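/- Let $n\ge 1$, $J>0$, $\phi\in\mathbb R$. For $N\ge n+2$ consider on the periodic chain of $N$ spins-$\tfrac12$ the Hamiltonian $$H^{(n)}_N=J\Big(\sin\phi\sum_{j}\sigma^y_j\sigma^y_{j+1}-\cos\phi\sum_j\sigma^x_j\,\sigma^z_{j+1}\cdots\sigma^z_{j+n}\,\sigma^x_{j+n+1}\Big),$$ let $Q=\prod_j\sigma^z_j$, and for $q=\pm1$ let $P_q=\tfrac12(1+qQ)$. (1) The Jordan–Wigner operators $c_j=\big(\prod_{i<j}\sigma^z_i\big)\sigma^-_j$ satisfy $c_j^\dagger=\big(\prod_{i<j}\sigma^z_i\big)\sigma^+_j$ and the canonical anticommutation relations, and $H^{(n)}_N=F_{1}P_1+F_{-1}P_{-1}$, where $F_q$ commutes with $Q$ and $$F_q=J\sin\phi\sum_{j=1}^N\big(c_j^\dagger c_{j+1}^\dagger-c_j^\dagger c_{j+1}+c_jc_{j+1}^\dagger-c_jc_{j+1}\big)+J\cos\phi\sum_{j=1}^N\big(c_j^\dagger c_{j+n+1}-c_jc_{j+n+1}^\dagger+c_j^\dagger c_{j+n+1}^\dagger-c_jc_{j+n+1}\big),$$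 with $c_{N+i}=-q\,c_i$. (2) Let $k$ run over the $N$ solutions in $[0,2\pi)$ of $e^{ikN}=-q$, and let $b_k=N^{-1/2}\sum_{j=1}^N c_je^{-ikj}$. The $b_k$ satisfy the canonical anticommutation relations and $$F_q=\sum_{0<k<\pi}h_k+\sum_{k\in\{0,\pi\}}\varepsilon_k(2b_k^\dagger b_k-1),\qquad h_k=2i\delta_k\big(b_k^\dagger b_{-k}^\dagger-b_{-k}b_k\big)+2\varepsilon_k\big(b_k^\dagger b_k+b_{-k}^\dagger b_{-k}-1\big),$$ where the second sum runs over those of the wave numbers $0,\pi$ that are allowed, $\delta_k=J(\sin((n+1)k)\cos\phi+\sin k\,\sin\phi)$ and $\varepsilon_k=J(\cos((n+1)k)\cos\phi-\cos k\,\sin\phi)$. The terms are independent: the Hilbert space has an orthonormal product basis of joint eigenvectors of the occupation numbers, labelled by one of the four states $|1_k,1_{-k}\rangle,|0_k,0_{-k}\rangle,|1_k,0_{-k}\rangle,|0_k,1_{-k}\rangle$ for each allowed $0<k<\pi$ and by an occupation number for each allowed $k\in\{0,\pi\}$, in which $h_k$ acts only on the label of the pair $\{k,-k\}$, by the matrix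 $$M_k=\begin{pmatrix}2\varepsilon_k&2i\delta_k&0&0\\-2i\delta_k&-2\varepsilon_k&0&0\\0&0&0&0\\0&0&0&0\end{pmatrix}.$$ (3) For every real $k$ the matrix $M_k$ is Hermitian, its ground state energy is $$E_k=-2\sqrt{\varepsilon_k^2+\delta_k^2}=-2J\sqrt{1-\cos((n+2)k)\sin 2\phi},$$ and its gap (here and below: the difference of the two lowest eigenvalues, counted with multiplicity) is $-E_k$. The ground state energy of $F_q$ is $\sum_{0<k<\pi}E_k-\sum_{k\in\{0,\pi\}}|\varepsilon_k|$. (4) As $N\to\infty$, for $q=\pm1$ both $\frac1N\sum_{0<k<\pi}E_k$ and the ground state energy of $H^{(n)}_N$ divided by $N$ converge to $$-\frac{J}{\pi}\int_0^\pi\sqrt{1-\cos((n+2)k)\sin2\phi}\,dk .$$ (5) The gap of $F_q$ is $\min_k(-E_k)$ over its $N$ allowed wave numbers, and it converges to $2J\sqrt{1-|\sin2\phi|}$ as $N\to\infty$. For $0\le\phi\le\pi/2$ this limit vanishes if and only if $\phi=\phi_c=\pi/4$, for every $n$; moreover, for $0\le k<2\pi$ the gap of the block $M_k$ vanishes if and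 only if $\phi=\pi/4$ and $k=\frac{2j\pi}{n+2}$ for some $j\in\{0,\dots,n+1\}$. -/

import Mathlib

open scoped Matrix
open Filter Topology

namespace ClusterIsing

noncomputable section

/-- Spin configurations of `N` sites; at each site `0` is spin up and `1` is spin down. The Hilbert
space of the chain is `EuclideanSpace ℂ (Config N)`. -/
abbrev Config (N : ℕ) := Fin N → Fin 2

/-- Operators on the chain, as matrices in the `σ^z` product basis. -/
abbrev Op (N : ℕ) := Matrix (Config N) (Config N) ℂ

def sigmaX : Matrix (Fin 2) (Fin 2) ℂ := !![0, 1; 1, 0]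

def sigmaY : Matrix (Fin 2) (Fin 2) ℂ := !![0, -Complex.I; Complex.I, 0]

def sigmaZ : Matrix (Fin 2) (Fin 2) ℂ := !![1, 0; 0, -1]

/-- The raising operator `(σ^x + i σ^y) / 2`. -/
def sigmaPlus : Matrix (Fin 2) (Fin 2) ℂ := !![0, 1; 0, 0]

/-- The lowering operator `(σ^x - i σ^y) / 2`. -/
def sigmaMinus : Matrix (Fin 2) (Fin 2) ℂ := !![0, 0; 1, 0]

/-- The one-site operator `A` acting on site `j`, tensored with the identity elsewhere. -/
def siteOp {N : ℕ} (A : Matrix (Fin 2) (Fin 2) ℂ) (j : Fin N) : Op N :=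
  Matrix.of fun s t => if ∀ i, i ≠ j → s i = t i then A (s j) (t j) else 0

/-- The site `j + a` on the periodic chain. -/
def shift {N : ℕ} (j : Fin N) (a : ℕ) : Fin N :=
  ⟨(j.val + a) % N, Nat.mod_lt _ j.pos⟩

/-- `O^z_{j,n} = ⨂_{k=1}^n σ^z_{j+k}`. -/
def clusterString {N : ℕ} (n : ℕ) (j : Fin N) : Op N :=
  ((List.range n).map fun i => siteOp sigmaZ (shift j (i + 1))).prod

/-- The `n`-cluster-Ising Hamiltonian on the periodic chain of `N` sites. -/
def hamiltonian (N n : ℕ) (J φ : ℝ) : Op N :=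
  (J : ℂ) • (((Real.sin φ : ℝ) : ℂ) •
      ∑ j : Fin N, siteOp sigmaY j * siteOp sigmaY (shift j 1)
    - ((Real.cos φ : ℝ) : ℂ) •
      ∑ j : Fin N, siteOp sigmaX j * clusterString n j * siteOp sigmaX (shift j (n + 1)))

/-- `⨂_{k<j} σ^z_k`. -/
def jwString {N : ℕ} (j : Fin N) : Op N :=
  (((List.finRange N).filter fun i => i < j).map fun i => siteOp sigmaZ i).prod

/-- The Jordan-Wigner fermion `c_j`. -/
def c {N : ℕ} (j : Fin N) : Op N := jwString j * siteOp sigmaMinus j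

/-- The parity `⨂_j σ^z_j`. -/
def parity (N : ℕ) : Op N :=
  ((List.finRange N).map fun i => siteOp sigmaZ i).prod

/-- The sign `q = ±1` as a complex number. -/
def sgn (q : ℤˣ) : ℂ := ((q : ℤ) : ℂ)

/-- The projection onto the sector of parity `q`. -/
def parityProj (N : ℕ) (q : ℤˣ) : Op N := (1 / 2 : ℂ) • (1 + sgn q • parity N)

/-- The fermion `c_{j+a}`, for `a ≤ N`, continued around the chain by `c_{N+i} = -q c_i`: in the
parity sector `q = 1` the fermions are antiperiodic, in the sector `q = -1` periodic. -/
def cShift {N : ℕ} (q : ℤˣ) (j : Fin N) (a : ℕ) : Op N :=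
  if j.val + a < N then c (shift j a) else (-sgn q) • c (shift j a)

/-- The quadratic fermionic Hamiltonian with boundary condition `q`. -/
def fermionHamiltonian (N n : ℕ) (J φ : ℝ) (q : ℤˣ) : Op N :=
  ((J * Real.sin φ : ℝ) : ℂ) • ∑ j : Fin N,
      ((c j)ᴴ * (cShift q j 1)ᴴ - (c j)ᴴ * cShift q j 1
        + c j * (cShift q j 1)ᴴ - c j * cShift q j 1)
  + ((J * Real.cos φ : ℝ) : ℂ) • ∑ j : Fin N,
      ((c j)ᴴ * cShift q j (n + 1) - c j * (cShift q j (n + 1))ᴴ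
        + (c j)ᴴ * (cShift q j (n + 1))ᴴ - c j * cShift q j (n + 1))

/-- Twice the offset of the wave numbers: half-integer modes if `q = 1`, integer if `q = -1`. -/
def offset (q : ℤˣ) : ℕ := if q = 1 then 1 else 0

/-- The allowed wave numbers `k = (2l + 1)π/N` (`q = 1`), `k = 2lπ/N` (`q = -1`), `0 ≤ l < N`;
they are the solutions of `exp (i k N) = -q` in `[0, 2π)`. -/
def waveNumber (N : ℕ) (q : ℤˣ) (l : Fin N) : ℝ :=
  ((2 * l.val + offset q : ℕ) : ℝ) * Real.pi / N

/-- The modes with `0 < k < π`, each of which represents the pair `{k, -k}`. -/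
def pairModes (N : ℕ) (q : ℤˣ) : Finset (Fin N) :=
  Finset.univ.filter fun l => 0 < 2 * l.val + offset q ∧ 2 * l.val + offset q < N

/-- The modes with `k = 0` or `k = π`, which are their own partners. -/
def selfModes (N : ℕ) (q : ℤˣ) : Finset (Fin N) :=
  Finset.univ.filter fun l => 2 * l.val + offset q = 0 ∨ 2 * l.val + offset q = N

/-- The Fourier transform `b_k = N^{-1/2} ∑_{j=1}^N c_j exp (-i k j)`; the site with index `j` in
`Fin N` has number `j + 1`. -/
def b (N : ℕ) (k : ℝ) : Op N :=
  ((1 / Real.sqrt N : ℝ) : ℂ) •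
    ∑ j : Fin N, Complex.exp (-(Complex.I * k * ((j.val : ℂ) + 1))) • c j

def delta (n : ℕ) (J φ k : ℝ) : ℝ :=
  J * (Real.sin ((n + 1) * k) * Real.cos φ + Real.sin k * Real.sin φ)

def epsilon (n : ℕ) (J φ k : ℝ) : ℝ :=
  J * (Real.cos ((n + 1) * k) * Real.cos φ - Real.cos k * Real.sin φ)

/-- The operator `h_k`. -/
def blockOp (N n : ℕ) (J φ k : ℝ) : Op N :=
  (2 * Complex.I * (delta n J φ k : ℂ)) • ((b N k)ᴴ * (b N (-k))ᴴ - b N (-k) * b N k)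
  + (2 * (epsilon n J φ k : ℂ)) • ((b N k)ᴴ * b N k + (b N (-k))ᴴ * b N (-k) - 1)

/-- The four-level matrix of `h_k` in the basis `|1_k,1_{-k}⟩, |0_k,0_{-k}⟩, |1_k,0_{-k}⟩,
|0_k,1_{-k}⟩`. -/
def blockMatrix (n : ℕ) (J φ k : ℝ) : Matrix (Fin 4) (Fin 4) ℂ :=
  !![2 * (epsilon n J φ k : ℂ), 2 * Complex.I * (delta n J φ k : ℂ), 0, 0;
     -(2 * Complex.I * (delta n J φ k : ℂ)), -(2 * (epsilon n J φ k : ℂ)), 0, 0;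
     0, 0, 0, 0;
     0, 0, 0, 0]

/-- The occupation of `k` in the four basis states of a block. -/
def occPlus : Fin 4 → ℂ := ![1, 0, 1, 0]

/-- The occupation of `-k` in the four basis states of a block. -/
def occMinus : Fin 4 → ℂ := ![1, 0, 0, 1]

/-- Labels of the product basis: one of four states for every pair `{k, -k}`, and an occupation
number for each of the self-paired modes `k = 0, π`. -/
abbrev BlockLabel (N : ℕ) (q : ℤˣ) :=
  (↥(pairModes N q) → Fin 4) × (↥(selfModes N q) → Fin 2)

/-- `E_k = -2 J √(1 - cos ((n+2)k) sin 2φ)`. -/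
def blockEnergy (n : ℕ) (J φ k : ℝ) : ℝ :=
  -2 * J * Real.sqrt (1 - Real.cos ((n + 2) * k) * Real.sin (2 * φ))

/-- `E` is the ground state energy of `A`: its least real eigenvalue. -/
def IsGroundEnergy {ι : Type*} [Fintype ι] [DecidableEq ι] (A : Matrix ι ι ℂ) (E : ℝ) : Prop :=
  IsLeast {x : ℝ | Module.End.HasEigenvalue (Matrix.toLin' A) (x : ℂ)} E

/-- `g` is the gap of `A` between the ground state and the first excited state, where eigenvalues
are counted with multiplicity (so that `g = 0` if the ground state is degenerate). -/
def HasGap {ι : Type*} [Fintype ι] [DecidableEq ι] (A : Matrix ι ι ℂ) (g : ℝ) : Prop :=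
  ∃ (e : OrthonormalBasis ι ℂ (EuclideanSpace ℂ ι)) (x : ι → ℝ) (i₀ : ι),
    (∀ i, Matrix.toEuclideanLin A (e i) = (x i : ℂ) • e i) ∧
    (∀ i, x i₀ ≤ x i) ∧
    IsLeast {d : ℝ | ∃ i, i ≠ i₀ ∧ d = x i - x i₀} g

end

end ClusterIsing

namespace ClusterIsing

noncomputable section

/-! ### One-site operators -/

/-! The chain is a system of free fermions. Attaching a string of σ^z to one-site operators that
anticommute with σ^z makes them anticommute at distinct sites, and in the product of two of them at
j and j+n+1 the strings cancel except on j, …, j+n. Hence every bond of the spin chain is quadratic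
in the fermions (`jw_mul_jw_shift`). A bond across the end of the chain leaves the complementary
string instead, which costs a factor -Q; on the sector Q = q this is the sign -q in the boundary
condition of F_q (`hamiltonian_eq`).

The wave numbers satisfy e^{ikN} = -q, so translation with this boundary condition is diagonal in
the modes b_k. In F_q the contributions that are odd under k ↦ -k cancel, and what remains couples k
to -k only (`fermionHamiltonian_eq_sum_blockOp`).

The spectral statements rest on an abstract fact about any family with the canonical anticommutation
relations: it has a vacuum, and the states created from it are orthonormal because their occupation
numbers differ. With N modes there are 2^N of them, the dimension of the Hilbert space, so they form
a basis. For the modes b_k this is the product basis (`exists_productBasis`). A Bogoliubov rotation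
by half the argument of ε_k + iδ_k gives new modes d_k with F_q = ∑ r_k (2 d_k† d_k - 1), r_k =
√(ε_k² + δ_k²), where k now runs over all allowed wave numbers
(`fermionHamiltonian_eq_sum_quasiMode`). So the ground energy is -∑ r_k and the gap is 2 min r_k,
and an addition formula evaluates r_k (`epsilon_sq_add_delta_sq`).

In the limit, -∑ r_k / N is a Riemann sum. The spin chain sees only the states of F_q with parity q,
but changing parity costs one quasiparticle, at most 4J whatever N is, so the energy density is the
same. The gap converges because the wave numbers become dense near a minimizer of r_k. -/

theorem siteOp_mulVec {N : ℕ} (A : Matrix (Fin 2) (Fin 2) ℂ) (j : Fin N) (v : Config N → ℂ)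
    (s : Config N) :
    (siteOp A j *ᵥ v) s = ∑ x : Fin 2, A (s j) x * v (Function.update s j x) := by
  simp only [Matrix.mulVec, dotProduct, siteOp, Matrix.of_apply, ite_mul, zero_mul]
  rw [← Finset.sum_filter]
  symm
  refine Finset.sum_bij (fun x _ => Function.update s j x) ?_ ?_ ?_ ?_
  · intro x _
    simp only [Finset.mem_filter, Finset.mem_univ, true_and]
    intro i hi
    simp [Function.update_of_ne hi]
  · intro x _ y _ h
    simpa using congrFun h j
  · intro t ht
    simp only [Finset.mem_filter, Finset.mem_univ, true_and] at ht
    refine ⟨t j, Finset.mem_univ _, ?_⟩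
    ext i
    by_cases hi : i = j
    · subst hi; simp
    · simp [Function.update_of_ne hi, ht i hi]
  · intro x _
    simp

/-- Identities of one-site operators are checked on vectors, where `siteOp_mulVec` leaves a sum over
two spin values instead of one over all configurations. -/
theorem op_ext {ι : Type*} [Fintype ι] {A B : Matrix ι ι ℂ}
    (h : ∀ (v : ι → ℂ) s, (A *ᵥ v) s = (B *ᵥ v) s) : A = B := by
  classical
  exact Matrix.ext_of_mulVec_single fun i => funext fun s => h _ s

theorem siteOp_mul {N : ℕ} (A B : Matrix (Fin 2) (Fin 2) ℂ) (j : Fin N) :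
    siteOp A j * siteOp B j = siteOp (A * B) j := by
  refine op_ext fun v s => ?_
  rw [← Matrix.mulVec_mulVec]
  simp only [siteOp_mulVec, Matrix.mul_apply, Fin.sum_univ_two, Function.update_self,
    Function.update_idem]
  ring

theorem siteOp_comm {N : ℕ} (A B : Matrix (Fin 2) (Fin 2) ℂ) {i j : Fin N} (h : i ≠ j) :
    siteOp A i * siteOp B j = siteOp B j * siteOp A i := by
  refine op_ext fun v s => ?_
  rw [← Matrix.mulVec_mulVec, ← Matrix.mulVec_mulVec]
  simp only [siteOp_mulVec, Fin.sum_univ_two, Function.update_of_ne h, Function.update_of_ne h.symm,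
    Function.update_comm h]
  ring

theorem siteOp_one {N : ℕ} (j : Fin N) : siteOp 1 j = (1 : Op N) := by
  refine op_ext fun v s => ?_
  rw [siteOp_mulVec]
  simp [Matrix.one_apply]

theorem siteOp_zero {N : ℕ} (j : Fin N) : siteOp 0 j = (0 : Op N) := by
  ext s t; simp [siteOp]

theorem siteOp_add {N : ℕ} (A B : Matrix (Fin 2) (Fin 2) ℂ) (j : Fin N) :
    siteOp (A + B) j = siteOp A j + siteOp B j := by
  ext s t
  simp only [siteOp, Matrix.of_apply, Matrix.add_apply]
  split_ifs <;> simp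

theorem siteOp_smul {N : ℕ} (z : ℂ) (A : Matrix (Fin 2) (Fin 2) ℂ) (j : Fin N) :
    siteOp (z • A) j = z • siteOp A j := by
  ext s t
  simp only [siteOp, Matrix.of_apply, Matrix.smul_apply]
  split_ifs <;> simp

theorem siteOp_conjTranspose {N : ℕ} (A : Matrix (Fin 2) (Fin 2) ℂ) (j : Fin N) :
    (siteOp A j)ᴴ = siteOp Aᴴ j := by
  ext s t
  simp only [siteOp, Matrix.of_apply, Matrix.conjTranspose_apply]
  by_cases h : ∀ i, i ≠ j → s i = t i
  · rw [if_pos h, if_pos fun i hi => (h i hi).symm]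
  · rw [if_neg h, if_neg fun h' => h fun i hi => (h' i hi).symm, star_zero]

/-! ### Strings of `σ^z` -/

/-- The eigenvalue of `σ^z`. -/
def zSign (x : Fin 2) : ℂ := if x = 0 then 1 else -1

theorem zSign_mul_self (x : Fin 2) : zSign x * zSign x = 1 := by
  unfold zSign; split_ifs <;> norm_num

theorem star_zSign (x : Fin 2) : star (zSign x) = zSign x := by
  unfold zSign; split_ifs <;> simp

/-- The product of `σ^z` over a set of sites. -/
def zString {N : ℕ} (T : Finset (Fin N)) : Op N :=
  Matrix.diagonal fun s => ∏ i ∈ T, zSign (s i)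

theorem zString_empty {N : ℕ} : zString (∅ : Finset (Fin N)) = 1 := by
  simp [zString]

theorem zString_singleton {N : ℕ} (j : Fin N) : zString {j} = siteOp sigmaZ j := by
  refine op_ext fun v s => ?_
  rw [siteOp_mulVec, zString, Matrix.mulVec_diagonal]
  simp only [Finset.prod_singleton, Fin.sum_univ_two]
  have : s j = 0 ∨ s j = 1 := by
    generalize s j = x
    fin_cases x <;> simp
  rcases this with h | h
  · have : Function.update s j 0 = s := by rw [← h]; simp
    simp [h, this, zSign, sigmaZ]
  · have : Function.update s j 1 = s := by rw [← h]; simp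
    simp [h, this, zSign, sigmaZ]

/-- Each σ^z squares to one, so sites common to both strings drop out. String identities thereby
become identities of finite sets. -/
theorem zString_mul {N : ℕ} (S T : Finset (Fin N)) :
    zString S * zString T = zString (symmDiff S T) := by
  simp only [zString, Matrix.diagonal_mul_diagonal]
  congr 1
  ext s
  have hS := Finset.prod_sdiff (f := fun i => zSign (s i)) (Finset.inter_subset_left (s₁ := S) (s₂ := T))
  have hT := Finset.prod_sdiff (f := fun i => zSign (s i)) (Finset.inter_subset_right (s₁ := S) (s₂ := T))
  rw [Finset.sdiff_inter_self_left] at hS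
  rw [Finset.sdiff_inter_self_right] at hT
  have hd : Disjoint (S \ T) (T \ S) := disjoint_sdiff_sdiff
  have hI : (∏ i ∈ S ∩ T, zSign (s i)) * (∏ i ∈ S ∩ T, zSign (s i)) = 1 := by
    rw [← Finset.prod_mul_distrib]
    exact Finset.prod_eq_one fun i _ => zSign_mul_self _
  rw [symmDiff_def, Finset.sup_eq_union, Finset.prod_union hd, ← hS, ← hT]
  linear_combination (∏ i ∈ S \ T, zSign (s i)) * (∏ i ∈ T \ S, zSign (s i)) * hI

theorem zString_comm {N : ℕ} (S T : Finset (Fin N)) :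
    zString S * zString T = zString T * zString S := by
  rw [zString_mul, zString_mul, symmDiff_comm]

theorem zString_mul_self {N : ℕ} (T : Finset (Fin N)) : zString T * zString T = 1 := by
  rw [zString_mul, symmDiff_self, Finset.bot_eq_empty, zString_empty]

theorem zString_conjTranspose {N : ℕ} (T : Finset (Fin N)) : (zString T)ᴴ = zString T := by
  rw [zString, Matrix.diagonal_conjTranspose]
  congr 1
  ext s
  simp only [Pi.star_apply, star_prod, star_zSign]

theorem list_prod_siteOp_sigmaZ {N : ℕ} {L : List (Fin N)} (hL : L.Nodup) :
    (L.map fun i => siteOp sigmaZ i).prod = zString L.toFinset := by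
  induction L with
  | nil => simp [zString_empty]
  | cons a L ih =>
    rw [List.nodup_cons] at hL
    rw [List.map_cons, List.prod_cons, ih hL.2, ← zString_singleton, zString_mul]
    congr 1
    ext i
    simp only [Finset.mem_symmDiff, Finset.mem_singleton, List.mem_toFinset, List.toFinset_cons,
      Finset.mem_insert]
    constructor
    · rintro (⟨h, _⟩ | ⟨h, _⟩) <;> tauto
    · rintro (h | h)
      · exact Or.inl ⟨h, h ▸ hL.1⟩
      · exact Or.inr ⟨h, fun h' => hL.1 (h' ▸ h)⟩

theorem zString_siteOp_of_notMem {N : ℕ} {T : Finset (Fin N)} {j : Fin N} (hj : j ∉ T)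
    (A : Matrix (Fin 2) (Fin 2) ℂ) : zString T * siteOp A j = siteOp A j * zString T := by
  induction T using Finset.induction_on with
  | empty => simp [zString_empty]
  | insert a T ha ih =>
    rw [Finset.mem_insert, not_or] at hj
    have : insert a T = symmDiff {a} T := by
      rw [(Finset.disjoint_singleton_left.2 ha).symmDiff_eq_sup]; rfl
    rw [this, ← zString_mul, mul_assoc, ih hj.2, ← mul_assoc, zString_singleton,
      siteOp_comm _ _ (Ne.symm hj.1), mul_assoc]

/-- A one-site operator that anticommutes with `σ^z`. -/
def OddSite (A : Matrix (Fin 2) (Fin 2) ℂ) : Prop := sigmaZ * A = -(A * sigmaZ)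

theorem oddSite_of_diag {A : Matrix (Fin 2) (Fin 2) ℂ} (h0 : A 0 0 = 0) (h1 : A 1 1 = 0) :
    OddSite A := by
  unfold OddSite sigmaZ
  ext i j
  fin_cases i <;> fin_cases j <;> simp [Matrix.mul_apply, Fin.sum_univ_two, h0, h1]

theorem siteOp_neg {N : ℕ} (A : Matrix (Fin 2) (Fin 2) ℂ) (j : Fin N) :
    siteOp (-A) j = -siteOp A j := by
  rw [← neg_one_smul ℂ A, siteOp_smul, neg_one_smul]

theorem zString_siteOp_of_mem {N : ℕ} {T : Finset (Fin N)} {j : Fin N} (hj : j ∈ T)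
    {A : Matrix (Fin 2) (Fin 2) ℂ} (hA : OddSite A) :
    zString T * siteOp A j = -(siteOp A j * zString T) := by
  have : T = symmDiff {j} (T.erase j) := by
    rw [(Finset.disjoint_singleton_left.2 (Finset.notMem_erase j T)).symmDiff_eq_sup]
    exact (Finset.insert_erase hj).symm
  rw [this, ← zString_mul, mul_assoc, zString_siteOp_of_notMem (Finset.notMem_erase j T),
    ← mul_assoc, zString_singleton, siteOp_mul, hA, siteOp_neg, ← siteOp_mul, neg_mul, mul_assoc]

theorem jwString_eq {N : ℕ} (j : Fin N) : jwString j = zString (Finset.Iio j) := by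
  rw [jwString, list_prod_siteOp_sigmaZ ((List.nodup_finRange N).filter _)]
  congr 1
  ext i
  simp

theorem parity_eq (N : ℕ) : parity N = zString Finset.univ := by
  rw [parity, list_prod_siteOp_sigmaZ (List.nodup_finRange N)]
  congr 1
  ext i
  simp

/-! ### Jordan-Wigner fermions -/

/-- A one-site operator with its Jordan-Wigner string. -/
def jw {N : ℕ} (A : Matrix (Fin 2) (Fin 2) ℂ) (j : Fin N) : Op N :=
  zString (Finset.Iio j) * siteOp A j

theorem jw_conjTranspose {N : ℕ} (A : Matrix (Fin 2) (Fin 2) ℂ) (j : Fin N) :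
    (jw A j)ᴴ = jw Aᴴ j := by
  rw [jw, Matrix.conjTranspose_mul, siteOp_conjTranspose, zString_conjTranspose, jw,
    zString_siteOp_of_notMem (by simp)]

theorem jw_mul_self {N : ℕ} (A B : Matrix (Fin 2) (Fin 2) ℂ) (j : Fin N) :
    jw A j * jw B j = siteOp (A * B) j := by
  rw [jw, jw, mul_assoc, ← mul_assoc (siteOp A j), ← zString_siteOp_of_notMem (by simp),
    ← mul_assoc, ← mul_assoc, zString_mul_self, one_mul, siteOp_mul]

theorem jw_mul_of_lt {N : ℕ} {A : Matrix (Fin 2) (Fin 2) ℂ} (hA : OddSite A)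
    (B : Matrix (Fin 2) (Fin 2) ℂ) {i j : Fin N} (h : i < j) :
    jw A i * jw B j
      = -(zString (symmDiff (Finset.Iio i) (Finset.Iio j)) * (siteOp A i * siteOp B j)) := by
  have h1 : siteOp A i * zString (Finset.Iio j) = -(zString (Finset.Iio j) * siteOp A i) := by
    rw [zString_siteOp_of_mem (by simpa using h) hA, neg_neg]
  rw [jw, jw, mul_assoc, ← mul_assoc (siteOp A i), h1, ← zString_mul]
  simp only [neg_mul, mul_neg, mul_assoc]

theorem jw_mul_of_gt {N : ℕ} (A B : Matrix (Fin 2) (Fin 2) ℂ) {i j : Fin N} (h : j < i) :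
    jw A i * jw B j
      = zString (symmDiff (Finset.Iio i) (Finset.Iio j)) * (siteOp A i * siteOp B j) := by
  have h1 : siteOp A i * zString (Finset.Iio j) = zString (Finset.Iio j) * siteOp A i := by
    rw [zString_siteOp_of_notMem (by simpa using h.le)]
  rw [jw, jw, mul_assoc, ← mul_assoc (siteOp A i), h1, ← zString_mul]
  simp only [mul_assoc]

/-- Of two distinct sites exactly one lies in the string of the other, so reordering the factors
produces exactly one sign. -/
theorem jw_anticomm {N : ℕ} {A B : Matrix (Fin 2) (Fin 2) ℂ} (hA : OddSite A) (hB : OddSite B)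
    {i j : Fin N} (h : i ≠ j) : jw A i * jw B j + jw B j * jw A i = 0 := by
  rcases lt_or_gt_of_ne h with h' | h'
  · rw [jw_mul_of_lt hA B h', jw_mul_of_gt B A h', symmDiff_comm, siteOp_comm B A h.symm,
      neg_add_cancel]
  · rw [jw_mul_of_gt A B h', jw_mul_of_lt hB A h', symmDiff_comm, siteOp_comm B A h.symm,
      add_neg_cancel]

theorem jw_parity {N : ℕ} {A : Matrix (Fin 2) (Fin 2) ℂ} (hA : OddSite A) (j : Fin N) :
    parity N * jw A j = -(jw A j * parity N) := by
  rw [parity_eq, jw, ← mul_assoc, zString_comm, mul_assoc,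
    zString_siteOp_of_mem (Finset.mem_univ j) hA, mul_neg, mul_assoc]

theorem oddSite_sigmaMinus : OddSite sigmaMinus := oddSite_of_diag rfl rfl
theorem oddSite_sigmaPlus : OddSite sigmaPlus := oddSite_of_diag rfl rfl
theorem oddSite_sigmaX : OddSite sigmaX := oddSite_of_diag rfl rfl
theorem oddSite_sigmaY : OddSite sigmaY := oddSite_of_diag rfl rfl

theorem sigmaMinus_conjTranspose : sigmaMinusᴴ = sigmaPlus := by
  ext i j
  fin_cases i <;> fin_cases j <;> simp [sigmaMinus, sigmaPlus]

theorem c_eq {N : ℕ} (j : Fin N) : c j = jw sigmaMinus j := by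
  rw [c, jwString_eq, jw]

theorem c_conjTranspose {N : ℕ} (j : Fin N) : (c j)ᴴ = jw sigmaPlus j := by
  rw [c_eq, jw_conjTranspose, sigmaMinus_conjTranspose]

theorem c_anticomm {N : ℕ} (i j : Fin N) : c i * c j + c j * c i = 0 := by
  rw [c_eq, c_eq]
  by_cases h : i = j
  · subst h
    have : sigmaMinus * sigmaMinus = 0 := by
      ext i j
      fin_cases i <;> fin_cases j <;> simp [sigmaMinus]
    rw [jw_mul_self, this, siteOp_zero, add_zero]
  · exact jw_anticomm oddSite_sigmaMinus oddSite_sigmaMinus h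

theorem c_anticomm_conjTranspose {N : ℕ} (i j : Fin N) :
    c i * (c j)ᴴ + (c j)ᴴ * c i = if i = j then 1 else 0 := by
  rw [c_conjTranspose, c_eq]
  split_ifs with h
  · subst h
    have : sigmaMinus * sigmaPlus + sigmaPlus * sigmaMinus = 1 := by
      ext i j
      fin_cases i <;> fin_cases j <;> simp [sigmaMinus, sigmaPlus]
    rw [jw_mul_self, jw_mul_self, ← siteOp_add, this, siteOp_one]
  · exact jw_anticomm oddSite_sigmaMinus oddSite_sigmaPlus h

theorem parity_c {N : ℕ} (j : Fin N) : parity N * c j = -(c j * parity N) := by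
  rw [c_eq, jw_parity oddSite_sigmaMinus]

theorem parity_c_conjTranspose {N : ℕ} (j : Fin N) :
    parity N * (c j)ᴴ = -((c j)ᴴ * parity N) := by
  rw [c_conjTranspose, jw_parity oddSite_sigmaPlus]

theorem parity_mul_self (N : ℕ) : parity N * parity N = 1 := by
  rw [parity_eq, zString_mul_self]

/-! ### The spin chain in terms of fermions -/

/-- The `n` sites that follow `j` on the periodic chain. -/
def arc {N : ℕ} (n : ℕ) (j : Fin N) : Finset (Fin N) :=
  Finset.univ.filter fun i =>
    (j.val < i.val ∧ i.val < j.val + n + 1) ∨ i.val + N < j.val + n + 1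

theorem shift_val {N : ℕ} (j : Fin N) {a : ℕ} (ha : a ≤ N) :
    (shift j a).val = if j.val + a < N then j.val + a else j.val + a - N := by
  have hj := j.isLt
  simp only [shift]
  split_ifs with h
  · exact Nat.mod_eq_of_lt h
  · rw [Nat.mod_eq_sub_mod (by omega), Nat.mod_eq_of_lt (by omega)]

theorem clusterString_eq {N n : ℕ} (hn : n + 1 < N) (j : Fin N) :
    clusterString n j = zString (arc n j) := by
  have hj := j.isLt
  have hmap : (List.range n).map (fun i => siteOp sigmaZ (shift j (i + 1)))
      = ((List.range n).map fun i => shift j (i + 1)).map fun i => siteOp sigmaZ i := by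
    rw [List.map_map]; rfl
  have hnd : ((List.range n).map fun i => shift j (i + 1)).Nodup := by
    refine List.Nodup.map_on ?_ List.nodup_range
    intro x hx y hy hxy
    rw [List.mem_range] at hx hy
    have h := congrArg Fin.val hxy
    rw [shift_val j (by omega), shift_val j (by omega)] at h
    split_ifs at h <;> omega
  rw [clusterString, hmap, list_prod_siteOp_sigmaZ hnd]
  congr 1
  ext i
  have hi := i.isLt
  simp only [List.mem_toFinset, List.mem_map, List.mem_range, arc, Finset.mem_filter,
    Finset.mem_univ, true_and]
  constructor
  · rintro ⟨t, ht, h⟩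
    have h := congrArg Fin.val h
    rw [shift_val j (by omega)] at h
    split_ifs at h <;> omega
  · rintro (h | h)
    · refine ⟨i.val - j.val - 1, by omega, Fin.ext ?_⟩
      rw [shift_val j (by omega)]
      split_ifs <;> omega
    · refine ⟨i.val + N - j.val - 1, by omega, Fin.ext ?_⟩
      rw [shift_val j (by omega)]
      split_ifs <;> omega

theorem notMem_arc {N n : ℕ} (hn : n + 1 < N) (j : Fin N) : j ∉ arc n j := by
  simp only [arc, Finset.mem_filter, Finset.mem_univ, true_and]
  omega

theorem symmDiff_Iio_of_lt {N n : ℕ} (hn : n + 1 < N) {j : Fin N} (h : j.val + (n + 1) < N) :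
    symmDiff (Finset.Iio j) (Finset.Iio (shift j (n + 1))) = symmDiff {j} (arc n j) := by
  ext i
  have hi := i.isLt
  have hs := shift_val j hn.le
  rw [if_pos h] at hs
  simp only [arc, Finset.mem_symmDiff, Finset.mem_Iio, Finset.mem_singleton, Finset.mem_filter,
    Finset.mem_univ, true_and, Fin.lt_def, Fin.ext_iff, hs]
  omega

/-- When the bond wraps around, the two strings leave the sites outside the bond; the symmetric
difference with `univ`, that is, multiplication by the parity, takes the complement. -/
theorem symmDiff_Iio_of_ge {N n : ℕ} (hn : n + 1 < N) {j : Fin N} (h : ¬ j.val + (n + 1) < N) :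
    symmDiff (symmDiff (Finset.Iio j) (Finset.Iio (shift j (n + 1)))) Finset.univ
      = symmDiff {j} (arc n j) := by
  ext i
  have hi := i.isLt
  have hj := j.isLt
  have hs := shift_val j hn.le
  rw [if_neg h] at hs
  simp only [arc, Finset.mem_symmDiff, Finset.mem_Iio, Finset.mem_singleton, Finset.mem_filter,
    Finset.mem_univ, true_and, not_true_eq_false, and_false, false_or, Fin.lt_def, Fin.ext_iff, hs]
  omega

/-- The sign of `c_{j+a}` relative to the fermion at the same site. -/
def wrapSign {N : ℕ} (q : ℤˣ) (j : Fin N) (a : ℕ) : ℂ := if j.val + a < N then 1 else -sgn q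

theorem star_sgn (q : ℤˣ) : star (sgn q) = sgn q := by
  rcases Int.units_eq_one_or q with rfl | rfl <;> simp [sgn]

theorem star_wrapSign {N : ℕ} (q : ℤˣ) (j : Fin N) (a : ℕ) :
    star (wrapSign q j a) = wrapSign q j a := by
  unfold wrapSign
  split_ifs
  · exact star_one ℂ
  · rw [star_neg, star_sgn]

theorem cShift_eq {N : ℕ} (q : ℤˣ) (j : Fin N) (a : ℕ) :
    cShift q j a = wrapSign q j a • c (shift j a) := by
  unfold cShift wrapSign
  split_ifs <;> simp

theorem cShift_conjTranspose {N : ℕ} (q : ℤˣ) (j : Fin N) (a : ℕ) :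
    (cShift q j a)ᴴ = wrapSign q j a • (c (shift j a))ᴴ := by
  rw [cShift_eq, Matrix.conjTranspose_smul, star_wrapSign]

/-- On the range of P_q the number -q equals the operator -Q, so the two boundary conditions combine
into one sector-independent factor. -/
theorem sum_wrapSign_parityProj {N : ℕ} (j : Fin N) (a : ℕ) :
    wrapSign 1 j a • parityProj N 1 + wrapSign (-1) j a • parityProj N (-1)
      = if j.val + a < N then 1 else -parity N := by
  unfold wrapSign parityProj sgn
  split_ifs <;> push_cast <;> module

theorem jw_add {N : ℕ} (A B : Matrix (Fin 2) (Fin 2) ℂ) (j : Fin N) :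
    jw (A + B) j = jw A j + jw B j := by
  rw [jw, siteOp_add, mul_add, jw, jw]

theorem jw_smul {N : ℕ} (z : ℂ) (A : Matrix (Fin 2) (Fin 2) ℂ) (j : Fin N) :
    jw (z • A) j = z • jw A j := by
  rw [jw, siteOp_smul, mul_smul_comm, jw]

theorem c_conjTranspose_add_c {N : ℕ} (j : Fin N) : (c j)ᴴ + c j = jw sigmaX j := by
  rw [c_conjTranspose, c_eq, ← jw_add]
  congr 1
  ext i j
  fin_cases i <;> fin_cases j <;> simp [sigmaMinus, sigmaPlus, sigmaX]

theorem c_conjTranspose_sub_c {N : ℕ} (j : Fin N) :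
    (c j)ᴴ - c j = Complex.I • jw sigmaY j := by
  rw [c_conjTranspose, c_eq, sub_eq_add_neg, ← neg_one_smul ℂ, ← jw_smul, ← jw_add, ← jw_smul]
  congr 1
  ext i j
  fin_cases i <;> fin_cases j <;> simp [sigmaMinus, sigmaPlus, sigmaY]

/-- Both cases carry the same overall sign: without wrapping, A at j anticommutes with the longer
string of B; with wrapping, nothing has to be exchanged and the sign is that of -Q. -/
theorem jw_mul_jw_shift {N n : ℕ} (hn : n + 1 < N) {A B : Matrix (Fin 2) (Fin 2) ℂ}
    (hA : OddSite A) (hB : OddSite B) (j : Fin N) :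
    jw A j * jw B (shift j (n + 1)) * (if j.val + (n + 1) < N then 1 else -parity N)
      = -(siteOp (sigmaZ * A) j * clusterString n j * siteOp B (shift j (n + 1))) := by
  have hj := j.isLt
  have hs := shift_val j hn.le
  -- The σ^z at j itself is absorbed into A; the rest of the string is the cluster string.
  have hstr : zString (symmDiff {j} (arc n j)) * (siteOp A j * siteOp B (shift j (n + 1)))
      = siteOp (sigmaZ * A) j * clusterString n j * siteOp B (shift j (n + 1)) := by
    rw [← zString_mul, zString_singleton, clusterString_eq hn, mul_assoc,
      ← mul_assoc (zString _) (siteOp A j), zString_siteOp_of_notMem (notMem_arc hn j),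
      ← siteOp_mul]
    simp only [mul_assoc]
  split_ifs at hs ⊢ with h
  · rw [mul_one, jw_mul_of_lt hA B (by rw [Fin.lt_def, hs]; omega), symmDiff_Iio_of_lt hn h, hstr]
  · have hQ : siteOp A j * siteOp B (shift j (n + 1)) * parity N
        = parity N * (siteOp A j * siteOp B (shift j (n + 1))) := by
      rw [parity_eq, ← mul_assoc, zString_siteOp_of_mem (Finset.mem_univ _) hA, neg_mul,
        mul_assoc (siteOp A j) (zString _), zString_siteOp_of_mem (Finset.mem_univ _) hB,
        mul_neg, neg_neg, mul_assoc]
    rw [jw_mul_of_gt A B (by rw [Fin.lt_def, hs]; omega), mul_neg, mul_assoc, hQ, ← mul_assoc,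
      parity_eq, zString_mul, symmDiff_Iio_of_ge hn h, hstr]

theorem isingBond {N : ℕ} (hN : 1 < N) (j : Fin N) :
    ((c j)ᴴ + c j) * ((c (shift j 1))ᴴ - c (shift j 1))
        * (if j.val + 1 < N then 1 else -parity N)
      = siteOp sigmaY j * siteOp sigmaY (shift j 1) := by
  -- The Ising bond is the cluster bond with an empty cluster.
  have h := jw_mul_jw_shift (n := 0) hN oddSite_sigmaX oddSite_sigmaY j
  have hZX : sigmaZ * sigmaX = Complex.I • sigmaY := by
    ext i j
    fin_cases i <;> fin_cases j <;> simp [sigmaZ, sigmaX, sigmaY]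
  have hcl : clusterString 0 j = 1 := by simp [clusterString]
  rw [zero_add, hcl, mul_one, hZX, siteOp_smul] at h
  rw [c_conjTranspose_add_c, c_conjTranspose_sub_c, mul_smul_comm, smul_mul_assoc, h,
    smul_mul_assoc, smul_neg, smul_smul, Complex.I_mul_I, neg_one_smul, neg_neg]

theorem clusterBond {N n : ℕ} (hn : n + 1 < N) (j : Fin N) :
    ((c j)ᴴ - c j) * ((c (shift j (n + 1)))ᴴ + c (shift j (n + 1)))
        * (if j.val + (n + 1) < N then 1 else -parity N)
      = -(siteOp sigmaX j * clusterString n j * siteOp sigmaX (shift j (n + 1))) := by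
  have h := jw_mul_jw_shift hn oddSite_sigmaY oddSite_sigmaX j
  have hZY : sigmaZ * sigmaY = (-Complex.I) • sigmaX := by
    ext i j
    fin_cases i <;> fin_cases j <;> simp [sigmaZ, sigmaX, sigmaY]
  rw [hZY, siteOp_smul] at h
  rw [c_conjTranspose_add_c, c_conjTranspose_sub_c, smul_mul_assoc, smul_mul_assoc, h,
    smul_mul_assoc, smul_mul_assoc, smul_neg, smul_smul]
  simp

theorem fermionHamiltonian_eq {N : ℕ} (n : ℕ) (J φ : ℝ) (q : ℤˣ) :
    fermionHamiltonian N n J φ q =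
      ((J * Real.sin φ : ℝ) : ℂ) • ∑ j : Fin N, wrapSign q j 1 •
        (((c j)ᴴ + c j) * ((c (shift j 1))ᴴ - c (shift j 1)))
      + ((J * Real.cos φ : ℝ) : ℂ) • ∑ j : Fin N, wrapSign q j (n + 1) •
        (((c j)ᴴ - c j) * ((c (shift j (n + 1)))ᴴ + c (shift j (n + 1)))) := by
  unfold fermionHamiltonian
  congr 2
  · refine Finset.sum_congr rfl fun j _ => ?_
    rw [cShift_conjTranspose, cShift_eq]
    simp only [mul_smul_comm, add_mul, mul_sub, smul_add, smul_sub]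
    abel
  · refine Finset.sum_congr rfl fun j _ => ?_
    rw [cShift_conjTranspose, cShift_eq]
    simp only [mul_smul_comm, sub_mul, mul_add, smul_add, smul_sub]
    abel

theorem hamiltonian_eq {N n : ℕ} (hn : n + 2 ≤ N) (J φ : ℝ) :
    hamiltonian N n J φ = fermionHamiltonian N n J φ 1 * parityProj N 1
      + fermionHamiltonian N n J φ (-1) * parityProj N (-1) := by
  -- The sector enters the fermionic Hamiltonian only through the wrapping signs, so both kinds of
  -- bond are recombined by the same computation.
  have key : ∀ (a : ℕ) (X : Fin N → Op N),
      (∑ j, wrapSign 1 j a • X j) * parityProj N 1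
        + (∑ j, wrapSign (-1) j a • X j) * parityProj N (-1)
      = ∑ j, X j * (if j.val + a < N then 1 else -parity N) := by
    intro a X
    rw [Finset.sum_mul, Finset.sum_mul, ← Finset.sum_add_distrib]
    refine Finset.sum_congr rfl fun j _ => ?_
    rw [← sum_wrapSign_parityProj, mul_add, smul_mul_assoc, smul_mul_assoc, mul_smul_comm,
      mul_smul_comm]
  have k1 := key 1 fun j => ((c j)ᴴ + c j) * ((c (shift j 1))ᴴ - c (shift j 1))
  have k2 := key (n + 1) fun j =>
    ((c j)ᴴ - c j) * ((c (shift j (n + 1)))ᴴ + c (shift j (n + 1)))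
  rw [Finset.sum_congr rfl fun j _ => isingBond (by omega) j] at k1
  rw [Finset.sum_congr rfl fun j _ => clusterBond (by omega) j, Finset.sum_neg_distrib] at k2
  rw [fermionHamiltonian_eq, fermionHamiltonian_eq, hamiltonian, add_mul, add_mul,
    add_add_add_comm, smul_mul_assoc, smul_mul_assoc, smul_mul_assoc, smul_mul_assoc,
    ← smul_add, ← smul_add, k1, k2, smul_sub, smul_smul, smul_smul, smul_neg, sub_eq_add_neg]
  push_cast
  rfl

theorem commute_parity_mul {N : ℕ} {A B : Op N} (hA : parity N * A = -(A * parity N))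
    (hB : parity N * B = -(B * parity N)) : Commute (A * B) (parity N) := by
  unfold Commute SemiconjBy
  rw [← mul_assoc (parity N), hA, neg_mul, mul_assoc A (parity N), hB, mul_neg, neg_neg, mul_assoc]

theorem fermionHamiltonian_commute_parity {N : ℕ} (n : ℕ) (J φ : ℝ) (q : ℤˣ) :
    Commute (fermionHamiltonian N n J φ q) (parity N) := by
  have h1 : ∀ j : Fin N, parity N * ((c j)ᴴ + c j) = -(((c j)ᴴ + c j) * parity N) := fun j => by
    rw [mul_add, add_mul, parity_c, parity_c_conjTranspose, neg_add]
  have h2 : ∀ j : Fin N, parity N * ((c j)ᴴ - c j) = -(((c j)ᴴ - c j) * parity N) := fun j => by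
    rw [mul_sub, sub_mul, parity_c, parity_c_conjTranspose, neg_sub, sub_neg_eq_add]
    abel
  rw [fermionHamiltonian_eq]
  refine Commute.add_left (Commute.smul_left ?_ _) (Commute.smul_left ?_ _)
  · exact Commute.sum_left _ _ _ fun j _ =>
      Commute.smul_left (commute_parity_mul (h1 _) (h2 _)) _
  · exact Commute.sum_left _ _ _ fun j _ =>
      Commute.smul_left (commute_parity_mul (h2 _) (h1 _)) _

/-! ### Fermionic modes and occupation states -/

/-- The canonical anticommutation relations. -/
structure IsCAR {κ ι : Type*} [DecidableEq κ] [Fintype ι] [DecidableEq ι]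
    (a : κ → Matrix ι ι ℂ) : Prop where
  anti : ∀ i j, a i * a j + a j * a i = 0
  anti_star : ∀ i j, a i * (a j)ᴴ + (a j)ᴴ * a i = if i = j then 1 else 0

/-- The state obtained from `v` by creating the modes of the list `L`. -/
def fock {κ ι : Type*} [Fintype ι] [DecidableEq ι] (a : κ → Matrix ι ι ℂ) (v : ι → ℂ)
    (L : List κ) : ι → ℂ :=
  (L.map fun i => (a i)ᴴ).prod *ᵥ v

theorem star_dotProduct_mulVec {ι : Type*} [Fintype ι] (A : Matrix ι ι ℂ)
    (x y : ι → ℂ) :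
    star x ⬝ᵥ (A *ᵥ y) = star (Aᴴ *ᵥ x) ⬝ᵥ y := by
  rw [Matrix.star_mulVec, Matrix.conjTranspose_conjTranspose, Matrix.dotProduct_mulVec]

section FockList

variable {κ ι : Type*} [Fintype ι] [DecidableEq ι] {a : κ → Matrix ι ι ℂ}

theorem fock_nil (v : ι → ℂ) : fock a v [] = v := by simp [fock]

theorem fock_cons (v : ι → ℂ) (i : κ) (L : List κ) :
    fock a v (i :: L) = (a i)ᴴ *ᵥ fock a v L := by
  simp [fock, Matrix.mulVec_mulVec]

theorem fock_append (v : ι → ℂ) (L L' : List κ) :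
    fock a v (L ++ L') = fock a (fock a v L') L := by
  simp [fock, Matrix.mulVec_mulVec]

variable {v : ι → ℂ}

/-- An even operator built from other modes passes a creation operator. -/
theorem mulVec_fock_of_commute {H : Matrix ι ι ℂ} {L : List κ}
    (hH : ∀ i ∈ L, Commute H (a i)ᴴ) :
    H *ᵥ fock a v L = fock a (H *ᵥ v) L := by
  induction L with
  | nil => rw [fock_nil, fock_nil]
  | cons i L ih =>
    rw [fock_cons, fock_cons, ← ih fun i hi => hH i (List.mem_cons_of_mem _ hi),
      Matrix.mulVec_mulVec, Matrix.mulVec_mulVec, (hH i List.mem_cons_self).eq]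

end FockList

section Fock

variable {κ ι : Type*} [DecidableEq κ] [Fintype ι] [DecidableEq ι] {a : κ → Matrix ι ι ℂ}

theorem IsCAR.anti_conjTranspose (h : IsCAR a) (i j : κ) :
    (a i)ᴴ * (a j)ᴴ + (a j)ᴴ * (a i)ᴴ = 0 := by
  rw [← Matrix.conjTranspose_mul, ← Matrix.conjTranspose_mul, ← Matrix.conjTranspose_add,
    h.anti, Matrix.conjTranspose_zero]

theorem IsCAR.mul_self (h : IsCAR a) (i : κ) : a i * a i = 0 := by
  have := h.anti i i
  rwa [← two_smul ℂ, smul_eq_zero_iff_right two_ne_zero] at this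

theorem IsCAR.mul_comm (h : IsCAR a) (i j : κ) : a i * a j = -(a j * a i) :=
  eq_neg_of_add_eq_zero_left (h.anti i j)

theorem IsCAR.conjTranspose_mul_comm (h : IsCAR a) (i j : κ) :
    (a i)ᴴ * (a j)ᴴ = -((a j)ᴴ * (a i)ᴴ) :=
  eq_neg_of_add_eq_zero_left (h.anti_conjTranspose i j)

theorem IsCAR.mul_conjTranspose_of_ne (h : IsCAR a) {i j : κ} (hij : i ≠ j) :
    a i * (a j)ᴴ = -((a j)ᴴ * a i) := by
  have := h.anti_star i j
  rw [if_neg hij] at this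
  exact eq_neg_of_add_eq_zero_left this

theorem IsCAR.mul_conjTranspose_self (h : IsCAR a) (i : κ) :
    a i * (a i)ᴴ = 1 - (a i)ᴴ * a i := by
  have := h.anti_star i i
  rw [if_pos rfl] at this
  exact eq_sub_of_add_eq this

/-- Modes are emptied one at a time: if a_m does not kill v, then a_m v is nonzero, is killed by a_m
since a_m² = 0, and is still killed by the earlier modes by anticommutation. -/
theorem IsCAR.exists_vacuum_list (h : IsCAR a) [Nonempty ι] (L : List κ) :
    ∃ v : ι → ℂ, v ≠ 0 ∧ ∀ i ∈ L, a i *ᵥ v = 0 := by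
  induction L with
  | nil => exact ⟨fun _ => 1, Function.ne_iff.2 ⟨Classical.arbitrary ι, one_ne_zero⟩, by simp⟩
  | cons m L ih =>
    obtain ⟨v, hv, hL⟩ := ih
    by_cases hm : a m *ᵥ v = 0
    · exact ⟨v, hv, by simpa [hm] using hL⟩
    · refine ⟨a m *ᵥ v, hm, fun i hi => ?_⟩
      rcases List.mem_cons.1 hi with rfl | hi
      · rw [Matrix.mulVec_mulVec, h.mul_self, Matrix.zero_mulVec]
      · rw [Matrix.mulVec_mulVec, h.mul_comm, Matrix.neg_mulVec, ← Matrix.mulVec_mulVec, hL i hi,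
          Matrix.mulVec_zero, neg_zero]

theorem IsCAR.exists_vacuum [Fintype κ] [Nonempty ι] (h : IsCAR a) :
    ∃ v : ι → ℂ, star v ⬝ᵥ v = 1 ∧ ∀ i, a i *ᵥ v = 0 := by
  obtain ⟨v, hv, hL⟩ := h.exists_vacuum_list Finset.univ.toList
  have hne : ‖WithLp.toLp 2 v‖ ≠ 0 := by simpa using hv
  refine ⟨((‖WithLp.toLp 2 v‖⁻¹ : ℝ) : ℂ) • v, ?_, fun i => ?_⟩
  · have hn : star v ⬝ᵥ v = ((‖WithLp.toLp 2 v‖ : ℝ) : ℂ) ^ 2 := by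
      have := inner_self_eq_norm_sq_to_K (𝕜 := ℂ) (WithLp.toLp 2 v)
      rw [EuclideanSpace.inner_eq_star_dotProduct] at this
      rw [dotProduct_comm]
      exact this
    have hne' : ((‖WithLp.toLp 2 v‖ : ℝ) : ℂ) ≠ 0 := by exact_mod_cast hne
    rw [star_smul, smul_dotProduct, dotProduct_smul, hn, smul_smul, smul_eq_mul,
      Complex.star_def, Complex.conj_ofReal, Complex.ofReal_inv]
    field_simp
  · rw [Matrix.mulVec_smul, hL i (by simp), smul_zero]

variable {v : ι → ℂ}

theorem IsCAR.mulVec_fock_of_notMem (h : IsCAR a) {m : κ} (hv : a m *ᵥ v = 0) {L : List κ}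
    (hm : m ∉ L) : a m *ᵥ fock a v L = 0 := by
  induction L with
  | nil => rwa [fock_nil]
  | cons i L ih =>
    rw [List.mem_cons, not_or] at hm
    rw [fock_cons, Matrix.mulVec_mulVec, h.mul_conjTranspose_of_ne hm.1, Matrix.neg_mulVec,
      ← Matrix.mulVec_mulVec, ih hm.2, Matrix.mulVec_zero, neg_zero]

theorem IsCAR.mul_conjTranspose_mulVec (h : IsCAR a) {m : κ} {w : ι → ℂ} (hw : a m *ᵥ w = 0) :
    a m *ᵥ ((a m)ᴴ *ᵥ w) = w := by
  rw [Matrix.mulVec_mulVec, h.mul_conjTranspose_self, Matrix.sub_mulVec, ← Matrix.mulVec_mulVec,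
    hw, Matrix.mulVec_zero, sub_zero, Matrix.one_mulVec]

theorem commute_mul_of_anti {R : Type*} [Ring R] {x y z : R} (hx : x * z = -(z * x))
    (hy : y * z = -(z * y)) : Commute (x * y) z := by
  unfold Commute SemiconjBy
  rw [mul_assoc, hy, mul_neg, ← mul_assoc, hx, neg_mul, neg_neg, mul_assoc]

theorem IsCAR.mulVec_number_of_notMem (h : IsCAR a) {m : κ} (hv : a m *ᵥ v = 0) {L : List κ}
    (hm : m ∉ L) : ((a m)ᴴ * a m) *ᵥ fock a v L = 0 := by
  rw [← Matrix.mulVec_mulVec, h.mulVec_fock_of_notMem hv hm, Matrix.mulVec_zero]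

theorem IsCAR.mulVec_number_of_mem (h : IsCAR a) {m : κ} (hv : a m *ᵥ v = 0) {L : List κ}
    (hL : L.Nodup) (hm : m ∈ L) : ((a m)ᴴ * a m) *ᵥ fock a v L = fock a v L := by
  induction L with
  | nil => simp at hm
  | cons i L ih =>
    rw [List.nodup_cons] at hL
    by_cases hmi : m = i
    · subst hmi
      rw [fock_cons, ← Matrix.mulVec_mulVec,
        h.mul_conjTranspose_mulVec (h.mulVec_fock_of_notMem hv hL.1)]
    · have hcomm : Commute ((a m)ᴴ * a m) (a i)ᴴ :=
        commute_mul_of_anti (h.conjTranspose_mul_comm _ _) (h.mul_conjTranspose_of_ne hmi)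
      rw [fock_cons, Matrix.mulVec_mulVec, hcomm.eq, ← Matrix.mulVec_mulVec,
        ih hL.2 ((List.mem_cons.1 hm).resolve_left hmi)]

theorem IsCAR.fock_norm (h : IsCAR a) (hv1 : star v ⬝ᵥ v = 1) (hv : ∀ i, a i *ᵥ v = 0)
    {L : List κ} (hL : L.Nodup) : star (fock a v L) ⬝ᵥ fock a v L = 1 := by
  induction L with
  | nil => rwa [fock_nil]
  | cons i L ih =>
    rw [List.nodup_cons] at hL
    rw [fock_cons, star_dotProduct_mulVec, Matrix.conjTranspose_conjTranspose,
      h.mul_conjTranspose_mulVec (h.mulVec_fock_of_notMem (hv i) hL.1), ih hL.2]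

/-- The number operator of m is Hermitian, with eigenvalue 1 on one state and 0 on the other. -/
theorem IsCAR.fock_orthogonal (h : IsCAR a) (hv : ∀ i, a i *ᵥ v = 0) {L L' : List κ}
    (hL : L.Nodup) (hL' : L'.Nodup) {m : κ} (hm : ¬(m ∈ L ↔ m ∈ L')) :
    star (fock a v L) ⬝ᵥ fock a v L' = 0 := by
  have hherm : ((a m)ᴴ * a m)ᴴ = (a m)ᴴ * a m := by
    rw [Matrix.conjTranspose_mul, Matrix.conjTranspose_conjTranspose]
  have key := star_dotProduct_mulVec ((a m)ᴴ * a m) (fock a v L) (fock a v L')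
  rw [hherm] at key
  by_cases h1 : m ∈ L
  · have h2 : m ∉ L' := fun h2 => hm (by tauto)
    rw [h.mulVec_number_of_mem (hv m) hL h1, h.mulVec_number_of_notMem (hv m) h2,
      dotProduct_zero] at key
    exact key.symm
  · have h2 : m ∈ L' := by tauto
    rw [h.mulVec_number_of_mem (hv m) hL' h2, h.mulVec_number_of_notMem (hv m) h1, star_zero,
      zero_dotProduct] at key
    exact key

end Fock

/-! ### Orthonormal eigenbases -/

theorem exists_orthonormalBasis {κ ι : Type*} [Fintype κ] [DecidableEq κ] [Fintype ι]
    (f : κ → ι → ℂ) (hcard : Fintype.card κ = Fintype.card ι)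
    (hf : ∀ i j, star (f i) ⬝ᵥ f j = if i = j then 1 else 0) :
    ∃ e : OrthonormalBasis κ ℂ (EuclideanSpace ℂ ι), ∀ i, e i = WithLp.toLp 2 (f i) := by
  have ho : Orthonormal ℂ fun i => (WithLp.toLp 2 (f i) : EuclideanSpace ℂ ι) := by
    rw [orthonormal_iff_ite]
    intro i j
    rw [EuclideanSpace.inner_eq_star_dotProduct, dotProduct_comm]
    exact hf i j
  have hfr : Fintype.card κ = Module.finrank ℂ (EuclideanSpace ℂ ι) := by
    rw [finrank_euclideanSpace, hcard]
  rcases isEmpty_or_nonempty κ with hκ | hκ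
  · refine ⟨OrthonormalBasis.mk ho ?_, fun i => hκ.elim i⟩
    have : Subsingleton (EuclideanSpace ℂ ι) := by
      rw [← Module.finrank_zero_iff (R := ℂ), ← hfr, Fintype.card_eq_zero]
    intro x _
    rw [Subsingleton.elim x 0]
    exact Submodule.zero_mem _
  · have hsp := (ho.linearIndependent.span_eq_top_of_card_eq_finrank hfr).ge
    exact ⟨OrthonormalBasis.mk ho hsp, fun i => by simp⟩

theorem toEuclideanLin_toLp {ι : Type*} [Fintype ι] [DecidableEq ι] (A : Matrix ι ι ℂ)
    (x : ι → ℂ) : Matrix.toEuclideanLin A (WithLp.toLp 2 x) = WithLp.toLp 2 (A *ᵥ x) := rfl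

section Eigenbasis

variable {κ ι : Type*} [Fintype κ] [Fintype ι] [DecidableEq ι] {A : Matrix ι ι ℂ}
  {e : OrthonormalBasis κ ℂ (EuclideanSpace ℂ ι)} {x : κ → ℝ}

theorem hasEigenvalue_toLin'_iff {μ : ℂ} :
    Module.End.HasEigenvalue (Matrix.toLin' A) μ ↔ ∃ w : ι → ℂ, w ≠ 0 ∧ A *ᵥ w = μ • w := by
  constructor
  · intro h
    obtain ⟨w, hw⟩ := h.exists_hasEigenvector
    exact ⟨w, hw.2, by simpa using hw.apply_eq_smul⟩
  · rintro ⟨w, h0, hw⟩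
    exact Module.End.hasEigenvalue_of_hasEigenvector
      ⟨Module.End.mem_eigenspace_iff.2 (by simpa using hw), h0⟩

/-- An eigenvector is orthogonal to the eigenbasis vectors of other eigenvalues. -/
theorem inner_eq_zero_of_eigenbasis
    (he : ∀ i, Matrix.toEuclideanLin A (e i) = (x i : ℂ) • e i) {μ : ℂ}
    {w : EuclideanSpace ℂ ι} (hw : Matrix.toEuclideanLin A w = μ • w) {i : κ}
    (hi : (x i : ℂ) ≠ μ) : inner ℂ (e i) w = 0 := by
  have hsum : Matrix.toEuclideanLin A w = ∑ j, (inner ℂ (e j) w * (x j : ℂ)) • e j := by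
    conv_lhs => rw [← e.sum_repr' w]
    rw [map_sum]
    exact Finset.sum_congr rfl fun j _ => by rw [map_smul, he, smul_smul]
  have h1 : inner ℂ (e i) (Matrix.toEuclideanLin A w) = inner ℂ (e i) w * (x i : ℂ) := by
    rw [hsum, e.orthonormal.inner_right_fintype]
  rw [hw, inner_smul_right] at h1
  have h2 : inner ℂ (e i) w * ((x i : ℂ) - μ) = 0 := by linear_combination -h1
  exact (mul_eq_zero.1 h2).resolve_right (sub_ne_zero.2 hi)

theorem hasEigenvalue_iff_of_eigenbasis
    (he : ∀ i, Matrix.toEuclideanLin A (e i) = (x i : ℂ) • e i) (y : ℝ) :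
    Module.End.HasEigenvalue (Matrix.toLin' A) (y : ℂ) ↔ y ∈ Set.range x := by
  rw [hasEigenvalue_toLin'_iff]
  constructor
  · rintro ⟨w, h0, hw⟩
    by_contra hy
    apply h0
    have hz : (WithLp.toLp 2 w : EuclideanSpace ℂ ι) = 0 := by
      rw [← e.sum_repr' (WithLp.toLp 2 w)]
      refine Finset.sum_eq_zero fun i _ => ?_
      rw [inner_eq_zero_of_eigenbasis he (μ := (y : ℂ)), zero_smul]
      · rw [toEuclideanLin_toLp, hw]; rfl
      · exact fun h => hy ⟨i, by exact_mod_cast h⟩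
    simpa using hz
  · rintro ⟨i, rfl⟩
    refine ⟨(e i).ofLp, fun h => e.toBasis.ne_zero i ?_, congrArg WithLp.ofLp (he i)⟩
    rw [OrthonormalBasis.coe_toBasis]
    exact WithLp.ofLp_injective 2 h

theorem isGroundEnergy_of_eigenbasis
    (he : ∀ i, Matrix.toEuclideanLin A (e i) = (x i : ℂ) • e i) {E : ℝ}
    (hE : IsLeast (Set.range x) E) : IsGroundEnergy A E := by
  have : {y : ℝ | Module.End.HasEigenvalue (Matrix.toLin' A) (y : ℂ)} = Set.range x :=
    Set.ext fun y => hasEigenvalue_iff_of_eigenbasis he y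
  rw [IsGroundEnergy, this]
  exact hE

/-- `HasGap` asks for a basis indexed like the matrix, whereas the eigenbases at hand are labelled
by occupations; a bijection of equal cardinality reindexes them. -/
theorem hasGap_of_eigenbasis
    (he : ∀ i, Matrix.toEuclideanLin A (e i) = (x i : ℂ) • e i) {i₀ : κ}
    (h₀ : ∀ i, x i₀ ≤ x i) {g : ℝ} (hg : IsLeast {d : ℝ | ∃ i, i ≠ i₀ ∧ d = x i - x i₀} g) :
    HasGap A g := by
  have hcard : Fintype.card κ = Fintype.card ι := by
    rw [← Module.finrank_eq_card_basis e.toBasis, finrank_euclideanSpace]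
  let σ : κ ≃ ι := Fintype.equivOfCardEq hcard
  refine ⟨e.reindex σ, x ∘ σ.symm, σ i₀, fun i => ?_, fun i => ?_, ?_⟩
  · rw [OrthonormalBasis.reindex_apply, he]; rfl
  · simpa using h₀ _
  · have : {d : ℝ | ∃ i, i ≠ σ i₀ ∧ d = (x ∘ σ.symm) i - (x ∘ σ.symm) (σ i₀)}
        = {d : ℝ | ∃ i, i ≠ i₀ ∧ d = x i - x i₀} := by
      ext d
      constructor
      · rintro ⟨i, hi, rfl⟩
        exact ⟨σ.symm i, fun h => hi (by rw [← h]; simp), by simp⟩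
      · rintro ⟨i, hi, rfl⟩
        exact ⟨σ i, fun h => hi (σ.injective h), by simp⟩
    rw [this]
    exact hg

end Eigenbasis

/-! ### Wave numbers -/

theorem offset_le_one (q : ℤˣ) : offset q ≤ 1 := by
  unfold offset; split_ifs <;> simp

/-- The mode with wave number `-k` modulo `2π`. -/
def modeInv {N : ℕ} (q : ℤˣ) (l : Fin N) : Fin N :=
  -- The partner l' solves (2l + offset) + (2l' + offset) = 2N; the exception is k = 0, for which
  -- this would give l' = N.
  if h : l.val + offset q = 0 then l else ⟨N - (l.val + offset q), by have := l.pos; omega⟩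

theorem modeInv_val {N : ℕ} (q : ℤˣ) (l : Fin N) :
    (modeInv q l).val = if l.val + offset q = 0 then 0 else N - (l.val + offset q) := by
  unfold modeInv
  split_ifs with h
  · omega
  · rfl

theorem modeInv_involutive {N : ℕ} (q : ℤˣ) : Function.Involutive (modeInv (N := N) q) := by
  intro l
  have hl := l.isLt
  have ho := offset_le_one q
  apply Fin.ext
  rw [modeInv_val, modeInv_val]
  split_ifs <;> omega

theorem modeInv_modeInv {N : ℕ} (q : ℤˣ) (l : Fin N) : modeInv q (modeInv q l) = l :=
  modeInv_involutive q l

theorem sum_modeInv {N : ℕ} {M : Type*} [AddCommMonoid M] (q : ℤˣ) (f : Fin N → M) :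
    ∑ l, f (modeInv q l) = ∑ l, f l :=
  Equiv.sum_comp (modeInv_involutive q).toPerm f

theorem modeInv_of_mem_selfModes {N : ℕ} {q : ℤˣ} {l : Fin N} (h : l ∈ selfModes N q) :
    modeInv q l = l := by
  have hl := l.isLt
  have ho := offset_le_one q
  simp only [selfModes, Finset.mem_filter, Finset.mem_univ, true_and] at h
  apply Fin.ext
  rw [modeInv_val]
  split_ifs <;> omega

/-- The modes that are neither in (0, π) nor self-paired are exactly the partners of those in (0,
π). -/
theorem sum_eq_pairModes_add_selfModes {N : ℕ} {M : Type*} [AddCommMonoid M] (q : ℤˣ)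
    (f : Fin N → M) :
    ∑ l, f l = ∑ l ∈ pairModes N q, (f l + f (modeInv q l)) + ∑ l ∈ selfModes N q, f l := by
  have ho := offset_le_one q
  have hd : Disjoint (pairModes N q) (selfModes N q) := by
    rw [Finset.disjoint_left]
    intro l h1 h2
    simp only [pairModes, selfModes, Finset.mem_filter, Finset.mem_univ, true_and] at h1 h2
    omega
  have hc : ∑ l ∈ (pairModes N q ∪ selfModes N q)ᶜ, f l
      = ∑ l ∈ pairModes N q, f (modeInv q l) := by
    refine Finset.sum_nbij' (modeInv q) (modeInv q) ?_ ?_ ?_ ?_ ?_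
    · intro l hl
      have := l.isLt
      simp only [pairModes, selfModes, Finset.mem_filter, Finset.mem_univ, true_and,
        Finset.mem_compl, Finset.mem_union] at hl ⊢
      rw [modeInv_val]
      split_ifs <;> omega
    · intro l hl
      have := l.isLt
      simp only [pairModes, selfModes, Finset.mem_filter, Finset.mem_univ, true_and,
        Finset.mem_compl, Finset.mem_union] at hl ⊢
      rw [modeInv_val]
      split_ifs <;> omega
    · exact fun l _ => modeInv_modeInv q l
    · exact fun l _ => modeInv_modeInv q l
    · exact fun l _ => by rw [modeInv_modeInv]
  rw [← Finset.sum_add_sum_compl (pairModes N q ∪ selfModes N q), Finset.sum_union hd, hc,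
    Finset.sum_add_distrib]
  abel

theorem waveNumber_modeInv {N : ℕ} (q : ℤˣ) (l : Fin N) :
    ∃ m : ℤ, waveNumber N q (modeInv q l) = -waveNumber N q l + m * (2 * Real.pi) := by
  have hN : (N : ℝ) ≠ 0 := by have := l.pos; positivity
  have hl := l.isLt
  have ho := offset_le_one q
  by_cases h : l.val + offset q = 0
  · refine ⟨0, ?_⟩
    have h1 : l.val = 0 := by omega
    have h2 : offset q = 0 := by omega
    have h3 : (modeInv q l).val = 0 := by rw [modeInv_val, if_pos h]
    simp [waveNumber, h1, h2, h3]
  · refine ⟨1, ?_⟩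
    have h3 : 2 * (modeInv q l).val + offset q + (2 * l.val + offset q) = 2 * N := by
      rw [modeInv_val, if_neg h]; omega
    have h4 : ((2 * (modeInv q l).val + offset q : ℕ) : ℝ)
        = 2 * N - ((2 * l.val + offset q : ℕ) : ℝ) := by
      rw [eq_sub_iff_add_eq]; exact_mod_cast h3
    rw [waveNumber, waveNumber, h4]
    push_cast
    field_simp
    ring

theorem cos_waveNumber_modeInv {N : ℕ} (q : ℤˣ) (l : Fin N) (a : ℕ) :
    Real.cos (a * waveNumber N q (modeInv q l)) = Real.cos (a * waveNumber N q l) := by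
  obtain ⟨m, hm⟩ := waveNumber_modeInv q l
  have : a * waveNumber N q (modeInv q l)
      = -(a * waveNumber N q l) + ((a * m : ℤ) : ℝ) * (2 * Real.pi) := by
    rw [hm]; push_cast; ring
  rw [this, Real.cos_add_int_mul_two_pi, Real.cos_neg]

theorem sin_waveNumber_modeInv {N : ℕ} (q : ℤˣ) (l : Fin N) (a : ℕ) :
    Real.sin (a * waveNumber N q (modeInv q l)) = -Real.sin (a * waveNumber N q l) := by
  obtain ⟨m, hm⟩ := waveNumber_modeInv q l
  have : a * waveNumber N q (modeInv q l)
      = -(a * waveNumber N q l) + ((a * m : ℤ) : ℝ) * (2 * Real.pi) := by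
    rw [hm]; push_cast; ring
  rw [this, Real.sin_add_int_mul_two_pi, Real.sin_neg]

theorem epsilon_modeInv {N : ℕ} (n : ℕ) (J φ : ℝ) (q : ℤˣ) (l : Fin N) :
    epsilon n J φ (waveNumber N q (modeInv q l)) = epsilon n J φ (waveNumber N q l) := by
  have h1 := cos_waveNumber_modeInv q l 1
  have h2 := cos_waveNumber_modeInv q l (n + 1)
  push_cast at h1 h2
  rw [one_mul, one_mul] at h1
  rw [epsilon, h1, h2, epsilon]

theorem delta_modeInv {N : ℕ} (n : ℕ) (J φ : ℝ) (q : ℤˣ) (l : Fin N) :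
    delta n J φ (waveNumber N q (modeInv q l)) = -delta n J φ (waveNumber N q l) := by
  have h1 := sin_waveNumber_modeInv q l 1
  have h2 := sin_waveNumber_modeInv q l (n + 1)
  push_cast at h1 h2
  rw [one_mul, one_mul] at h1
  rw [delta, h1, h2, delta]
  ring

/-! ### The Fourier transformation -/

/-- The matrix of the Fourier transformation from sites to modes. -/
def fourierMatrix (N : ℕ) (q : ℤˣ) : Matrix (Fin N) (Fin N) ℂ :=
  Matrix.of fun l j => ((1 / Real.sqrt N : ℝ) : ℂ) *
    Complex.exp (-(Complex.I * (waveNumber N q l : ℂ) * ((j.val : ℂ) + 1)))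

theorem fourierMatrix_apply {N : ℕ} (q : ℤˣ) (l j : Fin N) :
    fourierMatrix N q l j = ((1 / Real.sqrt N : ℝ) : ℂ) *
      Complex.exp (-(Complex.I * (waveNumber N q l : ℂ) * ((j.val : ℂ) + 1))) := rfl

theorem star_fourierMatrix_apply {N : ℕ} (q : ℤˣ) (l j : Fin N) :
    star (fourierMatrix N q l j) = ((1 / Real.sqrt N : ℝ) : ℂ) *
      Complex.exp (Complex.I * (waveNumber N q l : ℂ) * ((j.val : ℂ) + 1)) := by
  rw [fourierMatrix_apply, star_mul', Complex.star_def, Complex.conj_ofReal, ← Complex.exp_conj]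
  congr 2
  simp

theorem fourierMatrix_mul_conjTranspose (N : ℕ) (q : ℤˣ) :
    fourierMatrix N q * (fourierMatrix N q)ᴴ = 1 := by
  ext l l'
  have hpos : 0 < N := l.pos
  have hN : (N : ℂ) ≠ 0 := by exact_mod_cast hpos.ne'
  have hsq : ((1 / Real.sqrt N : ℝ) : ℂ) * ((1 / Real.sqrt N : ℝ) : ℂ) = 1 / (N : ℂ) := by
    rw [← Complex.ofReal_mul, div_mul_div_comm, Real.mul_self_sqrt (Nat.cast_nonneg N)]
    push_cast; ring
  -- The ratio of consecutive terms is w = e^{i(k'-k)}, in which the offset cancels; it is an N-th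
  -- root of unity, and the geometric sum vanishes unless w = 1.
  set w : ℂ := Complex.exp (((l'.val : ℤ) - (l.val : ℤ) : ℤ) * (2 * Real.pi * Complex.I) / N)
    with hw
  have hterm : ∀ j : Fin N, fourierMatrix N q l j * (fourierMatrix N q)ᴴ j l'
      = 1 / (N : ℂ) * w * w ^ j.val := by
    intro j
    rw [Matrix.conjTranspose_apply, star_fourierMatrix_apply, fourierMatrix_apply,
      mul_mul_mul_comm, hsq, ← Complex.exp_add, mul_assoc (1 / (N : ℂ)), ← pow_succ', hw,
      ← Complex.exp_nat_mul]
    congr 2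
    simp only [waveNumber]
    push_cast
    field_simp
    ring
  rw [Matrix.mul_apply, Finset.sum_congr rfl fun j _ => hterm j, ← Finset.mul_sum,
    Fin.sum_univ_eq_sum_range (fun i => w ^ i), Matrix.one_apply]
  split_ifs with h
  · subst h
    simp [hw, hN]
  · have hwN : w ^ N = 1 := by
      rw [hw, ← Complex.exp_nat_mul, mul_div_cancel₀ _ hN]
      exact Complex.exp_int_mul_two_pi_mul_I _
    have hw1 : w ≠ 1 := by
      intro h1
      rw [hw, Complex.exp_eq_one_iff] at h1
      obtain ⟨m, hm⟩ := h1
      have hpi : (2 * Real.pi * Complex.I : ℂ) ≠ 0 := by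
        simp [Real.pi_ne_zero]
      have h2 : ((((l'.val : ℤ) - (l.val : ℤ) : ℤ) : ℂ)) = ((m * N : ℤ) : ℂ) := by
        rw [div_eq_iff hN] at hm
        have : ((((l'.val : ℤ) - (l.val : ℤ) : ℤ) : ℂ) - ((m * N : ℤ) : ℂ))
            * (2 * Real.pi * Complex.I) = 0 := by
          push_cast at hm ⊢; linear_combination hm
        exact sub_eq_zero.1 ((mul_eq_zero.1 this).resolve_right hpi)
      have h3 : (l'.val : ℤ) - (l.val : ℤ) = m * N := by exact_mod_cast h2
      have hl := l.isLt
      have hl' := l'.isLt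
      -- Two indices below N differ by less than N, so a difference divisible by N is zero.
      have hm0 : m = 0 := by
        by_contra hm0
        rcases lt_or_gt_of_ne hm0 with hlt | hgt
        · have : m * N ≤ -1 * N := by gcongr; omega
          omega
        · have : 1 * (N : ℤ) ≤ m * N := by gcongr; omega
          omega
      rw [hm0, zero_mul] at h3
      exact h (Fin.ext (by omega))
    have hg : ∑ i ∈ Finset.range N, w ^ i = 0 := by
      have := geom_sum_mul w N
      rw [hwN, sub_self] at this
      exact (mul_eq_zero.1 this).resolve_right (sub_ne_zero.2 hw1)
    rw [hg, mul_zero]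

theorem b_waveNumber {N : ℕ} (q : ℤˣ) (l : Fin N) :
    b N (waveNumber N q l) = ∑ j, fourierMatrix N q l j • c j := by
  rw [b, Finset.smul_sum]
  exact Finset.sum_congr rfl fun j _ => by rw [smul_smul, fourierMatrix_apply]

theorem b_add_int_mul_two_pi (N : ℕ) (k : ℝ) (m : ℤ) :
    b N (k + m * (2 * Real.pi)) = b N k := by
  unfold b
  congr 1
  refine Finset.sum_congr rfl fun j _ => ?_
  congr 1
  have : -(Complex.I * ((k + m * (2 * Real.pi) : ℝ) : ℂ) * ((j.val : ℂ) + 1))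
      = -(Complex.I * (k : ℂ) * ((j.val : ℂ) + 1))
        + ((-m * (j.val + 1) : ℤ) : ℂ) * (2 * Real.pi * Complex.I) := by
    push_cast; ring
  rw [this, Complex.exp_add, Complex.exp_int_mul_two_pi_mul_I, mul_one]

theorem b_neg_waveNumber {N : ℕ} (q : ℤˣ) (l : Fin N) :
    b N (-waveNumber N q l) = b N (waveNumber N q (modeInv q l)) := by
  obtain ⟨m, hm⟩ := waveNumber_modeInv q l
  rw [hm, b_add_int_mul_two_pi]

theorem fourierMatrix_modeInv {N : ℕ} (q : ℤˣ) (l j : Fin N) :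
    fourierMatrix N q (modeInv q l) j = star (fourierMatrix N q l j) := by
  obtain ⟨m, hm⟩ := waveNumber_modeInv q l
  rw [star_fourierMatrix_apply, fourierMatrix_apply, hm]
  congr 1
  have : -(Complex.I * ((-waveNumber N q l + m * (2 * Real.pi) : ℝ) : ℂ) * ((j.val : ℂ) + 1))
      = Complex.I * (waveNumber N q l : ℂ) * ((j.val : ℂ) + 1)
        + ((-m * (j.val + 1) : ℤ) : ℂ) * (2 * Real.pi * Complex.I) := by
    push_cast; ring
  rw [this, Complex.exp_add, Complex.exp_int_mul_two_pi_mul_I, mul_one]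

/-- Common form of the four bilinear Fourier sums: orthogonality pairs l with itself in products of
a creator and an annihilator (σ = id), and with -k in products of two of the same kind (σ =
`modeInv`). -/
theorem sum_smul_mul_sum_smul {κ μ R : Type*} [Fintype κ] [DecidableEq κ] [Fintype μ] [Ring R]
    [Algebra ℂ R] {P Q : κ → μ → ℂ} {σ : κ → κ} (w : κ → ℂ) (x y : κ → R)
    (h : ∀ l l', ∑ j, P l j * Q l' j = if l = σ l' then 1 else 0) :
    ∑ j, (∑ l, P l j • x l) * (∑ l', (Q l' j * w l') • y l')
      = ∑ l, w l • (x (σ l) * y l) := by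
  simp only [Finset.sum_mul_sum, smul_mul_smul_comm]
  rw [Finset.sum_comm, Finset.sum_congr rfl fun l _ => Finset.sum_comm, Finset.sum_comm]
  refine Finset.sum_congr rfl fun l' _ => ?_
  simp only [← Finset.sum_smul, ← mul_assoc, ← Finset.sum_mul, h]
  simp

/-- The mode operators of the sector `q`. -/
def mode (N : ℕ) (q : ℤˣ) (l : Fin N) : Op N := b N (waveNumber N q l)

theorem mode_eq {N : ℕ} (q : ℤˣ) (l : Fin N) :
    mode N q l = ∑ j, fourierMatrix N q l j • c j := b_waveNumber q l

theorem mode_conjTranspose {N : ℕ} (q : ℤˣ) (l : Fin N) :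
    (mode N q l)ᴴ = ∑ j, star (fourierMatrix N q l j) • (c j)ᴴ := by
  rw [mode_eq, Matrix.conjTranspose_sum]
  exact Finset.sum_congr rfl fun j _ => Matrix.conjTranspose_smul _ _

theorem sum_fourierMatrix_mul_star {N : ℕ} (q : ℤˣ) (l l' : Fin N) :
    ∑ j, fourierMatrix N q l j * star (fourierMatrix N q l' j) = if l = l' then 1 else 0 := by
  have := congrFun (congrFun (fourierMatrix_mul_conjTranspose N q) l) l'
  rwa [Matrix.mul_apply, Matrix.one_apply] at this

theorem isCAR_mode (N : ℕ) (q : ℤˣ) : IsCAR (mode N q) where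
  anti l l' := by
    rw [mode_eq, mode_eq, Finset.sum_mul_sum, Finset.sum_mul_sum,
      Finset.sum_comm (f := fun i j => fourierMatrix N q l' i • c i * fourierMatrix N q l j • c j),
      ← Finset.sum_add_distrib]
    refine Finset.sum_eq_zero fun i _ => ?_
    rw [← Finset.sum_add_distrib]
    refine Finset.sum_eq_zero fun j _ => ?_
    rw [smul_mul_smul_comm, smul_mul_smul_comm, mul_comm, ← smul_add, c_anticomm, smul_zero]
  anti_star l l' := by
    rw [mode_eq, mode_conjTranspose, Finset.sum_mul_sum, Finset.sum_mul_sum,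
      Finset.sum_comm (f := fun i j =>
        star (fourierMatrix N q l' i) • (c i)ᴴ * fourierMatrix N q l j • c j),
      ← Finset.sum_add_distrib]
    have : ∀ i, ∑ j, fourierMatrix N q l i • c i * star (fourierMatrix N q l' j) • (c j)ᴴ
        + ∑ j, star (fourierMatrix N q l' j) • (c j)ᴴ * fourierMatrix N q l i • c i
        = (fourierMatrix N q l i * star (fourierMatrix N q l' i)) • (1 : Op N) := by
      intro i
      rw [← Finset.sum_add_distrib, Finset.sum_eq_single i]
      · rw [smul_mul_smul_comm, smul_mul_smul_comm, mul_comm (star _), ← smul_add,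
          c_anticomm_conjTranspose, if_pos rfl]
      · intro j _ hj
        rw [smul_mul_smul_comm, smul_mul_smul_comm, mul_comm (star _), ← smul_add,
          c_anticomm_conjTranspose, if_neg hj.symm, smul_zero]
      · simp
    rw [Finset.sum_congr rfl fun i _ => this i, ← Finset.sum_smul, sum_fourierMatrix_mul_star]
    split_ifs <;> simp

theorem c_eq_sum_mode {N : ℕ} (q : ℤˣ) (j : Fin N) :
    c j = ∑ l, star (fourierMatrix N q l j) • mode N q l := by
  have hU := mul_eq_one_comm.1 (fourierMatrix_mul_conjTranspose N q)
  simp only [mode_eq, Finset.smul_sum, smul_smul]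
  rw [Finset.sum_comm, Finset.sum_eq_single j]
  · have := congrFun (congrFun hU j) j
    rw [Matrix.mul_apply, Matrix.one_apply_eq] at this
    rw [← Finset.sum_smul]
    exact (one_smul ℂ (c j)).symm.trans (congrArg (· • c j) this.symm)
  · intro i _ hi
    have := congrFun (congrFun hU j) i
    rw [Matrix.mul_apply, Matrix.one_apply_ne hi.symm] at this
    rw [← Finset.sum_smul]
    exact (congrArg (· • c i) this).trans (zero_smul ℂ (c i))
  · simp

/-- The translation phase of a mode. -/
def phase {N : ℕ} (q : ℤˣ) (a : ℕ) (l : Fin N) : ℂ :=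
  Complex.exp (Complex.I * (waveNumber N q l : ℂ) * a)

theorem exp_waveNumber_mul {N : ℕ} (q : ℤˣ) (l : Fin N) :
    Complex.exp (Complex.I * (waveNumber N q l : ℂ) * N) = -sgn q := by
  have hN : (N : ℂ) ≠ 0 := by have := l.pos; exact_mod_cast this.ne'
  have : Complex.I * (waveNumber N q l : ℂ) * N
      = offset q * (Real.pi * Complex.I) + (l.val : ℤ) * (2 * Real.pi * Complex.I) := by
    rw [waveNumber]; push_cast; field_simp; ring
  rw [this, Complex.exp_add, Complex.exp_int_mul_two_pi_mul_I, mul_one]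
  rcases Int.units_eq_one_or q with rfl | rfl
  · simp [offset, sgn]
  · have : (-1 : ℤˣ) ≠ 1 := by decide
    simp [offset, sgn, this]

/-- Passing the end of the chain changes the plane wave by e^{-ikN}, and the boundary sign -q =
e^{ikN} compensates; translation is thus a pure phase at every site. -/
theorem wrapSign_mul_star_fourierMatrix {N : ℕ} (q : ℤˣ) (l j : Fin N) {a : ℕ} (ha : a ≤ N) :
    wrapSign q j a * star (fourierMatrix N q l (shift j a))
      = star (fourierMatrix N q l j) * phase q a l := by
  have hs := shift_val j ha
  rw [star_fourierMatrix_apply, star_fourierMatrix_apply, phase, mul_assoc (_ : ℂ) (Complex.exp _), ← Complex.exp_add,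
    wrapSign]
  split_ifs at hs ⊢ with h
  · rw [one_mul, hs]
    congr 2
    push_cast; ring
  · have hs' : ((shift j a).val : ℂ) + N = j.val + a := by
      have : (shift j a).val + N = j.val + a := by omega
      exact_mod_cast this
    rw [mul_left_comm, ← exp_waveNumber_mul q l, ← Complex.exp_add]
    congr 2
    linear_combination (Complex.I * (waveNumber N q l : ℂ)) * hs'

theorem cShift_eq_sum_mode {N : ℕ} (q : ℤˣ) (j : Fin N) {a : ℕ} (ha : a ≤ N) :
    cShift q j a = ∑ l, (star (fourierMatrix N q l j) * phase q a l) • mode N q l := by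
  rw [cShift_eq, c_eq_sum_mode q, Finset.smul_sum]
  exact Finset.sum_congr rfl fun l _ => by
    rw [smul_smul, wrapSign_mul_star_fourierMatrix q l j ha]

theorem c_conjTranspose_eq_sum_mode {N : ℕ} (q : ℤˣ) (j : Fin N) :
    (c j)ᴴ = ∑ l, fourierMatrix N q l j • (mode N q l)ᴴ := by
  rw [c_eq_sum_mode q, Matrix.conjTranspose_sum]
  exact Finset.sum_congr rfl fun l _ => by rw [Matrix.conjTranspose_smul, star_star]

theorem cShift_conjTranspose_eq_sum_mode {N : ℕ} (q : ℤˣ) (j : Fin N) {a : ℕ} (ha : a ≤ N) :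
    (cShift q j a)ᴴ = ∑ l, (fourierMatrix N q l j * star (phase q a l)) • (mode N q l)ᴴ := by
  rw [cShift_eq_sum_mode q j ha, Matrix.conjTranspose_sum]
  exact Finset.sum_congr rfl fun l _ => by
    rw [Matrix.conjTranspose_smul, star_mul', star_star]

section FourierSums

variable {N : ℕ} (q : ℤˣ) {a : ℕ}

theorem sum_star_fourierMatrix_mul (l l' : Fin N) :
    ∑ j, star (fourierMatrix N q l j) * fourierMatrix N q l' j = if l = l' then 1 else 0 := by
  simp only [mul_comm (star (fourierMatrix N q _ _)), sum_fourierMatrix_mul_star, eq_comm]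

theorem sum_fourierMatrix_mul (l l' : Fin N) :
    ∑ j, fourierMatrix N q l j * fourierMatrix N q l' j
      = if l = modeInv q l' then 1 else 0 := by
  rw [← sum_fourierMatrix_mul_star q l (modeInv q l')]
  exact Finset.sum_congr rfl fun j _ => by rw [fourierMatrix_modeInv, star_star]

theorem sum_star_fourierMatrix_mul_star (l l' : Fin N) :
    ∑ j, star (fourierMatrix N q l j) * star (fourierMatrix N q l' j)
      = if l = modeInv q l' then 1 else 0 := by
  rw [← sum_star_fourierMatrix_mul q l (modeInv q l')]
  exact Finset.sum_congr rfl fun j _ => by rw [fourierMatrix_modeInv]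

theorem sum_cDag_mul_cShift (ha : a ≤ N) :
    ∑ j : Fin N, (c j)ᴴ * cShift q j a
      = ∑ l, phase q a l • ((mode N q l)ᴴ * mode N q l) := by
  simp only [c_conjTranspose_eq_sum_mode q, cShift_eq_sum_mode q _ ha]
  exact sum_smul_mul_sum_smul (σ := id) _ _ _ (sum_fourierMatrix_mul_star q)

theorem sum_c_mul_cShiftDag (ha : a ≤ N) :
    ∑ j : Fin N, c j * (cShift q j a)ᴴ
      = ∑ l, star (phase q a l) • (mode N q l * (mode N q l)ᴴ) := by
  simp only [cShift_conjTranspose_eq_sum_mode q _ ha]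
  rw [Finset.sum_congr rfl fun j _ => by rw [c_eq_sum_mode q j]]
  exact sum_smul_mul_sum_smul (σ := id) _ _ _ (sum_star_fourierMatrix_mul q)

theorem sum_c_mul_cShift (ha : a ≤ N) :
    ∑ j : Fin N, c j * cShift q j a
      = ∑ l, phase q a l • (mode N q (modeInv q l) * mode N q l) := by
  simp only [cShift_eq_sum_mode q _ ha]
  rw [Finset.sum_congr rfl fun j _ => by rw [c_eq_sum_mode q j]]
  exact sum_smul_mul_sum_smul _ _ _ (sum_star_fourierMatrix_mul_star q)

theorem sum_cDag_mul_cShiftDag (ha : a ≤ N) :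
    ∑ j : Fin N, (c j)ᴴ * (cShift q j a)ᴴ
      = ∑ l, star (phase q a l) • ((mode N q (modeInv q l))ᴴ * (mode N q l)ᴴ) := by
  simp only [c_conjTranspose_eq_sum_mode q, cShift_conjTranspose_eq_sum_mode q _ ha]
  exact sum_smul_mul_sum_smul _ _ (fun l => (mode N q l)ᴴ) (sum_fourierMatrix_mul q)

end FourierSums

/-! ### The Hamiltonian in terms of modes -/

/-- The contribution of one mode to the fermionic Hamiltonian. -/
def modeTerm (N n : ℕ) (J φ : ℝ) (q : ℤˣ) (l : Fin N) : Op N :=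
  (epsilon n J φ (waveNumber N q l) : ℂ) • ((2 : ℂ) • ((mode N q l)ᴴ * mode N q l) - 1)
  + (Complex.I * (delta n J φ (waveNumber N q l) : ℂ)) •
    ((mode N q l)ᴴ * (mode N q (modeInv q l))ᴴ - mode N q (modeInv q l) * mode N q l)

theorem phase_eq {N : ℕ} (q : ℤˣ) (a : ℕ) (l : Fin N) :
    phase q a l = (Real.cos (a * waveNumber N q l) : ℂ)
      + (Real.sin (a * waveNumber N q l) : ℂ) * Complex.I := by
  rw [phase, mul_assoc, mul_comm Complex.I, Complex.exp_mul_I]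
  push_cast
  rw [mul_comm (waveNumber N q l : ℂ)]

theorem star_phase_eq {N : ℕ} (q : ℤˣ) (a : ℕ) (l : Fin N) :
    star (phase q a l) = (Real.cos (a * waveNumber N q l) : ℂ)
      - (Real.sin (a * waveNumber N q l) : ℂ) * Complex.I := by
  rw [phase_eq, star_add, star_mul']
  simp only [Complex.star_def, Complex.conj_ofReal, Complex.conj_I]
  ring

theorem sum_eq_zero_of_modeInv_neg {N : ℕ} {M : Type*} [AddCommGroup M] [Module ℂ M] (q : ℤˣ)
    {f : Fin N → M} (hf : ∀ l, f (modeInv q l) = -f l) : ∑ l, f l = 0 := by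
  have h := sum_modeInv q f
  rw [Finset.sum_congr rfl fun l _ => hf l, Finset.sum_neg_distrib] at h
  have h2 : (2 : ℂ) • ∑ l, f l = 0 := by
    rw [two_smul]
    nth_rewrite 1 [← h]
    exact neg_add_cancel _
  exact (smul_eq_zero_iff_right two_ne_zero).1 h2

/-- The raw Fourier sums and the mode terms agree only after summation: they differ by terms that
change sign under k ↦ -k. -/
theorem fermionHamiltonian_eq_sum_modeTerm {N n : ℕ} (hn : n + 2 ≤ N) (J φ : ℝ) (q : ℤˣ) :
    fermionHamiltonian N n J φ q = ∑ l, modeTerm N n J φ q l := by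
  have hcar := isCAR_mode N q
  set k : Fin N → ℝ := waveNumber N q with hk
  -- τ is odd in k and multiplies the identity. The weight σ below is even, but multiplies a product
  -- of two modes that is antisymmetric under k ↦ -k.
  set τ : Fin N → ℝ := fun l =>
    J * Real.cos φ * Real.sin ((n + 1 : ℕ) * k l) - J * Real.sin φ * Real.sin ((1 : ℕ) * k l)
    with hτ
  set σ : Fin N → ℝ := fun l =>
    J * Real.cos φ * Real.cos ((n + 1 : ℕ) * k l) + J * Real.sin φ * Real.cos ((1 : ℕ) * k l)
    with hσ
  have h1 : ∑ l, (τ l : ℂ) • (Complex.I • (1 : Op N)) = 0 := by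
    refine sum_eq_zero_of_modeInv_neg q fun l => ?_
    simp only [hτ, hk, sin_waveNumber_modeInv]
    rw [← neg_smul]
    congr 1
    push_cast; ring
  have h2 : ∑ l, (σ l : ℂ) • (mode N q (modeInv q l) * mode N q l) = 0 := by
    refine sum_eq_zero_of_modeInv_neg q fun l => ?_
    simp only [hσ, hk, cos_waveNumber_modeInv, modeInv_modeInv]
    rw [hcar.mul_comm, smul_neg]
  have h3 : ∑ l, (σ l : ℂ) • ((mode N q (modeInv q l))ᴴ * (mode N q l)ᴴ) = 0 := by
    refine sum_eq_zero_of_modeInv_neg q fun l => ?_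
    simp only [hσ, hk, cos_waveNumber_modeInv, modeInv_modeInv]
    rw [hcar.conjTranspose_mul_comm, smul_neg]
  unfold fermionHamiltonian
  simp only [Finset.sum_add_distrib, Finset.sum_sub_distrib]
  rw [sum_cDag_mul_cShift q (by omega), sum_c_mul_cShiftDag q (by omega),
    sum_c_mul_cShift q (by omega), sum_cDag_mul_cShiftDag q (by omega),
    sum_cDag_mul_cShift q (by omega), sum_c_mul_cShiftDag q (by omega),
    sum_c_mul_cShift q (by omega), sum_cDag_mul_cShiftDag q (by omega)]
  -- Adding the three vanishing sums makes the identity hold mode by mode.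
  have h0 : ∑ l, modeTerm N n J φ q l = ∑ l, modeTerm N n J φ q l
      + ∑ l, (τ l : ℂ) • (Complex.I • (1 : Op N))
      - ∑ l, (σ l : ℂ) • (mode N q (modeInv q l) * mode N q l)
      + ∑ l, (σ l : ℂ) • ((mode N q (modeInv q l))ᴴ * (mode N q l)ᴴ) := by
    rw [h1, h2, h3, add_zero, sub_zero, add_zero]
  rw [h0]
  simp only [Finset.smul_sum, ← Finset.sum_add_distrib, ← Finset.sum_sub_distrib]
  refine Finset.sum_congr rfl fun l _ => ?_
  rw [modeTerm, hcar.mul_conjTranspose_self, hcar.conjTranspose_mul_comm l (modeInv q l)]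
  simp only [star_phase_eq]
  simp only [phase_eq, hτ, hσ, hk, epsilon, delta]
  push_cast
  simp only [one_mul]
  module

theorem blockOp_eq {N : ℕ} (n : ℕ) (J φ : ℝ) (q : ℤˣ) (l : Fin N) :
    blockOp N n J φ (waveNumber N q l)
      = modeTerm N n J φ q l + modeTerm N n J φ q (modeInv q l) := by
  have hcar := isCAR_mode N q
  have h1 := hcar.mul_comm l (modeInv q l)
  have h2 := hcar.conjTranspose_mul_comm (modeInv q l) l
  simp only [blockOp, modeTerm, b_neg_waveNumber, epsilon_modeInv, delta_modeInv, modeInv_modeInv]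
  simp only [← mode.eq_1, h1, h2]
  push_cast
  module

/-- A self-paired mode has no pairing term, since b_k² = 0. -/
theorem modeTerm_of_mem_selfModes {N n : ℕ} (J φ : ℝ) {q : ℤˣ} {l : Fin N}
    (hl : l ∈ selfModes N q) : modeTerm N n J φ q l
      = (epsilon n J φ (waveNumber N q l) : ℂ) •
        ((2 : ℂ) • ((mode N q l)ᴴ * mode N q l) - 1) := by
  have hcar := isCAR_mode N q
  rw [modeTerm, modeInv_of_mem_selfModes hl, hcar.mul_self, ← Matrix.conjTranspose_mul,
    hcar.mul_self, Matrix.conjTranspose_zero, sub_zero, smul_zero, add_zero]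

theorem fermionHamiltonian_eq_sum_blockOp {N n : ℕ} (hn : n + 2 ≤ N) (J φ : ℝ) (q : ℤˣ) :
    fermionHamiltonian N n J φ q =
      ∑ l ∈ pairModes N q, blockOp N n J φ (waveNumber N q l)
      + ∑ l ∈ selfModes N q, (epsilon n J φ (waveNumber N q l) : ℂ) •
          ((2 : ℂ) • ((mode N q l)ᴴ * mode N q l) - 1) := by
  rw [fermionHamiltonian_eq_sum_modeTerm hn, sum_eq_pairModes_add_selfModes q]
  congr 1
  · exact Finset.sum_congr rfl fun l _ => (blockOp_eq n J φ q l).symm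
  · exact Finset.sum_congr rfl fun l hl => modeTerm_of_mem_selfModes J φ hl

/-! ### The action of a block on four states -/

section Block

variable {κ ι : Type*} [DecidableEq κ] [Fintype ι] [DecidableEq ι] {a : κ → Matrix ι ι ℂ}

/-- The occupied modes in the four states of the pair `l`, `m`. -/
def pairList (l m : κ) : Fin 4 → List κ := ![[l, m], [], [l], [m]]

theorem IsCAR.conjTranspose_mul_self (h : IsCAR a) (i : κ) : (a i)ᴴ * (a i)ᴴ = 0 := by
  rw [← Matrix.conjTranspose_mul, h.mul_self, Matrix.conjTranspose_zero]

theorem IsCAR.pair_mulVec (h : IsCAR a) {l m : κ} (hlm : l ≠ m) {w : ι → ℂ} (hl : a l *ᵥ w = 0)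
    (hm : a m *ᵥ w = 0) (x : Fin 4) :
    ((a l)ᴴ * (a m)ᴴ - a m * a l) *ᵥ fock a w (pairList l m x)
      = (![-1, 0, 0, 0] : Fin 4 → ℂ) x • fock a w (pairList l m 1)
        + (![0, 1, 0, 0] : Fin 4 → ℂ) x • fock a w (pairList l m 0) := by
  have c1 := h.conjTranspose_mul_self l
  have c2 := h.conjTranspose_mul_self m
  have c3 := h.conjTranspose_mul_comm m l
  have r1 : a l *ᵥ ((a l)ᴴ *ᵥ w) = w := h.mul_conjTranspose_mulVec hl
  have r2 : a m *ᵥ ((a m)ᴴ *ᵥ w) = w := h.mul_conjTranspose_mulVec hm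
  have r3 : a l *ᵥ ((a m)ᴴ *ᵥ w) = 0 := by
    have := h.mulVec_fock_of_notMem hl (L := [m]) (by simpa using hlm)
    rwa [fock_cons, fock_nil] at this
  have r5 : a l *ᵥ ((a l)ᴴ *ᵥ ((a m)ᴴ *ᵥ w)) = (a m)ᴴ *ᵥ w :=
    h.mul_conjTranspose_mulVec r3
  have d1 : ∀ y, (a l)ᴴ *ᵥ ((a l)ᴴ *ᵥ y) = 0 := fun y => by
    rw [Matrix.mulVec_mulVec, c1, Matrix.zero_mulVec]
  have d2 : ∀ y, (a m)ᴴ *ᵥ ((a m)ᴴ *ᵥ y) = 0 := fun y => by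
    rw [Matrix.mulVec_mulVec, c2, Matrix.zero_mulVec]
  have d3 : ∀ y, (a m)ᴴ *ᵥ ((a l)ᴴ *ᵥ y) = -((a l)ᴴ *ᵥ ((a m)ᴴ *ᵥ y)) := fun y => by
    rw [Matrix.mulVec_mulVec, c3, Matrix.neg_mulVec, Matrix.mulVec_mulVec]
  rw [Matrix.sub_mulVec, ← Matrix.mulVec_mulVec, ← Matrix.mulVec_mulVec]
  fin_cases x <;> simp [-Matrix.mulVec_mulVec, pairList, fock_cons, fock_nil, r1, r2, r3, r5,
    d1, d2, d3, hl, hm, Matrix.mulVec_neg]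

theorem IsCAR.number_pair_mulVec (h : IsCAR a) {l m : κ} (hlm : l ≠ m) {w : ι → ℂ}
    (hl : a l *ᵥ w = 0) (hm : a m *ᵥ w = 0) (x : Fin 4) :
    ((a l)ᴴ * a l + (a m)ᴴ * a m - 1) *ᵥ fock a w (pairList l m x)
      = (![1, -1, 0, 0] : Fin 4 → ℂ) x • fock a w (pairList l m x) := by
  have hnd : (pairList l m x).Nodup := by
    fin_cases x <;> simp [pairList, hlm]
  have hnum : ∀ (i : κ) (z : ℂ), a i *ᵥ w = 0 → (i ∈ pairList l m x → z = 1) →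
      (i ∉ pairList l m x → z = 0) →
      ((a i)ᴴ * a i) *ᵥ fock a w (pairList l m x) = z • fock a w (pairList l m x) := by
    intro i z hi h1 h0
    by_cases hx : i ∈ pairList l m x
    · rw [h.mulVec_number_of_mem hi hnd hx, h1 hx, one_smul]
    · rw [h.mulVec_number_of_notMem hi hx, h0 hx, zero_smul]
  have e1 := hnum l ((![1, 0, 1, 0] : Fin 4 → ℂ) x) hl
    (by fin_cases x <;> simp [pairList, hlm]) (by fin_cases x <;> simp [pairList])
  have e2 := hnum m ((![1, 0, 0, 1] : Fin 4 → ℂ) x) hm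
    (by fin_cases x <;> simp [pairList, hlm.symm]) (by fin_cases x <;> simp [pairList])
  rw [Matrix.sub_mulVec, Matrix.add_mulVec, e1, e2, Matrix.one_mulVec]
  fin_cases x <;> simp

end Block

/-! ### The product basis -/

section ProductBasis

variable {N : ℕ} {q : ℤˣ}

theorem modeInv_notMem_pairModes {l : Fin N} (hl : l ∈ pairModes N q) :
    modeInv q l ∉ pairModes N q := by
  have := l.isLt
  simp only [pairModes, Finset.mem_filter, Finset.mem_univ, true_and, modeInv_val] at hl ⊢
  split_ifs <;> omega

theorem modeInv_notMem_selfModes {l : Fin N} (hl : l ∈ pairModes N q) :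
    modeInv q l ∉ selfModes N q := by
  have := l.isLt
  simp only [pairModes, selfModes, Finset.mem_filter, Finset.mem_univ, true_and,
    modeInv_val] at hl ⊢
  split_ifs <;> omega

theorem notMem_selfModes_of_mem_pairModes {l : Fin N} (hl : l ∈ pairModes N q) :
    l ∉ selfModes N q := by
  simp only [pairModes, selfModes, Finset.mem_filter, Finset.mem_univ, true_and] at hl ⊢
  omega

theorem ne_modeInv {l : Fin N} (hl : l ∈ pairModes N q) : l ≠ modeInv q l :=
  fun h => modeInv_notMem_pairModes hl (h ▸ hl)

theorem eq_or_eq_of_mem_pairList {κ : Type*} {l m i : κ} {x : Fin 4} (h : i ∈ pairList l m x) :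
    i = l ∨ i = m := by
  fin_cases x <;> simp [pairList] at h <;> tauto

/-- The block of a pair contains no mode of another block. -/
theorem eq_of_mem_pairList {l l' : Fin N} (hl : l ∈ pairModes N q) (hl' : l' ∈ pairModes N q)
    {i : Fin N} (hi : i = l ∨ i = modeInv q l) (hi' : i = l' ∨ i = modeInv q l') : l = l' := by
  rcases hi with rfl | rfl <;> rcases hi' with h | h
  · exact h
  · exact absurd (h ▸ hl) (modeInv_notMem_pairModes hl')
  · exact absurd (h ▸ hl') (modeInv_notMem_pairModes hl)
  · exact (modeInv_involutive q).injective h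

/-- The occupied modes among the pairs in the list `P`. -/
def pairPart (s : ↥(pairModes N q) → Fin 4) (P : List ↥(pairModes N q)) : List (Fin N) :=
  P.flatMap fun l => pairList l.1 (modeInv q l.1) (s l)

/-- The occupied modes among the self-paired ones. -/
def selfPart (t : ↥(selfModes N q) → Fin 2) : List (Fin N) :=
  (Finset.univ.toList.filter fun l => t l = 1).map Subtype.val

/-- The occupied modes of a product basis state. -/
def labelList (s : ↥(pairModes N q) → Fin 4) (t : ↥(selfModes N q) → Fin 2) : List (Fin N) :=
  pairPart s Finset.univ.toList ++ selfPart t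

theorem mem_pairPart {s : ↥(pairModes N q) → Fin 4} {P : List ↥(pairModes N q)} {i : Fin N} :
    i ∈ pairPart s P ↔ ∃ l ∈ P, i ∈ pairList l.1 (modeInv q l.1) (s l) := by
  simp only [pairPart, List.mem_flatMap]

theorem mem_selfModes_of_mem_selfPart {t : ↥(selfModes N q) → Fin 2} {i : Fin N}
    (h : i ∈ selfPart t) : i ∈ selfModes N q := by
  simp only [selfPart, List.mem_map] at h
  obtain ⟨l, _, rfl⟩ := h
  exact l.2

theorem mem_pairPart_iff {s : ↥(pairModes N q) → Fin 4} {P : List ↥(pairModes N q)} {i : Fin N}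
    {l : ↥(pairModes N q)} (hi : i = l.1 ∨ i = modeInv q l.1) :
    i ∈ pairPart s P ↔ l ∈ P ∧ i ∈ pairList l.1 (modeInv q l.1) (s l) := by
  rw [mem_pairPart]
  constructor
  · rintro ⟨l', hl', h⟩
    have : l' = l := Subtype.ext (eq_of_mem_pairList l'.2 l.2 (eq_or_eq_of_mem_pairList h) hi)
    subst this
    exact ⟨hl', h⟩
  · rintro ⟨hl, h⟩
    exact ⟨l, hl, h⟩

theorem notMem_selfModes_of_pair {i : Fin N} {l : ↥(pairModes N q)}
    (hi : i = l.1 ∨ i = modeInv q l.1) : i ∉ selfModes N q := by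
  rcases hi with rfl | rfl
  · exact notMem_selfModes_of_mem_pairModes l.2
  · exact modeInv_notMem_selfModes l.2

theorem mem_labelList_pair {s : ↥(pairModes N q) → Fin 4} {t : ↥(selfModes N q) → Fin 2}
    {i : Fin N} {l : ↥(pairModes N q)} (hi : i = l.1 ∨ i = modeInv q l.1) :
    i ∈ labelList s t ↔ i ∈ pairList l.1 (modeInv q l.1) (s l) := by
  rw [labelList, List.mem_append, mem_pairPart_iff hi]
  have h1 : i ∉ selfPart t := fun h =>
    notMem_selfModes_of_pair hi (mem_selfModes_of_mem_selfPart h)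
  simp [h1]

theorem mem_labelList_self {s : ↥(pairModes N q) → Fin 4} {t : ↥(selfModes N q) → Fin 2}
    {l : ↥(selfModes N q)} : l.1 ∈ labelList s t ↔ t l = 1 := by
  have h1 : l.1 ∉ pairPart s Finset.univ.toList := by
    rw [mem_pairPart]
    rintro ⟨l', _, h⟩
    exact notMem_selfModes_of_pair (eq_or_eq_of_mem_pairList h) l.2
  rw [labelList, List.mem_append, or_iff_right h1, selfPart]
  simp

theorem labelList_nodup (s : ↥(pairModes N q) → Fin 4) (t : ↥(selfModes N q) → Fin 2) :
    (labelList s t).Nodup := by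
  rw [labelList, List.nodup_append']
  refine ⟨?_, ?_, ?_⟩
  · rw [pairPart, List.nodup_flatMap]
    refine ⟨fun l _ => ?_, ?_⟩
    · have := ne_modeInv l.2
      generalize s l = x
      fin_cases x <;> simp [pairList, this]
    · refine (Finset.nodup_toList _).imp ?_
      intro l l' hne i h h'
      exact hne (Subtype.ext (eq_of_mem_pairList l.2 l'.2 (eq_or_eq_of_mem_pairList h)
        (eq_or_eq_of_mem_pairList h')))
  · exact ((Finset.nodup_toList _).filter _).map Subtype.val_injective
  · intro i h h'
    rw [mem_pairPart] at h
    obtain ⟨l, _, h⟩ := h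
    exact notMem_selfModes_of_pair (eq_or_eq_of_mem_pairList h) (mem_selfModes_of_mem_selfPart h')

/-- The four states of a pair are told apart by the occupations of k and -k, so distinct labels
differ in the occupation of some mode. -/
theorem exists_mem_labelList_ne {x y : BlockLabel N q} (h : x ≠ y) :
    ∃ i, ¬(i ∈ labelList x.1 x.2 ↔ i ∈ labelList y.1 y.2) := by
  by_contra hc
  push Not at hc
  apply h
  refine Prod.ext (funext fun l => ?_) (funext fun l => ?_)
  · have h1 := hc l.1
    have h2 := hc (modeInv q l.1)
    rw [mem_labelList_pair (Or.inl rfl), mem_labelList_pair (Or.inl rfl)] at h1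
    rw [mem_labelList_pair (Or.inr rfl), mem_labelList_pair (Or.inr rfl)] at h2
    have hne := ne_modeInv l.2
    revert h1 h2
    generalize x.1 l = a
    generalize y.1 l = b
    fin_cases a <;> fin_cases b <;> simp [pairList, hne, hne.symm]
  · have h1 := hc l.1
    rw [mem_labelList_self, mem_labelList_self] at h1
    revert h1
    generalize x.2 l = a
    generalize y.2 l = b
    fin_cases a <;> fin_cases b <;> simp

/-- A pair uses up two of the N modes and contributes 4 = 2² states; a self-paired mode contributes
2. -/
theorem card_blockLabel (N : ℕ) (q : ℤˣ) :
    Fintype.card (BlockLabel N q) = Fintype.card (Config N) := by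
  have h := sum_eq_pairModes_add_selfModes (N := N) q fun _ => 1
  simp only [Finset.sum_const, smul_eq_mul, mul_one, Finset.card_univ, Fintype.card_fin] at h
  simp only [BlockLabel, Config, Fintype.card_prod, Fintype.card_fun, Fintype.card_fin,
    Fintype.card_coe]
  conv_rhs => rw [h]
  rw [pow_add, mul_comm _ (1 + 1), pow_mul]
  norm_num

theorem commute_blockOp (n : ℕ) (J φ : ℝ) {l i : Fin N} (h1 : i ≠ l) (h2 : i ≠ modeInv q l) :
    Commute (blockOp N n J φ (waveNumber N q l)) (mode N q i)ᴴ := by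
  have hcar := isCAR_mode N q
  have a1 := hcar.conjTranspose_mul_comm l i
  have a2 := hcar.conjTranspose_mul_comm (modeInv q l) i
  have a3 := hcar.mul_conjTranspose_of_ne h1.symm
  have a4 := hcar.mul_conjTranspose_of_ne h2.symm
  unfold blockOp
  rw [b_neg_waveNumber]
  change Commute (_ • ((mode N q l)ᴴ * (mode N q (modeInv q l))ᴴ
    - mode N q (modeInv q l) * mode N q l) + _ • ((mode N q l)ᴴ * mode N q l
    + (mode N q (modeInv q l))ᴴ * mode N q (modeInv q l) - 1)) _
  refine Commute.add_left (Commute.smul_left (Commute.sub_left ?_ ?_) _)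
    (Commute.smul_left (Commute.sub_left (Commute.add_left ?_ ?_) (Commute.one_left _)) _)
  · exact commute_mul_of_anti a1 a2
  · exact commute_mul_of_anti a4 a3
  · exact commute_mul_of_anti a1 a3
  · exact commute_mul_of_anti a2 a4

theorem fock_sum {κ ι α : Type*} [Fintype ι] [DecidableEq ι] (a : κ → Matrix ι ι ℂ)
    (S : Finset α) (z : α → ℂ) (w : α → ι → ℂ) (L : List κ) :
    fock a (∑ i ∈ S, z i • w i) L = ∑ i ∈ S, z i • fock a (w i) L := by
  simp only [fock, ← Matrix.mulVecLin_apply, map_sum, map_smul]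

/-- The block is even in its own two modes, so it commutes with every creation operator standing to
the left of its pair. What stands to the right is killed by both of its annihilators and serves as a
vacuum for the four states. -/
theorem blockOp_mulVec_labelList (n : ℕ) (J φ : ℝ) {v : Config N → ℂ}
    (hv : ∀ i, mode N q i *ᵥ v = 0) (s : ↥(pairModes N q) → Fin 4)
    (t : ↥(selfModes N q) → Fin 2) (l : ↥(pairModes N q)) :
    blockOp N n J φ (waveNumber N q l.1) *ᵥ fock (mode N q) v (labelList s t)
      = ∑ x : Fin 4, blockMatrix n J φ (waveNumber N q l.1) x (s l) •
          fock (mode N q) v (labelList (Function.update s l x) t) := by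
  have hcar := isCAR_mode N q
  have hnd := Finset.nodup_toList (Finset.univ : Finset ↥(pairModes N q))
  -- The fixed enumeration of the pairs is cut at l; changing the label of l alters only the middle
  -- segment, so no reordering signs arise.
  obtain ⟨A, B, hAB⟩ := List.append_of_mem (Finset.mem_toList.2 (Finset.mem_univ l))
  rw [hAB] at hnd
  have hA : l ∉ A := fun h => by
    have := (List.nodup_append.1 hnd).2.2 l h l (by simp)
    exact this rfl
  have hB : l ∉ B := (List.nodup_cons.1 (List.nodup_append.1 hnd).2.1).1
  have hsplit : ∀ x, labelList (Function.update s l x) t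
      = pairPart s A ++ (pairList l.1 (modeInv q l.1) x ++ (pairPart s B ++ selfPart t)) := by
    intro x
    have hu : ∀ P : List ↥(pairModes N q), l ∉ P →
        pairPart (Function.update s l x) P = pairPart s P := by
      intro P hP
      refine List.flatMap_congr fun i hi => ?_
      rw [Function.update_of_ne (fun h : i = l => hP (h ▸ hi))]
    rw [labelList, hAB, ← hu A hA, ← hu B hB]
    simp [pairPart]
  have hs := hsplit (s l)
  rw [Function.update_eq_self] at hs
  set w := fock (mode N q) v (pairPart s B ++ selfPart t) with hw
  have hkill : ∀ i, (i = l.1 ∨ i = modeInv q l.1) → mode N q i *ᵥ w = 0 := by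
    intro i hi
    refine hcar.mulVec_fock_of_notMem (hv i) ?_
    rw [List.mem_append, mem_pairPart_iff hi, not_or]
    exact ⟨fun h => hB h.1, fun h =>
      notMem_selfModes_of_pair hi (mem_selfModes_of_mem_selfPart h)⟩
  have hcomm : ∀ i ∈ pairPart s A,
      Commute (blockOp N n J φ (waveNumber N q l.1)) (mode N q i)ᴴ := by
    intro i hi
    refine commute_blockOp n J φ (fun h => ?_) (fun h => ?_)
    · exact hA ((mem_pairPart_iff (Or.inl h)).1 hi).1
    · exact hA ((mem_pairPart_iff (Or.inr h)).1 hi).1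
  have hw1 := hkill l.1 (Or.inl rfl)
  have hw2 := hkill (modeInv q l.1) (Or.inr rfl)
  have hblock : blockOp N n J φ (waveNumber N q l.1) *ᵥ
      fock (mode N q) w (pairList l.1 (modeInv q l.1) (s l))
      = ∑ x : Fin 4, blockMatrix n J φ (waveNumber N q l.1) x (s l) •
          fock (mode N q) w (pairList l.1 (modeInv q l.1) x) := by
    unfold blockOp
    rw [b_neg_waveNumber]
    change (_ • ((mode N q l.1)ᴴ * (mode N q (modeInv q l.1))ᴴ
      - mode N q (modeInv q l.1) * mode N q l.1) + _ • ((mode N q l.1)ᴴ * mode N q l.1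
      + (mode N q (modeInv q l.1))ᴴ * mode N q (modeInv q l.1) - 1)) *ᵥ _ = _
    rw [Matrix.add_mulVec, Matrix.smul_mulVec, Matrix.smul_mulVec,
      hcar.pair_mulVec (ne_modeInv l.2) hw1 hw2, hcar.number_pair_mulVec (ne_modeInv l.2) hw1 hw2,
      Fin.sum_univ_four]
    generalize s l = x
    fin_cases x <;> simp [blockMatrix, add_comm]
  rw [hs, fock_append, fock_append, ← hw, mulVec_fock_of_commute hcomm, hblock, fock_sum]
  exact Finset.sum_congr rfl fun x _ => by rw [hsplit, fock_append, fock_append]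

theorem exists_productBasis (N n : ℕ) (J φ : ℝ) (q : ℤˣ) :
    ∃ e : OrthonormalBasis (BlockLabel N q) ℂ (EuclideanSpace ℂ (Config N)),
      ∀ (s : ↥(pairModes N q) → Fin 4) (t : ↥(selfModes N q) → Fin 2),
      (∀ l : ↥(pairModes N q),
        Matrix.toEuclideanLin ((b N (waveNumber N q l.1))ᴴ * b N (waveNumber N q l.1)) (e (s, t))
          = occPlus (s l) • e (s, t) ∧
        Matrix.toEuclideanLin ((b N (-waveNumber N q l.1))ᴴ * b N (-waveNumber N q l.1)) (e (s, t))
          = occMinus (s l) • e (s, t) ∧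
        Matrix.toEuclideanLin (blockOp N n J φ (waveNumber N q l.1)) (e (s, t))
          = ∑ a : Fin 4, blockMatrix n J φ (waveNumber N q l.1) a (s l) •
              e (Function.update s l a, t)) ∧
      (∀ l : ↥(selfModes N q),
        Matrix.toEuclideanLin ((b N (waveNumber N q l.1))ᴴ * b N (waveNumber N q l.1)) (e (s, t))
          = (((t l).val : ℕ) : ℂ) • e (s, t)) := by
  have hcar := isCAR_mode N q
  obtain ⟨v, hv1, hv⟩ := hcar.exists_vacuum
  obtain ⟨e, he⟩ := exists_orthonormalBasis
    (fun x : BlockLabel N q => fock (mode N q) v (labelList x.1 x.2)) (card_blockLabel N q) (by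
      intro x y
      split_ifs with h
      · subst h
        exact hcar.fock_norm hv1 hv (labelList_nodup _ _)
      · obtain ⟨m, hm⟩ := exists_mem_labelList_ne h
        exact hcar.fock_orthogonal hv (labelList_nodup _ _) (labelList_nodup _ _) hm)
  have hnum : ∀ (i : Fin N) (s : ↥(pairModes N q) → Fin 4) (t : ↥(selfModes N q) → Fin 2) (z : ℂ),
      (i ∈ labelList s t → z = 1) → (i ∉ labelList s t → z = 0) →
      Matrix.toEuclideanLin ((mode N q i)ᴴ * mode N q i) (e (s, t)) = z • e (s, t) := by
    intro i s t z h1 h0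
    rw [he, toEuclideanLin_toLp, ← WithLp.toLp_smul]
    congr 1
    by_cases h : i ∈ labelList s t
    · rw [hcar.mulVec_number_of_mem (hv i) (labelList_nodup _ _) h, h1 h, one_smul]
    · rw [hcar.mulVec_number_of_notMem (hv i) h, h0 h, zero_smul]
  refine ⟨e, fun s t => ⟨fun l => ⟨?_, ?_, ?_⟩, fun l => ?_⟩⟩
  · have hne := ne_modeInv l.2
    refine hnum l.1 s t _ ?_ ?_ <;> rw [mem_labelList_pair (Or.inl rfl)] <;>
      generalize s l = x <;> fin_cases x <;> simp [pairList, occPlus, hne]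
  · have hne := ne_modeInv l.2
    rw [b_neg_waveNumber]
    refine hnum (modeInv q l.1) s t _ ?_ ?_ <;> rw [mem_labelList_pair (Or.inr rfl)] <;>
      generalize s l = x <;> fin_cases x <;> simp [pairList, occMinus, hne.symm]
  · simp only [he, toEuclideanLin_toLp]
    rw [blockOp_mulVec_labelList n J φ hv, WithLp.toLp_sum]
    rfl
  · refine hnum l.1 s t _ ?_ ?_ <;> rw [mem_labelList_self] <;>
      generalize t l = x <;> fin_cases x <;> simp

end ProductBasis

/-! ### The Bogoliubov transformation -/

/-- The Bogoliubov rotation of the modes `l` and `σ l`. -/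
def bogoliubov {κ ι : Type*} (a : κ → Matrix ι ι ℂ) (σ : κ → κ) (C S : κ → ℝ) (l : κ) :
    Matrix ι ι ℂ :=
  (C l : ℂ) • a l + (Complex.I * (S l : ℂ)) • (a (σ l))ᴴ

theorem bogoliubov_conjTranspose {κ ι : Type*} {a : κ → Matrix ι ι ℂ} {σ : κ → κ} {C S : κ → ℝ}
    (l : κ) :
    (bogoliubov a σ C S l)ᴴ = (C l : ℂ) • (a l)ᴴ - (Complex.I * (S l : ℂ)) • a (σ l) := by
  rw [bogoliubov, Matrix.conjTranspose_add, Matrix.conjTranspose_smul, Matrix.conjTranspose_smul,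
    Matrix.conjTranspose_conjTranspose]
  simp only [star_mul', Complex.star_def, Complex.conj_ofReal, Complex.conj_I]
  module

section Bogoliubov

variable {κ ι : Type*} [DecidableEq κ] [Fintype ι] [DecidableEq ι] {a : κ → Matrix ι ι ℂ}
  {σ : κ → κ} {C S : κ → ℝ}

/-- `h1` normalizes each rotated mode; `h2` is the only condition coming from the partner and
removes the anticommutator of the rotated modes l and σ l. -/
theorem IsCAR.bogoliubov (h : IsCAR a) (hσ : Function.Involutive σ)
    (h1 : ∀ l, C l ^ 2 + S l ^ 2 = 1) (h2 : ∀ l, C l * S (σ l) + S l * C (σ l) = 0) :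
    IsCAR (bogoliubov a σ C S) where
  anti l m := by
    have e1 : a l * (a (σ m))ᴴ = (if l = σ m then 1 else 0) - (a (σ m))ᴴ * a l :=
      eq_sub_of_add_eq (h.anti_star l (σ m))
    have e2 : a m * (a (σ l))ᴴ = (if m = σ l then 1 else 0) - (a (σ l))ᴴ * a m :=
      eq_sub_of_add_eq (h.anti_star m (σ l))
    have e3 := h.mul_comm l m
    have e4 := h.conjTranspose_mul_comm (σ l) (σ m)
    have e5 : (m = σ l) = (l = σ m) := by
      apply propext
      constructor <;> rintro rfl <;> simp [hσ _]
    simp only [ClusterIsing.bogoliubov, add_mul, mul_add, smul_mul_assoc, mul_smul_comm, e1, e2,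
      e3, e4, e5]
    split_ifs with hlm
    · subst hlm
      have h2' := h2 m
      have h3 : (C m : ℂ) * (S (σ m) : ℂ) + (S m : ℂ) * (C (σ m) : ℂ) = 0 := by
        exact_mod_cast h2'
      -- After normal ordering only this multiple of the identity survives.
      have : ∀ X : Matrix ι ι ℂ, (Complex.I * ((C m : ℂ) * (S (σ m) : ℂ)
          + (S m : ℂ) * (C (σ m) : ℂ))) • X = 0 := fun X => by rw [h3, mul_zero, zero_smul]
      rw [← this 1]
      module
    · module
  anti_star l m := by
    have e1 : a l * (a m)ᴴ = (if l = m then 1 else 0) - (a m)ᴴ * a l :=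
      eq_sub_of_add_eq (h.anti_star l m)
    have e2 : a (σ m) * (a (σ l))ᴴ = (if l = m then 1 else 0) - (a (σ l))ᴴ * a (σ m) := by
      have := eq_sub_of_add_eq (h.anti_star (σ m) (σ l))
      rw [this]
      congr 1
      simp only [hσ.injective.eq_iff, eq_comm]
    have e3 := h.mul_comm l (σ m)
    have e4 := h.conjTranspose_mul_comm (σ l) m
    simp only [bogoliubov_conjTranspose]
    simp only [ClusterIsing.bogoliubov, add_mul, mul_add, sub_mul, mul_sub, smul_mul_assoc,
      mul_smul_comm, e1, e2, e3, e4]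
    split_ifs with hlm
    · subst hlm
      -- `I ^ 2` is kept unevaluated because `module` treats `I` as an atom.
      have h3 : (C l : ℂ) ^ 2 - Complex.I ^ 2 * (S l : ℂ) ^ 2 = 1 := by
        rw [Complex.I_sq]
        have : (C l : ℂ) ^ 2 + (S l : ℂ) ^ 2 = 1 := by exact_mod_cast h1 l
        linear_combination this
      have : ((C l : ℂ) ^ 2 - Complex.I ^ 2 * (S l : ℂ) ^ 2) • (1 : Matrix ι ι ℂ) = 1 := by
        rw [h3, one_smul]
      refine Eq.trans ?_ this
      module
    · module

theorem IsCAR.bogoliubov_number (h : IsCAR a) (l : κ) :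
    (ClusterIsing.bogoliubov a σ C S l)ᴴ * ClusterIsing.bogoliubov a σ C S l
      = ((C l : ℂ) ^ 2) • ((a l)ᴴ * a l) + ((S l : ℂ) ^ 2) • (1 - (a (σ l))ᴴ * a (σ l))
        + (Complex.I * ((C l : ℂ) * (S l : ℂ))) • ((a l)ᴴ * (a (σ l))ᴴ - a (σ l) * a l) := by
  rw [bogoliubov_conjTranspose]
  simp only [ClusterIsing.bogoliubov, mul_add, sub_mul, smul_mul_assoc, mul_smul_comm,
    h.mul_conjTranspose_self]
  have : (S l : ℂ) ^ 2 = -(Complex.I ^ 2 * (S l : ℂ) ^ 2) := by rw [Complex.I_sq]; ring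
  rw [this]
  module

/-- For a single mode the two sides differ by (r - ε) times the difference of the occupations of l
and σ l. As r and ε are invariant under σ, this cancels in the sum. -/
theorem IsCAR.sum_bogoliubov_number [Fintype κ] (h : IsCAR a) (hσ : Function.Involutive σ)
    (h1 : ∀ l, C l ^ 2 + S l ^ 2 = 1) {r ε δ : κ → ℝ} (hr : ∀ l, r (σ l) = r l)
    (hε : ∀ l, ε (σ l) = ε l) (hC : ∀ l, r l * (C l ^ 2 - S l ^ 2) = ε l)
    (hS : ∀ l, 2 * r l * (C l * S l) = δ l) :
    ∑ l, (r l : ℂ) • ((2 : ℂ) • ((ClusterIsing.bogoliubov a σ C S l)ᴴ *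
        ClusterIsing.bogoliubov a σ C S l) - 1)
      = ∑ l, ((ε l : ℂ) • ((2 : ℂ) • ((a l)ᴴ * a l) - 1)
        + (Complex.I * (δ l : ℂ)) • ((a l)ᴴ * (a (σ l))ᴴ - a (σ l) * a l)) := by
  have hsum : ∑ l, ((r l - ε l : ℝ) : ℂ) • ((a (σ l))ᴴ * a (σ l))
      = ∑ l, ((r l - ε l : ℝ) : ℂ) • ((a l)ᴴ * a l) := by
    rw [← Equiv.sum_comp hσ.toPerm fun l => ((r l - ε l : ℝ) : ℂ) • ((a l)ᴴ * a l)]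
    refine Finset.sum_congr rfl fun l _ => ?_
    simp only [Function.Involutive.coe_toPerm, hr, hε]
  rw [← sub_eq_zero] at hsum ⊢
  rw [← neg_eq_zero] at hsum
  rw [← hsum, ← Finset.sum_sub_distrib, ← Finset.sum_sub_distrib, ← Finset.sum_neg_distrib]
  refine Finset.sum_congr rfl fun l _ => ?_
  rw [h.bogoliubov_number]
  have k1 : 2 * (r l : ℂ) * (C l : ℂ) ^ 2 = r l + ε l := by
    have : 2 * r l * C l ^ 2 = r l + ε l := by linear_combination r l * h1 l + hC l
    exact_mod_cast this
  have k2 : 2 * (r l : ℂ) * (S l : ℂ) ^ 2 = r l - ε l := by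
    have : 2 * r l * S l ^ 2 = r l - ε l := by linear_combination r l * h1 l - hC l
    exact_mod_cast this
  have k3 : 2 * (r l : ℂ) * ((C l : ℂ) * (S l : ℂ)) = δ l := by exact_mod_cast hS l
  have : (r l : ℂ) • ((2 : ℂ) • (((C l : ℂ) ^ 2) • ((a l)ᴴ * a l)
      + ((S l : ℂ) ^ 2) • (1 - (a (σ l))ᴴ * a (σ l))
      + (Complex.I * ((C l : ℂ) * (S l : ℂ))) • ((a l)ᴴ * (a (σ l))ᴴ - a (σ l) * a l)) - 1)
    = (2 * (r l : ℂ) * (C l : ℂ) ^ 2) • ((a l)ᴴ * a l)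
      + (2 * (r l : ℂ) * (S l : ℂ) ^ 2) • (1 - (a (σ l))ᴴ * a (σ l))
      + (Complex.I * (2 * (r l : ℂ) * ((C l : ℂ) * (S l : ℂ)))) •
        ((a l)ᴴ * (a (σ l))ᴴ - a (σ l) * a l) - (r l : ℂ) • 1 := by module
  rw [this, k1, k2, k3]
  push_cast
  module

/-- The eigenbasis of a free fermion Hamiltonian. -/
theorem IsCAR.exists_eigenbasis [Fintype κ] [Nonempty ι] (h : IsCAR a)
    (hcard : Fintype.card ι = 2 ^ Fintype.card κ) (r : κ → ℝ) :
    ∃ (v : ι → ℂ) (e : OrthonormalBasis (Finset κ) ℂ (EuclideanSpace ℂ ι)),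
      (∀ i, a i *ᵥ v = 0) ∧ (∀ X, e X = WithLp.toLp 2 (fock a v X.toList)) ∧
      ∀ X, Matrix.toEuclideanLin (∑ l, (r l : ℂ) • ((2 : ℂ) • ((a l)ᴴ * a l) - 1)) (e X)
        = ((∑ l ∈ X, 2 * r l - ∑ l, r l : ℝ) : ℂ) • e X := by
  obtain ⟨v, hv1, hv⟩ := h.exists_vacuum
  obtain ⟨e, he⟩ := exists_orthonormalBasis (fun X : Finset κ => fock a v X.toList)
    (by rw [Fintype.card_finset, hcard]) (by
      intro X Y
      split_ifs with hXY
      · subst hXY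
        exact h.fock_norm hv1 hv X.nodup_toList
      · have : ∃ m, ¬(m ∈ X.toList ↔ m ∈ Y.toList) := by
          by_contra hc
          push Not at hc
          exact hXY (Finset.ext fun m => by simpa using hc m)
        obtain ⟨m, hm⟩ := this
        exact h.fock_orthogonal hv X.nodup_toList Y.nodup_toList hm)
  refine ⟨v, e, hv, he, fun X => ?_⟩
  rw [he, toEuclideanLin_toLp, ← WithLp.toLp_smul]
  congr 1
  have hl : ∀ l, ((r l : ℂ) • ((2 : ℂ) • ((a l)ᴴ * a l) - 1)) *ᵥ fock a v X.toList
      = (((if l ∈ X then 2 * r l else 0) - r l : ℝ) : ℂ) • fock a v X.toList := by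
    intro l
    rw [Matrix.smul_mulVec, Matrix.sub_mulVec, Matrix.smul_mulVec, Matrix.one_mulVec]
    split_ifs with hX
    · rw [h.mulVec_number_of_mem (hv l) X.nodup_toList (by simpa using hX)]
      push_cast; module
    · rw [h.mulVec_number_of_notMem (hv l) (by simpa using hX)]
      push_cast; module
  rw [Matrix.sum_mulVec, Finset.sum_congr rfl fun l _ => hl l, ← Finset.sum_smul]
  congr 1
  rw [← Complex.ofReal_sum, Finset.sum_sub_distrib, Finset.sum_ite_mem, Finset.univ_inter]

end Bogoliubov

/-! ### Half angles -/

/-- The cosine of half the argument of `ε + i δ`. -/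
def halfCos (ε δ : ℝ) : ℝ := Real.cos (Complex.arg ⟨ε, δ⟩ / 2)

/-- The sine of half the argument of `ε + i δ`. -/
def halfSin (ε δ : ℝ) : ℝ := Real.sin (Complex.arg ⟨ε, δ⟩ / 2)

theorem halfCos_sq_add_halfSin_sq (ε δ : ℝ) : halfCos ε δ ^ 2 + halfSin ε δ ^ 2 = 1 :=
  Real.cos_sq_add_sin_sq _

theorem norm_mk (ε δ : ℝ) : ‖(⟨ε, δ⟩ : ℂ)‖ = √(ε ^ 2 + δ ^ 2) := by
  rw [Complex.norm_def, Complex.normSq_mk]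
  congr 1
  ring

theorem sqrt_mul_halfCos_sq_sub (ε δ : ℝ) :
    √(ε ^ 2 + δ ^ 2) * (halfCos ε δ ^ 2 - halfSin ε δ ^ 2) = ε := by
  rw [halfCos, halfSin, ← Real.cos_two_mul', mul_div_cancel₀ _ two_ne_zero, ← norm_mk,
    Complex.norm_mul_cos_arg]

theorem two_mul_sqrt_mul_halfCos_mul (ε δ : ℝ) :
    2 * √(ε ^ 2 + δ ^ 2) * (halfCos ε δ * halfSin ε δ) = δ := by
  have : 2 * √(ε ^ 2 + δ ^ 2) * (halfCos ε δ * halfSin ε δ)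
      = √(ε ^ 2 + δ ^ 2) * Real.sin (2 * (Complex.arg ⟨ε, δ⟩ / 2)) := by
    rw [Real.sin_two_mul, halfCos, halfSin]; ring
  rw [this, mul_div_cancel₀ _ two_ne_zero, ← norm_mk, Complex.norm_mul_sin_arg]

/-- Reversing δ reverses the half angle, so the left side is the sine of the sum of two opposite
half angles. -/
theorem halfCos_mul_halfSin_neg (ε δ : ℝ) :
    halfCos ε δ * halfSin ε (-δ) + halfSin ε δ * halfCos ε (-δ) = 0 := by
  have hconj : (⟨ε, -δ⟩ : ℂ) = (starRingEnd ℂ) ⟨ε, δ⟩ := rfl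
  unfold halfCos halfSin
  rw [hconj, Complex.arg_conj]
  split_ifs with h
  -- On the branch cut the argument stays π under conjugation, but there the half-angle cosine is 0.
  · rw [h, Real.cos_pi_div_two]; ring
  · rw [neg_div, Real.sin_neg, Real.cos_neg]; ring

/-! ### The spectrum of the fermionic Hamiltonian -/

/-- Half the excitation energy of a mode. -/
def halfGap (n : ℕ) (J φ k : ℝ) : ℝ := √(epsilon n J φ k ^ 2 + delta n J φ k ^ 2)

theorem halfGap_nonneg (n : ℕ) (J φ k : ℝ) : 0 ≤ halfGap n J φ k := Real.sqrt_nonneg _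

theorem halfGap_modeInv {N : ℕ} (n : ℕ) (J φ : ℝ) (q : ℤˣ) (l : Fin N) :
    halfGap n J φ (waveNumber N q (modeInv q l)) = halfGap n J φ (waveNumber N q l) := by
  rw [halfGap, epsilon_modeInv, delta_modeInv, neg_sq, halfGap]

/-- The quasiparticle operators that diagonalize the fermionic Hamiltonian. -/
def quasiMode (N n : ℕ) (J φ : ℝ) (q : ℤˣ) : Fin N → Op N :=
  bogoliubov (mode N q) (modeInv q)
    (fun l => halfCos (epsilon n J φ (waveNumber N q l)) (delta n J φ (waveNumber N q l)))
    (fun l => halfSin (epsilon n J φ (waveNumber N q l)) (delta n J φ (waveNumber N q l)))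

theorem isCAR_quasiMode (N n : ℕ) (J φ : ℝ) (q : ℤˣ) : IsCAR (quasiMode N n J φ q) :=
  (isCAR_mode N q).bogoliubov (modeInv_involutive q)
    (fun _ => halfCos_sq_add_halfSin_sq _ _)
    (fun l => by rw [epsilon_modeInv, delta_modeInv]; exact halfCos_mul_halfSin_neg _ _)

theorem fermionHamiltonian_eq_sum_quasiMode {N n : ℕ} (hn : n + 2 ≤ N) (J φ : ℝ) (q : ℤˣ) :
    fermionHamiltonian N n J φ q = ∑ l, (halfGap n J φ (waveNumber N q l) : ℂ) •
      ((2 : ℂ) • ((quasiMode N n J φ q l)ᴴ * quasiMode N n J φ q l) - 1) := by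
  rw [fermionHamiltonian_eq_sum_modeTerm hn]
  exact ((isCAR_mode N q).sum_bogoliubov_number (modeInv_involutive q)
    (fun _ => halfCos_sq_add_halfSin_sq _ _) (fun l => halfGap_modeInv n J φ q l)
    (fun l => epsilon_modeInv n J φ q l) (fun _ => sqrt_mul_halfCos_sq_sub _ _)
    (fun _ => two_mul_sqrt_mul_halfCos_mul _ _)).symm

/-- The energy of the state with quasiparticles in the modes of `X`. -/
def level (N n : ℕ) (J φ : ℝ) (q : ℤˣ) (X : Finset (Fin N)) : ℝ :=
  ∑ l ∈ X, 2 * halfGap n J φ (waveNumber N q l) - ∑ l, halfGap n J φ (waveNumber N q l)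

theorem exists_eigenbasis_fermionHamiltonian {N n : ℕ} (hn : n + 2 ≤ N) (J φ : ℝ) (q : ℤˣ) :
    ∃ (v : Config N → ℂ) (e : OrthonormalBasis (Finset (Fin N)) ℂ (EuclideanSpace ℂ (Config N))),
      (∀ i, quasiMode N n J φ q i *ᵥ v = 0) ∧
      (∀ X, e X = WithLp.toLp 2 (fock (quasiMode N n J φ q) v X.toList)) ∧
      ∀ X, Matrix.toEuclideanLin (fermionHamiltonian N n J φ q) (e X)
        = (level N n J φ q X : ℂ) • e X := by
  rw [fermionHamiltonian_eq_sum_quasiMode hn]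
  exact (isCAR_quasiMode N n J φ q).exists_eigenbasis (by simp [Config]) _

theorem level_empty_le (N n : ℕ) (J φ : ℝ) (q : ℤˣ) (X : Finset (Fin N)) :
    level N n J φ q ∅ ≤ level N n J φ q X := by
  have : 0 ≤ ∑ l ∈ X, 2 * halfGap n J φ (waveNumber N q l) :=
    Finset.sum_nonneg fun l _ => mul_nonneg zero_le_two (halfGap_nonneg _ _ _ _)
  rw [level, level, Finset.sum_empty]
  linarith

theorem isGroundEnergy_fermionHamiltonian {N n : ℕ} (hn : n + 2 ≤ N) (J φ : ℝ) (q : ℤˣ) :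
    IsGroundEnergy (fermionHamiltonian N n J φ q) (level N n J φ q ∅) := by
  obtain ⟨v, e, _, _, he⟩ := exists_eigenbasis_fermionHamiltonian hn J φ q
  refine isGroundEnergy_of_eigenbasis he ⟨⟨∅, rfl⟩, ?_⟩
  rintro _ ⟨X, rfl⟩
  exact level_empty_le N n J φ q X

/-- Excitation energies add and are nonnegative, so the cheapest nonempty set of quasiparticles is a
singleton; a zero mode gives a degenerate ground state and gap 0, in accordance with the
multiplicity count. -/
theorem hasGap_fermionHamiltonian {N n : ℕ} (hn : n + 2 ≤ N) (J φ : ℝ) (q : ℤˣ) {g : ℝ}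
    (hg : IsLeast (Set.range fun l : Fin N => 2 * halfGap n J φ (waveNumber N q l)) g) :
    HasGap (fermionHamiltonian N n J φ q) g := by
  obtain ⟨v, e, _, _, he⟩ := exists_eigenbasis_fermionHamiltonian hn J φ q
  have hd : ∀ X, level N n J φ q X - level N n J φ q ∅
      = ∑ l ∈ X, 2 * halfGap n J φ (waveNumber N q l) := fun X => by
    rw [level, level, Finset.sum_empty]; ring
  refine hasGap_of_eigenbasis he (level_empty_le N n J φ q) ⟨?_, ?_⟩
  · obtain ⟨l, hl⟩ := hg.1
    refine ⟨{l}, Finset.singleton_ne_empty l, ?_⟩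
    rw [hd, Finset.sum_singleton]
    exact hl.symm
  · rintro _ ⟨X, hX, rfl⟩
    obtain ⟨l, hl⟩ := Finset.nonempty_iff_ne_empty.2 hX
    rw [hd]
    exact (hg.2 ⟨l, rfl⟩).trans (Finset.single_le_sum
      (f := fun l => 2 * halfGap n J φ (waveNumber N q l))
      (fun l _ => mul_nonneg zero_le_two (halfGap_nonneg _ _ _ _)) hl)

/-! ### Energies of a block -/

/-- The squares sum to J², and the cross terms combine by the addition formula for cos((n+1)k + k).
-/
theorem epsilon_sq_add_delta_sq (n : ℕ) (J φ k : ℝ) :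
    epsilon n J φ k ^ 2 + delta n J φ k ^ 2
      = J ^ 2 * (1 - Real.cos ((n + 2) * k) * Real.sin (2 * φ)) := by
  have h1 : ((n : ℝ) + 2) * k = (n + 1) * k + k := by ring
  rw [epsilon, delta, h1, Real.cos_add, Real.sin_two_mul]
  have s1 := Real.sin_sq_add_cos_sq (((n : ℝ) + 1) * k)
  have s2 := Real.sin_sq_add_cos_sq k
  have s3 := Real.sin_sq_add_cos_sq φ
  linear_combination J ^ 2 * Real.cos φ ^ 2 * s1 + J ^ 2 * Real.sin φ ^ 2 * s2 + J ^ 2 * s3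

/-- The dispersion relation in units of `2J`. -/
def dispersion (n : ℕ) (φ k : ℝ) : ℝ := √(1 - Real.cos ((n + 2) * k) * Real.sin (2 * φ))

theorem halfGap_eq (n : ℕ) {J : ℝ} (hJ : 0 < J) (φ k : ℝ) :
    halfGap n J φ k = J * dispersion n φ k := by
  rw [halfGap, epsilon_sq_add_delta_sq, Real.sqrt_mul (sq_nonneg J), Real.sqrt_sq hJ.le,
    dispersion]

theorem blockEnergy_eq (n : ℕ) {J : ℝ} (hJ : 0 < J) (φ k : ℝ) :
    blockEnergy n J φ k = -(2 * halfGap n J φ k) := by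
  rw [halfGap_eq n hJ, blockEnergy, dispersion]; ring

theorem continuous_dispersion (n : ℕ) (φ : ℝ) : Continuous (dispersion n φ) := by
  unfold dispersion; fun_prop

theorem cos_mul_sin_le (x y : ℝ) : Real.cos x * Real.sin y ≤ |Real.sin y| := by
  calc Real.cos x * Real.sin y ≤ |Real.cos x * Real.sin y| := le_abs_self _
    _ = |Real.cos x| * |Real.sin y| := abs_mul _ _
    _ ≤ 1 * |Real.sin y| := by gcongr; exact Real.abs_cos_le_one x
    _ = |Real.sin y| := one_mul _

theorem le_dispersion (n : ℕ) (φ k : ℝ) : √(1 - |Real.sin (2 * φ)|) ≤ dispersion n φ k := by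
  unfold dispersion
  gcongr
  exact cos_mul_sin_le _ _

/-- A crude bound suffices: it only has to keep the energy of a single quasiparticle bounded
uniformly in N. -/
theorem dispersion_le_two (n : ℕ) (φ k : ℝ) : dispersion n φ k ≤ 2 := by
  rw [dispersion, Real.sqrt_le_left zero_le_two]
  have h := cos_mul_sin_le (((n : ℝ) + 2) * k) (-(2 * φ))
  have h2 := Real.abs_sin_le_one (-(2 * φ))
  rw [Real.sin_neg] at h h2
  linarith

theorem dispersion_eq_zero_iff {n : ℕ} {φ k : ℝ} :
    dispersion n φ k = 0 ↔ Real.cos ((n + 2) * k) * Real.sin (2 * φ) = 1 := by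
  have h := (cos_mul_sin_le (((n : ℝ) + 2) * k) (2 * φ)).trans (Real.abs_sin_le_one _)
  rw [dispersion, Real.sqrt_eq_zero (by linarith), sub_eq_zero, eq_comm]

theorem blockMatrix_isHermitian (n : ℕ) (J φ k : ℝ) : (blockMatrix n J φ k).IsHermitian := by
  ext i j
  fin_cases i <;> fin_cases j <;> simp [blockMatrix]

/-- The eigenvalues of a block. -/
def blockLevel (n : ℕ) (J φ k : ℝ) : Fin 4 → ℝ :=
  ![-(2 * halfGap n J φ k), 0, 0, 2 * halfGap n J φ k]

theorem exists_eigenbasis_blockMatrix (n : ℕ) (J φ k : ℝ) :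
    ∃ e : OrthonormalBasis (Fin 4) ℂ (EuclideanSpace ℂ (Fin 4)),
      ∀ i, Matrix.toEuclideanLin (blockMatrix n J φ k) (e i)
        = (blockLevel n J φ k i : ℂ) • e i := by
  set C := halfCos (epsilon n J φ k) (delta n J φ k) with hC
  set S := halfSin (epsilon n J φ k) (delta n J φ k) with hS
  have h1 : C ^ 2 + S ^ 2 = 1 := halfCos_sq_add_halfSin_sq _ _
  have h2 : halfGap n J φ k * (C ^ 2 - S ^ 2) = epsilon n J φ k := sqrt_mul_halfCos_sq_sub _ _
  have h3 : 2 * halfGap n J φ k * (C * S) = delta n J φ k := two_mul_sqrt_mul_halfCos_mul _ _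
  have h1c : (C : ℂ) ^ 2 + (S : ℂ) ^ 2 = 1 := by exact_mod_cast h1
  have h2c : (epsilon n J φ k : ℂ) = (halfGap n J φ k : ℂ) * ((C : ℂ) ^ 2 - (S : ℂ) ^ 2) := by
    exact_mod_cast h2.symm
  have h3c : (delta n J φ k : ℂ) = 2 * (halfGap n J φ k : ℂ) * ((C : ℂ) * (S : ℂ)) := by
    exact_mod_cast h3.symm
  have hI := Complex.I_sq
  -- The outer two vectors are the Bogoliubov half-angle rotation of |1,1⟩ and |0,0⟩; the singly
  -- occupied states are null vectors.
  set f : Fin 4 → Fin 4 → ℂ := ![![-(Complex.I * S), C, 0, 0], ![0, 0, 1, 0], ![0, 0, 0, 1],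
    ![C, -(Complex.I * S), 0, 0]] with hf
  obtain ⟨e, he⟩ := exists_orthonormalBasis f rfl (by
    intro i j
    fin_cases i <;> fin_cases j <;>
      simp [hf, dotProduct, Fin.sum_univ_four] <;>
      first
      | ring1
      | linear_combination h1c - (S : ℂ) ^ 2 * hI)
  refine ⟨e, fun i => ?_⟩
  rw [he, toEuclideanLin_toLp, ← WithLp.toLp_smul]
  congr 1
  ext j
  fin_cases i <;> fin_cases j <;>
    simp [hf, blockMatrix, blockLevel, Matrix.mulVec, dotProduct, Fin.sum_univ_four, h2c, h3c] <;>
    first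
    | linear_combination (2 * Complex.I * (halfGap n J φ k : ℂ) * (S : ℂ)) * h1c
    | linear_combination (-2 * Complex.I * (halfGap n J φ k : ℂ) * (S : ℂ)) * h1c
    | linear_combination (4 * (halfGap n J φ k : ℂ) * C * (S : ℂ) ^ 2) * hI
        - (2 * (halfGap n J φ k : ℂ) * C) * h1c
    | linear_combination (-4 * (halfGap n J φ k : ℂ) * C * (S : ℂ) ^ 2) * hI
        + (2 * (halfGap n J φ k : ℂ) * C) * h1c

theorem blockLevel_zero_le (n : ℕ) (J φ k : ℝ) (i : Fin 4) :
    blockLevel n J φ k 0 ≤ blockLevel n J φ k i := by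
  have := halfGap_nonneg n J φ k
  fin_cases i <;> simp [blockLevel] <;> linarith

theorem isGroundEnergy_blockMatrix (n : ℕ) (J φ k : ℝ) :
    IsGroundEnergy (blockMatrix n J φ k) (-(2 * halfGap n J φ k)) := by
  obtain ⟨e, he⟩ := exists_eigenbasis_blockMatrix n J φ k
  refine isGroundEnergy_of_eigenbasis he ⟨⟨0, rfl⟩, ?_⟩
  rintro _ ⟨i, rfl⟩
  exact blockLevel_zero_le n J φ k i

theorem hasGap_blockMatrix (n : ℕ) (J φ k : ℝ) :
    HasGap (blockMatrix n J φ k) (2 * halfGap n J φ k) := by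
  have h := halfGap_nonneg n J φ k
  obtain ⟨e, he⟩ := exists_eigenbasis_blockMatrix n J φ k
  refine hasGap_of_eigenbasis he (blockLevel_zero_le n J φ k) ⟨⟨1, by simp, ?_⟩, ?_⟩
  · simp [blockLevel]
  · rintro _ ⟨i, hi, rfl⟩
    fin_cases i <;> simp [blockLevel] at hi ⊢; linarith

/-- `HasGap` is existential, so excluding gap 0 requires an argument about every eigenbasis: if r >
0, the lowest eigenspace is a line and cannot contain two orthogonal nonzero vectors. -/
theorem hasGap_blockMatrix_zero_iff (n : ℕ) (J φ k : ℝ) :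
    HasGap (blockMatrix n J φ k) 0 ↔ halfGap n J φ k = 0 := by
  constructor
  · rintro ⟨f, y, i₀, hf, hmin, ⟨i, hi, hgap⟩, _⟩
    by_contra hr
    have hpos : 0 < halfGap n J φ k := lt_of_le_of_ne (halfGap_nonneg n J φ k) (Ne.symm hr)
    obtain ⟨e, he⟩ := exists_eigenbasis_blockMatrix n J φ k
    have hleast : y i₀ = -(2 * halfGap n J φ k) :=
      IsLeast.unique (isGroundEnergy_of_eigenbasis hf ⟨⟨i₀, rfl⟩, by
        rintro _ ⟨j, rfl⟩; exact hmin j⟩) (isGroundEnergy_blockMatrix n J φ k)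
    have hi' : y i = -(2 * halfGap n J φ k) := by linarith
    have hexp : ∀ j, y j = -(2 * halfGap n J φ k) → f j = inner ℂ (e 0) (f j) • e 0 := by
      intro j hj
      conv_lhs => rw [← e.sum_repr' (f j)]
      rw [Fin.sum_univ_four]
      have hz : ∀ m : Fin 4, m ≠ 0 → inner ℂ (e m) (f j) = 0 := by
        intro m hm
        refine inner_eq_zero_of_eigenbasis he (hf j) ?_
        rw [hj]
        intro h
        have h' : blockLevel n J φ k m = -(2 * halfGap n J φ k) := by exact_mod_cast h
        fin_cases m <;> simp [blockLevel] at hm h' <;> linarith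
      rw [hz 1 (by decide), hz 2 (by decide), hz 3 (by decide)]
      simp
    have h1 := hexp i₀ hleast
    have h2 := hexp i hi'
    have ho : inner ℂ (f i₀) (f i) = 0 := f.orthonormal.2 (Ne.symm hi)
    have n1 : f i₀ ≠ 0 := f.orthonormal.ne_zero i₀
    have n2 : f i ≠ 0 := f.orthonormal.ne_zero i
    have hee : inner ℂ (e 0) (e 0) = (1 : ℂ) := by
      rw [inner_self_eq_norm_sq_to_K, e.orthonormal.1]; simp
    rw [h1, h2, inner_smul_left, inner_smul_right, hee, mul_one] at ho
    rcases mul_eq_zero.1 ho with h | h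
    · rw [map_eq_zero] at h
      exact n1 (by rw [h1, h, zero_smul])
    · exact n2 (by rw [h2, h, zero_smul])
  · intro h
    have := hasGap_blockMatrix n J φ k
    rwa [h, mul_zero] at this

/-! ### The critical point -/

theorem sin_two_mul_eq_one_iff {φ : ℝ} (h0 : 0 ≤ φ) (h1 : φ ≤ Real.pi / 2) :
    Real.sin (2 * φ) = 1 ↔ φ = Real.pi / 4 := by
  have hpi := Real.pi_pos
  constructor
  · intro h
    rw [Real.sin_eq_one_iff] at h
    obtain ⟨m, hm⟩ := h
    have hm0 : m = 0 := by
      have a1 : (m : ℝ) < 1 := by nlinarith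
      have a2 : (-1 : ℝ) < m := by nlinarith
      have b1 : m < 1 := by exact_mod_cast a1
      have b2 : -1 < m := by exact_mod_cast a2
      omega
    rw [hm0] at hm
    push_cast at hm
    linarith
  · rintro rfl
    rw [show 2 * (Real.pi / 4) = Real.pi / 2 by ring, Real.sin_pi_div_two]

theorem sin_two_mul_nonneg {φ : ℝ} (h0 : 0 ≤ φ) (h1 : φ ≤ Real.pi / 2) :
    0 ≤ Real.sin (2 * φ) :=
  Real.sin_nonneg_of_nonneg_of_le_pi (by linarith) (by linarith)

theorem cos_mul_eq_one_iff (n : ℕ) {k : ℝ} (h0 : 0 ≤ k) (h1 : k < 2 * Real.pi) :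
    Real.cos ((n + 2) * k) = 1 ↔ ∃ j : ℕ, j ≤ n + 1 ∧ k = 2 * j * Real.pi / (n + 2) := by
  have hpi := Real.pi_pos
  have hn : (0 : ℝ) < n + 2 := by positivity
  rw [Real.cos_eq_one_iff]
  constructor
  · rintro ⟨m, hm⟩
    have a1 : (m : ℝ) < n + 2 := by
      have : (m : ℝ) * (2 * Real.pi) < (n + 2) * (2 * Real.pi) := by rw [hm]; gcongr
      exact lt_of_mul_lt_mul_right this (by positivity)
    have a2 : (0 : ℝ) ≤ m := by
      have : 0 ≤ (m : ℝ) * (2 * Real.pi) := by rw [hm]; positivity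
      exact nonneg_of_mul_nonneg_left this (by positivity)
    have b1 : m < n + 2 := by exact_mod_cast a1
    have b2 : 0 ≤ m := by exact_mod_cast a2
    lift m to ℕ using b2
    refine ⟨m, by omega, ?_⟩
    rw [eq_div_iff hn.ne']
    push_cast at hm
    linarith
  · rintro ⟨j, _, rfl⟩
    refine ⟨j, ?_⟩
    push_cast
    field_simp

/-- For φ in this range sin 2φ ≥ 0, so a product of a cosine and sin 2φ equals 1 only if both
factors do. -/
theorem dispersion_eq_zero_iff_critical (n : ℕ) {φ k : ℝ} (hφ0 : 0 ≤ φ) (hφ1 : φ ≤ Real.pi / 2)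
    (h0 : 0 ≤ k) (h1 : k < 2 * Real.pi) :
    dispersion n φ k = 0 ↔
      φ = Real.pi / 4 ∧ ∃ j : ℕ, j ≤ n + 1 ∧ k = 2 * j * Real.pi / (n + 2) := by
  rw [dispersion_eq_zero_iff, ← sin_two_mul_eq_one_iff hφ0 hφ1, ← cos_mul_eq_one_iff n h0 h1]
  have a1 := Real.sin_le_one (2 * φ)
  have a2 := Real.cos_le_one ((n + 2) * k)
  have a3 := sin_two_mul_nonneg hφ0 hφ1
  constructor
  · intro h
    have b1 : Real.sin (2 * φ) = 1 := by nlinarith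
    rw [b1, mul_one] at h
    exact ⟨b1, h⟩
  · rintro ⟨b1, b2⟩
    rw [b1, b2, mul_one]

theorem limitGap_eq_zero_iff {J φ : ℝ} (hJ : 0 < J) (h0 : 0 ≤ φ) (h1 : φ ≤ Real.pi / 2) :
    2 * J * √(1 - |Real.sin (2 * φ)|) = 0 ↔ φ = Real.pi / 4 := by
  rw [← sin_two_mul_eq_one_iff h0 h1, abs_of_nonneg (sin_two_mul_nonneg h0 h1),
    mul_eq_zero_iff_left (by positivity),
    Real.sqrt_eq_zero (by linarith [Real.sin_le_one (2 * φ)]), sub_eq_zero, eq_comm]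

/-! ### The ground state energy of the fermionic Hamiltonian -/

/-- δ is odd in k, and these modes are fixed by k ↦ -k. -/
theorem delta_eq_zero_of_mem_selfModes {N : ℕ} (n : ℕ) (J φ : ℝ) {q : ℤˣ} {l : Fin N}
    (hl : l ∈ selfModes N q) : delta n J φ (waveNumber N q l) = 0 := by
  have h := delta_modeInv n J φ q l
  rw [modeInv_of_mem_selfModes hl] at h
  linarith

theorem halfGap_of_mem_selfModes {N : ℕ} (n : ℕ) (J φ : ℝ) {q : ℤˣ} {l : Fin N}
    (hl : l ∈ selfModes N q) :
    halfGap n J φ (waveNumber N q l) = |epsilon n J φ (waveNumber N q l)| := by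
  rw [halfGap, delta_eq_zero_of_mem_selfModes n J φ hl, zero_pow two_ne_zero, add_zero,
    Real.sqrt_sq_eq_abs]

theorem sum_blockEnergy (N n : ℕ) {J : ℝ} (hJ : 0 < J) (φ : ℝ) (q : ℤˣ) :
    ∑ l ∈ pairModes N q, blockEnergy n J φ (waveNumber N q l)
      = level N n J φ q ∅ + ∑ l ∈ selfModes N q, halfGap n J φ (waveNumber N q l) := by
  rw [level, Finset.sum_empty, sum_eq_pairModes_add_selfModes q]
  simp only [halfGap_modeInv, blockEnergy_eq n hJ, Finset.sum_neg_distrib, two_mul]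
  ring

theorem sum_blockEnergy_sub (N n : ℕ) {J : ℝ} (hJ : 0 < J) (φ : ℝ) (q : ℤˣ) :
    ∑ l ∈ pairModes N q, blockEnergy n J φ (waveNumber N q l)
      - ∑ l ∈ selfModes N q, |epsilon n J φ (waveNumber N q l)| = level N n J φ q ∅ := by
  rw [sum_blockEnergy N n hJ, Finset.sum_congr rfl fun l hl => halfGap_of_mem_selfModes n J φ hl]
  ring

/-! ### The ground state energy of the spin chain -/

theorem parity_mode {N : ℕ} (q : ℤˣ) (l : Fin N) :
    parity N * mode N q l = -(mode N q l * parity N) := by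
  rw [mode_eq, Finset.mul_sum, Finset.sum_mul, ← Finset.sum_neg_distrib]
  exact Finset.sum_congr rfl fun j _ => by
    rw [mul_smul_comm, parity_c, smul_neg, smul_mul_assoc]

theorem parity_conjTranspose (N : ℕ) : (parity N)ᴴ = parity N := by
  rw [parity_eq, zString_conjTranspose]

theorem parity_conjTranspose_of_parity {N : ℕ} {A : Op N} (h : parity N * A = -(A * parity N)) :
    parity N * Aᴴ = -(Aᴴ * parity N) := by
  have := congrArg Matrix.conjTranspose h
  rw [Matrix.conjTranspose_neg, Matrix.conjTranspose_mul, Matrix.conjTranspose_mul,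
    parity_conjTranspose] at this
  rw [this, neg_neg]

theorem parity_quasiMode {N : ℕ} (n : ℕ) (J φ : ℝ) (q : ℤˣ) (l : Fin N) :
    parity N * quasiMode N n J φ q l = -(quasiMode N n J φ q l * parity N) := by
  rw [quasiMode, bogoliubov, mul_add, add_mul, mul_smul_comm, mul_smul_comm, parity_mode,
    parity_conjTranspose_of_parity (parity_mode _ _), smul_mul_assoc, smul_mul_assoc, smul_neg,
    smul_neg, neg_add]

theorem parityProj_mul_parityProj (N : ℕ) (q q' : ℤˣ) :
    parityProj N q * parityProj N q' = if q = q' then parityProj N q else 0 := by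
  have h := parity_mul_self N
  have hne : (1 : ℤˣ) ≠ -1 := by decide
  have e : parityProj N q * parityProj N q'
      = (1 / 4 : ℂ) • ((1 + sgn q * sgn q') • 1 + (sgn q + sgn q') • parity N) := by
    simp only [parityProj, smul_mul_smul_comm, add_mul, mul_add, one_mul, mul_one, h]
    module
  rw [e]
  rcases Int.units_eq_one_or q with rfl | rfl <;> rcases Int.units_eq_one_or q' with rfl | rfl <;>
    simp [hne, hne.symm, sgn, parityProj] <;> module

theorem commute_fermionHamiltonian_parityProj {N : ℕ} (n : ℕ) (J φ : ℝ) (q q' : ℤˣ) :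
    Commute (fermionHamiltonian N n J φ q) (parityProj N q') :=
  Commute.smul_right ((Commute.one_right _).add_right
    (Commute.smul_right (fermionHamiltonian_commute_parity n J φ q) _)) _

theorem parityProj_add_parityProj (N : ℕ) : parityProj N 1 + parityProj N (-1) = 1 := by
  unfold parityProj sgn
  push_cast
  module

theorem parityProj_mul_hamiltonian {N n : ℕ} (hn : n + 2 ≤ N) (J φ : ℝ) (q : ℤˣ) :
    parityProj N q * hamiltonian N n J φ = fermionHamiltonian N n J φ q * parityProj N q := by
  have hne : (1 : ℤˣ) ≠ -1 := by decide
  rw [hamiltonian_eq hn, mul_add, ← mul_assoc, ← mul_assoc,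
    ← (commute_fermionHamiltonian_parityProj n J φ 1 q).eq,
    ← (commute_fermionHamiltonian_parityProj n J φ (-1) q).eq, mul_assoc, mul_assoc,
    parityProj_mul_parityProj, parityProj_mul_parityProj]
  rcases Int.units_eq_one_or q with rfl | rfl <;> simp [hne, hne.symm]

theorem hamiltonian_mul_parityProj {N n : ℕ} (hn : n + 2 ≤ N) (J φ : ℝ) (q : ℤˣ) :
    hamiltonian N n J φ * parityProj N q = fermionHamiltonian N n J φ q * parityProj N q := by
  have hne : (1 : ℤˣ) ≠ -1 := by decide
  rw [hamiltonian_eq hn, add_mul, mul_assoc, mul_assoc, parityProj_mul_parityProj,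
    parityProj_mul_parityProj]
  rcases Int.units_eq_one_or q with rfl | rfl <;> simp [hne, hne.symm]

/-- An eigenvector of the chain has a nonzero component in some parity sector q, and this component
is an eigenvector of F_q with the same eigenvalue. -/
theorem level_le_of_hasEigenvalue {N n : ℕ} (hn : n + 2 ≤ N) (J φ : ℝ) {x : ℝ}
    (hx : Module.End.HasEigenvalue (Matrix.toLin' (hamiltonian N n J φ)) (x : ℂ)) :
    ∃ q : ℤˣ, level N n J φ q ∅ ≤ x := by
  obtain ⟨w, h0, hw⟩ := hasEigenvalue_toLin'_iff.1 hx
  have hq : ∃ q, parityProj N q *ᵥ w ≠ 0 := by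
    by_contra hc
    push Not at hc
    apply h0
    rw [← Matrix.one_mulVec w, ← parityProj_add_parityProj, Matrix.add_mulVec, hc, hc, add_zero]
  obtain ⟨q, hq⟩ := hq
  refine ⟨q, (isGroundEnergy_fermionHamiltonian hn J φ q).2 ?_⟩
  refine hasEigenvalue_toLin'_iff.2 ⟨parityProj N q *ᵥ w, hq, ?_⟩
  rw [Matrix.mulVec_mulVec, ← parityProj_mul_hamiltonian hn, ← Matrix.mulVec_mulVec, hw,
    Matrix.mulVec_smul]

/-- If the quasiparticle vacuum of F_q has a component of parity q, that component is an eigenvector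
of the chain. Otherwise the vacuum has the opposite parity, and adding one quasiparticle corrects
it. -/
theorem exists_hasEigenvalue_hamiltonian {N n : ℕ} (hn : n + 2 ≤ N) (J φ : ℝ) (q : ℤˣ) :
    ∃ x : ℝ, Module.End.HasEigenvalue (Matrix.toLin' (hamiltonian N n J φ)) (x : ℂ) ∧
      ∃ k, x ≤ level N n J φ q ∅ + 2 * halfGap n J φ k := by
  obtain ⟨v, e, hv, he, hlev⟩ := exists_eigenbasis_fermionHamiltonian hn J φ q
  have hF : ∀ X, fermionHamiltonian N n J φ q *ᵥ fock (quasiMode N n J φ q) v X.toList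
      = (level N n J φ q X : ℂ) • fock (quasiMode N n J φ q) v X.toList := by
    intro X
    have := hlev X
    rw [he, toEuclideanLin_toLp] at this
    exact congrArg WithLp.ofLp this
  have hne : ∀ X : Finset (Fin N), fock (quasiMode N n J φ q) v X.toList ≠ 0 := by
    intro X h
    have := e.orthonormal.ne_zero X
    rw [he, h] at this
    exact this rfl
  have hP : ∀ X, parityProj N q *ᵥ fock (quasiMode N n J φ q) v X.toList ≠ 0 →
      Module.End.HasEigenvalue (Matrix.toLin' (hamiltonian N n J φ))
        (level N n J φ q X : ℂ) := by
    intro X hX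
    refine hasEigenvalue_toLin'_iff.2 ⟨_, hX, ?_⟩
    rw [Matrix.mulVec_mulVec, hamiltonian_mul_parityProj hn,
      (commute_fermionHamiltonian_parityProj n J φ q q).eq, ← Matrix.mulVec_mulVec, hF,
      Matrix.mulVec_smul]
  by_cases h : parityProj N q *ᵥ fock (quasiMode N n J φ q) v (∅ : Finset (Fin N)).toList = 0
  · have hpos : 0 < N := by omega
    let l : Fin N := ⟨0, hpos⟩
    refine ⟨level N n J φ q {l}, hP _ fun h' => hne {l} ?_, waveNumber N q l, ?_⟩
    · have hv0 : parityProj N q *ᵥ v = 0 := by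
        rwa [Finset.toList_empty, fock_nil] at h
      -- A creation operator is odd, so it turns P_q into 1 - P_q; as P_q kills the vacuum, P_q
      -- fixes the one-particle state.
      have hc : parityProj N q * (quasiMode N n J φ q l)ᴴ
          = (quasiMode N n J φ q l)ᴴ - (quasiMode N n J φ q l)ᴴ * parityProj N q := by
        simp only [parityProj, smul_mul_assoc, mul_smul_comm, add_mul, mul_add, one_mul, mul_one,
          parity_conjTranspose_of_parity (parity_quasiMode n J φ q l)]
        module
      rw [Finset.toList_singleton, fock_cons, fock_nil, Matrix.mulVec_mulVec, hc,
        Matrix.sub_mulVec, ← Matrix.mulVec_mulVec, hv0, Matrix.mulVec_zero, sub_zero] at h'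
      rw [Finset.toList_singleton, fock_cons, fock_nil, h']
    · simp only [level, Finset.sum_singleton, Finset.sum_empty]
      linarith
  · refine ⟨level N n J φ q ∅, hP _ h, 0, ?_⟩
    have := halfGap_nonneg n J φ 0
    linarith

theorem exists_isGroundEnergy_hamiltonian {N n : ℕ} (hn : n + 2 ≤ N) {J : ℝ} (hJ : 0 < J)
    (φ : ℝ) : ∃ E : ℝ, IsGroundEnergy (hamiltonian N n J φ) E ∧
      E ≤ level N n J φ 1 ∅ + 4 * J ∧ ∃ q : ℤˣ, level N n J φ q ∅ ≤ E := by
  obtain ⟨x, hx, k, hxk⟩ := exists_hasEigenvalue_hamiltonian hn J φ 1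
  -- Finiteness and nonemptiness of the set of real eigenvalues yield a least one.
  have hfin : {y : ℝ | Module.End.HasEigenvalue (Matrix.toLin' (hamiltonian N n J φ))
      (y : ℂ)}.Finite :=
    Set.Finite.preimage (Complex.ofReal_injective.injOn)
      (Module.End.finite_hasEigenvalue (f := Matrix.toLin' (hamiltonian N n J φ)))
  obtain ⟨E, hE, hmin⟩ := Set.exists_min_image _ id hfin ⟨x, hx⟩
  refine ⟨E, ⟨hE, hmin⟩, (hmin x hx).trans (hxk.trans ?_), level_le_of_hasEigenvalue hn J φ hE⟩
  rw [halfGap_eq n hJ]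
  nlinarith [dispersion_le_two n φ k]

/-! ### Riemann sums over the wave numbers -/

/-- For both values of q the l-th wave number lies in the l-th cell of length 2π/N, at its left end
or its midpoint, so each sum is a tagged Riemann sum. -/
theorem abs_sum_mul_sub_integral_le {g : ℝ → ℝ} (hg : Continuous g) {N : ℕ} (hN : 0 < N)
    (q : ℤˣ) {η : ℝ}
    (hη : ∀ x ∈ Set.Icc 0 (2 * Real.pi), ∀ y ∈ Set.Icc 0 (2 * Real.pi),
      |x - y| ≤ 2 * Real.pi / N → |g x - g y| ≤ η) :
    |∑ l : Fin N, g (waveNumber N q l) * (2 * Real.pi / N) - ∫ k in (0 : ℝ)..(2 * Real.pi), g k|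
      ≤ η * (2 * Real.pi) := by
  have hpi := Real.pi_pos
  have hN' : (0 : ℝ) < N := by exact_mod_cast hN
  set p : ℕ → ℝ := fun i => 2 * Real.pi / N * i with hp
  have hstep : ∀ i, p (i + 1) - p i = 2 * Real.pi / N := fun i => by
    simp only [hp]; push_cast; ring
  have hle : ∀ i, p i ≤ p (i + 1) := fun i => by
    have := hstep i
    have : 0 < 2 * Real.pi / N := by positivity
    linarith
  have hp0 : p 0 = 0 := by simp [hp]
  have hpN : p N = 2 * Real.pi := by simp only [hp]; field_simp
  have hsum := intervalIntegral.sum_integral_adjacent_intervals (μ := MeasureTheory.volume)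
    (f := g) (a := p) (n := N) fun i _ => hg.intervalIntegrable _ _
  rw [hp0, hpN, ← Fin.sum_univ_eq_sum_range (fun i => ∫ x in p i..p (i + 1), g x)] at hsum
  rw [← hsum, ← Finset.sum_sub_distrib]
  refine (Finset.abs_sum_le_sum_abs _ _).trans ?_
  have hterm : ∀ l : Fin N, |g (waveNumber N q l) * (2 * Real.pi / N)
      - ∫ x in p l..p (l + 1), g x| ≤ η * (2 * Real.pi / N) := by
    intro l
    have hconst : g (waveNumber N q l) * (2 * Real.pi / N)
        = ∫ _ in p l..p (l + 1), g (waveNumber N q l) := by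
      rw [intervalIntegral.integral_const, hstep, smul_eq_mul, mul_comm]
    have ho : (offset q : ℝ) ≤ 1 := by exact_mod_cast offset_le_one q
    have ho0 : (0 : ℝ) ≤ offset q := by positivity
    have hk : waveNumber N q l = p l + offset q * (Real.pi / N) := by
      simp only [waveNumber, hp]; push_cast; ring
    have hpos : 0 < Real.pi / N := by positivity
    have hk1 : p l ≤ waveNumber N q l := by rw [hk]; nlinarith
    have hk2 : waveNumber N q l ≤ p (l + 1) := by
      have h1 := hstep l
      have h2 : 2 * Real.pi / N = 2 * (Real.pi / N) := by ring
      rw [hk]; nlinarith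
    have hlo : 0 ≤ p l := by simp only [hp]; positivity
    have hhi : p (l + 1) ≤ 2 * Real.pi := by
      rw [← hpN]
      simp only [hp]
      gcongr
      exact l.isLt
    rw [hconst, ← intervalIntegral.integral_sub (by simp) (hg.intervalIntegrable _ _)]
    have := intervalIntegral.norm_integral_le_of_norm_le_const (a := p l) (b := p (l + 1))
      (C := η) (f := fun x => g (waveNumber N q l) - g x) (by
        intro x hx
        rw [Set.uIoc_of_le (hle l)] at hx
        refine hη _ ⟨by linarith, by linarith⟩ _ ⟨by linarith [hx.1], by linarith [hx.2]⟩ ?_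
        have := hstep l
        rw [abs_le]
        constructor <;> linarith [hx.1, hx.2])
    rw [hstep, abs_of_pos (by positivity)] at this
    exact this
  refine (Finset.sum_le_sum fun l _ => hterm l).trans (le_of_eq ?_)
  rw [Finset.sum_const, Finset.card_univ, Fintype.card_fin, nsmul_eq_mul]
  field_simp

theorem tendsto_sum_waveNumber {g : ℝ → ℝ} (hg : Continuous g) (q : ℤˣ) :
    Tendsto (fun N : ℕ => (∑ l : Fin N, g (waveNumber N q l)) / (N : ℝ)) atTop
      (𝓝 ((∫ k in (0 : ℝ)..(2 * Real.pi), g k) / (2 * Real.pi))) := by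
  have hpi := Real.pi_pos
  rw [Metric.tendsto_atTop]
  intro η hη
  have huc : UniformContinuousOn g (Set.Icc 0 (2 * Real.pi)) :=
    isCompact_Icc.uniformContinuousOn_of_continuous hg.continuousOn
  rw [Metric.uniformContinuousOn_iff] at huc
  obtain ⟨d, hd, hgd⟩ := huc (η / 2) (by positivity)
  obtain ⟨N₀, hN₀⟩ := exists_nat_gt (2 * Real.pi / d)
  refine ⟨N₀ + 1, fun N hN => ?_⟩
  have hNpos : 0 < N := by omega
  have hN' : (0 : ℝ) < N := by exact_mod_cast hNpos
  have hNd : 2 * Real.pi / N < d := by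
    have h1 : (N₀ : ℝ) < N := by exact_mod_cast (by omega : N₀ < N)
    rw [div_lt_iff₀ hN']
    rw [div_lt_iff₀ hd] at hN₀
    nlinarith
  have hmain := abs_sum_mul_sub_integral_le hg hNpos q (η := η / 2) fun x hx y hy hxy =>
    (hgd x hx y hy (lt_of_le_of_lt hxy hNd)).le
  rw [← Finset.sum_mul] at hmain
  rw [Real.dist_eq]
  have hfac : (∑ l : Fin N, g (waveNumber N q l)) / (N : ℝ)
      - (∫ k in (0 : ℝ)..(2 * Real.pi), g k) / (2 * Real.pi)
      = ((∑ l : Fin N, g (waveNumber N q l)) * (2 * Real.pi / N)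
        - ∫ k in (0 : ℝ)..(2 * Real.pi), g k) / (2 * Real.pi) := by
    field_simp
  rw [hfac, abs_div, abs_of_pos (by positivity : 0 < 2 * Real.pi), div_lt_iff₀ (by positivity)]
  nlinarith

/-- The dispersion is symmetric under k ↦ 2π - k. -/
theorem integral_dispersion (n : ℕ) (φ : ℝ) :
    ∫ k in (0 : ℝ)..(2 * Real.pi), dispersion n φ k
      = 2 * ∫ k in (0 : ℝ)..Real.pi, dispersion n φ k := by
  have hc := continuous_dispersion n φ
  have hsymm : ∀ k, dispersion n φ (2 * Real.pi - k) = dispersion n φ k := by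
    intro k
    have : ((n : ℝ) + 2) * (2 * Real.pi - k)
        = ((n + 2 : ℕ) : ℝ) * (2 * Real.pi) - (n + 2) * k := by push_cast; ring
    rw [dispersion, this, Real.cos_nat_mul_two_pi_sub, dispersion]
  have hadd := intervalIntegral.integral_add_adjacent_intervals (a := 0) (b := Real.pi)
    (c := 2 * Real.pi) (hc.intervalIntegrable (μ := MeasureTheory.volume) _ _)
    (hc.intervalIntegrable _ _)
  have hsub := intervalIntegral.integral_comp_sub_left (a := 0) (b := Real.pi) (dispersion n φ)
    (2 * Real.pi)
  simp only [hsymm] at hsub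
  rw [sub_zero, show 2 * Real.pi - Real.pi = Real.pi by ring] at hsub
  linarith

/-! ### The energy density -/

/-- The ground state energy per site in the thermodynamic limit. -/
def energyDensity (n : ℕ) (J φ : ℝ) : ℝ :=
  -(J / Real.pi) * ∫ k in (0 : ℝ)..Real.pi, dispersion n φ k

theorem tendsto_level_div (n : ℕ) {J : ℝ} (hJ : 0 < J) (φ : ℝ) (q : ℤˣ) :
    Tendsto (fun N : ℕ => level N n J φ q ∅ / (N : ℝ)) atTop (𝓝 (energyDensity n J φ)) := by
  have hpi := Real.pi_pos
  have h := (tendsto_sum_waveNumber (continuous_dispersion n φ) q).const_mul (-J)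
  have hlim : -J * ((∫ k in (0 : ℝ)..(2 * Real.pi), dispersion n φ k) / (2 * Real.pi))
      = energyDensity n J φ := by
    rw [integral_dispersion, energyDensity]
    field_simp
  rw [hlim] at h
  refine h.congr fun N => ?_
  rw [level, Finset.sum_empty, zero_sub]
  simp only [halfGap_eq n hJ, ← Finset.mul_sum]
  ring

theorem card_selfModes_le (N : ℕ) (q : ℤˣ) : (selfModes N q).card ≤ 2 := by
  calc (selfModes N q).card ≤ ({0, N} : Finset ℕ).card := by
        refine Finset.card_le_card_of_injOn (fun l => 2 * l.val + offset q) ?_ ?_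
        · intro l hl
          simpa [selfModes] using hl
        · intro l _ l' _ h
          simp only at h
          exact Fin.ext (by omega)
    _ ≤ 2 := Finset.card_le_two

theorem tendsto_const_div_atTop_nat (x : ℝ) :
    Tendsto (fun N : ℕ => x / (N : ℝ)) atTop (𝓝 0) :=
  tendsto_const_nhds.div_atTop tendsto_natCast_atTop_atTop

/-- The pair sum differs from the ground level of F_q by at most two self-paired modes, each of
energy at most 2J, which is negligible after division by N. -/
theorem tendsto_sum_blockEnergy_div (n : ℕ) {J : ℝ} (hJ : 0 < J) (φ : ℝ) (q : ℤˣ) :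
    Tendsto (fun N : ℕ =>
      (∑ l ∈ pairModes N q, blockEnergy n J φ (waveNumber N q l)) / (N : ℝ)) atTop
      (𝓝 (energyDensity n J φ)) := by
  have hself : Tendsto (fun N : ℕ =>
      (∑ l ∈ selfModes N q, halfGap n J φ (waveNumber N q l)) / (N : ℝ)) atTop (𝓝 0) := by
    refine squeeze_zero (fun N => ?_) (fun N => ?_) (tendsto_const_div_atTop_nat (4 * J))
    · exact div_nonneg (Finset.sum_nonneg fun _ _ => halfGap_nonneg _ _ _ _) (Nat.cast_nonneg N)
    · gcongr
      have h1 : ∑ l ∈ selfModes N q, halfGap n J φ (waveNumber N q l)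
          ≤ (selfModes N q).card • (2 * J) := by
        refine Finset.sum_le_card_nsmul _ _ _ fun l _ => ?_
        rw [halfGap_eq n hJ]
        nlinarith [dispersion_le_two n φ (waveNumber N q l)]
      have h2 : ((selfModes N q).card : ℝ) ≤ 2 := by exact_mod_cast card_selfModes_le N q
      rw [nsmul_eq_mul] at h1
      nlinarith
  have h := (tendsto_level_div n hJ φ q).add hself
  rw [add_zero] at h
  refine h.congr fun N => ?_
  rw [sum_blockEnergy N n hJ, add_div]

theorem exists_groundEnergy_tendsto (n : ℕ) {J : ℝ} (hJ : 0 < J) (φ : ℝ) :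
    ∃ E : ℕ → ℝ, (∀ N : ℕ, n + 2 ≤ N → IsGroundEnergy (hamiltonian N n J φ) (E N)) ∧
      Tendsto (fun N : ℕ => E N / (N : ℝ)) atTop (𝓝 (energyDensity n J φ)) := by
  -- The size condition stays inside the existential so that a total sequence can be chosen; the
  -- value 0 for short chains is arbitrary.
  have hex : ∀ N : ℕ, ∃ E : ℝ, n + 2 ≤ N → IsGroundEnergy (hamiltonian N n J φ) E ∧
      E ≤ level N n J φ 1 ∅ + 4 * J ∧ ∃ q : ℤˣ, level N n J φ q ∅ ≤ E := by
    intro N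
    by_cases hN : n + 2 ≤ N
    · obtain ⟨E, hE⟩ := exists_isGroundEnergy_hamiltonian hN hJ φ
      exact ⟨E, fun _ => hE⟩
    · exact ⟨0, fun h => absurd h hN⟩
  choose E hE using hex
  refine ⟨E, fun N hN => (hE N hN).1, ?_⟩
  -- The sector of the ground state may vary with N, so the lower bound is the smaller of the two
  -- sector levels, which have the same density in the limit.
  have hlo := (tendsto_level_div n hJ φ 1).min (tendsto_level_div n hJ φ (-1))
  rw [min_self] at hlo
  have hhi := (tendsto_level_div n hJ φ 1).add (tendsto_const_div_atTop_nat (4 * J))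
  rw [add_zero] at hhi
  refine tendsto_of_tendsto_of_tendsto_of_le_of_le' hlo hhi ?_ ?_
  · filter_upwards [eventually_ge_atTop (n + 2)] with N hN
    obtain ⟨_, _, q, hq⟩ := hE N hN
    have hq' : level N n J φ q ∅ / (N : ℝ) ≤ E N / (N : ℝ) := by gcongr
    rcases Int.units_eq_one_or q with rfl | rfl
    · exact (min_le_left _ _).trans hq'
    · exact (min_le_right _ _).trans hq'
  · filter_upwards [eventually_ge_atTop (n + 2)] with N hN
    rw [← add_div]
    gcongr
    exact (hE N hN).2.1

/-! ### The gap in the thermodynamic limit -/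

/-- The lower bound is attained where cos((n+2)k) has the sign of sin 2φ and modulus 1: at k = 0, or
at k = π/(n+2) if sin 2φ is negative. The strict bound x < 1 later keeps ⌊xN⌋ a valid mode index. -/
theorem exists_dispersion_eq (n : ℕ) (φ : ℝ) : ∃ x : ℝ, 0 ≤ x ∧ x < 1 ∧
    dispersion n φ (2 * Real.pi * x) = √(1 - |Real.sin (2 * φ)|) := by
  have hn : (0 : ℝ) < n + 2 := by positivity
  rcases le_total 0 (Real.sin (2 * φ)) with h | h
  · refine ⟨0, le_rfl, zero_lt_one, ?_⟩
    simp [dispersion, abs_of_nonneg h]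
  · refine ⟨1 / (2 * (n + 2)), by positivity, ?_, ?_⟩
    · rw [div_lt_one (by positivity)]
      linarith [(Nat.cast_nonneg n : (0 : ℝ) ≤ n)]
    · have : ((n : ℝ) + 2) * (2 * Real.pi * (1 / (2 * (n + 2)))) = Real.pi := by
        field_simp
      rw [dispersion, this, Real.cos_pi, abs_of_nonpos h, neg_one_mul]

theorem exists_gap_tendsto (n : ℕ) {J : ℝ} (hJ : 0 < J) (φ : ℝ) (q : ℤˣ) :
    ∃ g : ℕ → ℝ,
      (∀ N : ℕ, n + 2 ≤ N →
        IsLeast (Set.range fun l : Fin N => -blockEnergy n J φ (waveNumber N q l)) (g N) ∧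
        HasGap (fermionHamiltonian N n J φ q) (g N)) ∧
      Tendsto g atTop (𝓝 (2 * J * √(1 - |Real.sin (2 * φ)|))) := by
  have hrange : ∀ N : ℕ, (Set.range fun l : Fin N => -blockEnergy n J φ (waveNumber N q l))
      = Set.range fun l : Fin N => 2 * halfGap n J φ (waveNumber N q l) := by
    intro N
    congr 1
    funext l
    rw [blockEnergy_eq n hJ, neg_neg]
  have hleast : ∀ N : ℕ, 0 < N →
      IsLeast (Set.range fun l : Fin N => 2 * halfGap n J φ (waveNumber N q l))
        (sInf (Set.range fun l : Fin N => 2 * halfGap n J φ (waveNumber N q l))) := by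
    intro N hN
    have hfin := Set.finite_range fun l : Fin N => 2 * halfGap n J φ (waveNumber N q l)
    have hne : (Set.range fun l : Fin N => 2 * halfGap n J φ (waveNumber N q l)).Nonempty :=
      ⟨_, ⟨⟨0, hN⟩, rfl⟩⟩
    exact ⟨hne.csInf_mem hfin, fun y hy => csInf_le hfin.bddBelow hy⟩
  refine ⟨fun N => sInf (Set.range fun l : Fin N => 2 * halfGap n J φ (waveNumber N q l)),
    fun N hN => ?_, ?_⟩
  · have h := hleast N (by omega)
    rw [hrange]
    exact ⟨h, hasGap_fermionHamiltonian hN J φ q h⟩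
  · obtain ⟨x, hx0, hx1, hx⟩ := exists_dispersion_eq n φ
    -- This is the wave number of the mode ⌊xN⌋, which tends to the minimizer 2πx and bounds the
    -- minimum from above.
    have hk : Tendsto (fun N : ℕ => 2 * Real.pi * ((⌊x * (N : ℝ)⌋₊ : ℝ) / (N : ℝ))
        + (offset q * Real.pi) / (N : ℝ)) atTop (𝓝 (2 * Real.pi * x)) := by
      have h1 := ((tendsto_nat_floor_mul_div_atTop hx0).comp
        (tendsto_natCast_atTop_atTop (R := ℝ))).const_mul (2 * Real.pi)
      have h2 := h1.add (tendsto_const_div_atTop_nat (offset q * Real.pi))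
      rw [add_zero] at h2
      exact h2
    have hup := (((continuous_dispersion n φ).tendsto _).comp hk).const_mul (2 * J)
    rw [hx] at hup
    refine tendsto_of_tendsto_of_tendsto_of_le_of_le' tendsto_const_nhds hup ?_ ?_
    · filter_upwards [eventually_gt_atTop 0] with N hN
      obtain ⟨l, hl⟩ := (hleast N hN).1
      rw [← hl]
      simp only [halfGap_eq n hJ]
      rw [mul_assoc]
      gcongr
      exact le_dispersion n φ _
    · filter_upwards [eventually_gt_atTop 0] with N hN
      have hN' : (0 : ℝ) < N := by exact_mod_cast hN
      have hlt : ⌊x * (N : ℝ)⌋₊ < N := by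
        rw [Nat.floor_lt (by positivity)]
        nlinarith
      refine ((hleast N hN).2 ⟨⟨_, hlt⟩, rfl⟩).trans (le_of_eq ?_)
      simp only [halfGap_eq n hJ, Function.comp, waveNumber]
      rw [mul_assoc]
      congr 3
      push_cast
      ring

end

end ClusterIsing

/-! ### Assembly of the theorem -/

theorem mainTheorem2 (n : ℕ) (hn : 1 ≤ n) (J : ℝ) (hJ : 0 < J) (φ : ℝ) :
    -- Jordan-Wigner transformation
    (∀ N : ℕ, n + 2 ≤ N →
      (∀ j : Fin N, (ClusterIsing.c j)ᴴ =
        ClusterIsing.jwString j * ClusterIsing.siteOp ClusterIsing.sigmaPlus j) ∧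
      (∀ i j : Fin N, ClusterIsing.c i * ClusterIsing.c j
        + ClusterIsing.c j * ClusterIsing.c i = 0) ∧
      (∀ i j : Fin N, ClusterIsing.c i * (ClusterIsing.c j)ᴴ
        + (ClusterIsing.c j)ᴴ * ClusterIsing.c i = if i = j then 1 else 0) ∧
      (∀ q : ℤˣ, Commute (ClusterIsing.fermionHamiltonian N n J φ q) (ClusterIsing.parity N)) ∧
      ClusterIsing.hamiltonian N n J φ =
        ClusterIsing.fermionHamiltonian N n J φ 1 * ClusterIsing.parityProj N 1
        + ClusterIsing.fermionHamiltonian N n J φ (-1) * ClusterIsing.parityProj N (-1)) ∧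
    -- Fourier transformation
    (∀ N : ℕ, n + 2 ≤ N → ∀ q : ℤˣ,
      (∀ l l' : Fin N,
        ClusterIsing.b N (ClusterIsing.waveNumber N q l)
            * ClusterIsing.b N (ClusterIsing.waveNumber N q l')
          + ClusterIsing.b N (ClusterIsing.waveNumber N q l')
            * ClusterIsing.b N (ClusterIsing.waveNumber N q l) = 0) ∧
      (∀ l l' : Fin N,
        ClusterIsing.b N (ClusterIsing.waveNumber N q l)
            * (ClusterIsing.b N (ClusterIsing.waveNumber N q l'))ᴴ
          + (ClusterIsing.b N (ClusterIsing.waveNumber N q l'))ᴴ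
            * ClusterIsing.b N (ClusterIsing.waveNumber N q l) = if l = l' then 1 else 0) ∧
      ClusterIsing.fermionHamiltonian N n J φ q =
        ∑ l ∈ ClusterIsing.pairModes N q,
          ClusterIsing.blockOp N n J φ (ClusterIsing.waveNumber N q l)
        + ∑ l ∈ ClusterIsing.selfModes N q,
          (ClusterIsing.epsilon n J φ (ClusterIsing.waveNumber N q l) : ℂ) •
            ((2 : ℂ) • ((ClusterIsing.b N (ClusterIsing.waveNumber N q l))ᴴ
              * ClusterIsing.b N (ClusterIsing.waveNumber N q l)) - 1)) ∧
    -- independence of the blocks: each acts as the four-level matrix on its own tensor factor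
    (∀ N : ℕ, n + 2 ≤ N → ∀ q : ℤˣ,
      ∃ e : OrthonormalBasis (ClusterIsing.BlockLabel N q) ℂ
          (EuclideanSpace ℂ (ClusterIsing.Config N)),
        ∀ (s : ↥(ClusterIsing.pairModes N q) → Fin 4)
          (t : ↥(ClusterIsing.selfModes N q) → Fin 2),
        (∀ l : ↥(ClusterIsing.pairModes N q),
          Matrix.toEuclideanLin
              ((ClusterIsing.b N (ClusterIsing.waveNumber N q l.1))ᴴ
                * ClusterIsing.b N (ClusterIsing.waveNumber N q l.1)) (e (s, t))
            = ClusterIsing.occPlus (s l) • e (s, t) ∧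
          Matrix.toEuclideanLin
              ((ClusterIsing.b N (-ClusterIsing.waveNumber N q l.1))ᴴ
                * ClusterIsing.b N (-ClusterIsing.waveNumber N q l.1)) (e (s, t))
            = ClusterIsing.occMinus (s l) • e (s, t) ∧
          Matrix.toEuclideanLin
              (ClusterIsing.blockOp N n J φ (ClusterIsing.waveNumber N q l.1)) (e (s, t))
            = ∑ a : Fin 4,
                ClusterIsing.blockMatrix n J φ (ClusterIsing.waveNumber N q l.1) a (s l) •
                  e (Function.update s l a, t)) ∧
        (∀ l : ↥(ClusterIsing.selfModes N q),
          Matrix.toEuclideanLin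
              ((ClusterIsing.b N (ClusterIsing.waveNumber N q l.1))ᴴ
                * ClusterIsing.b N (ClusterIsing.waveNumber N q l.1)) (e (s, t))
            = (((t l).val : ℕ) : ℂ) • e (s, t))) ∧
    -- ground state energy and gap of a block
    (∀ k : ℝ,
      (ClusterIsing.blockMatrix n J φ k).IsHermitian ∧
      ClusterIsing.IsGroundEnergy (ClusterIsing.blockMatrix n J φ k)
        (-2 * Real.sqrt (ClusterIsing.epsilon n J φ k ^ 2 + ClusterIsing.delta n J φ k ^ 2)) ∧
      -2 * Real.sqrt (ClusterIsing.epsilon n J φ k ^ 2 + ClusterIsing.delta n J φ k ^ 2)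
        = ClusterIsing.blockEnergy n J φ k ∧
      ClusterIsing.HasGap (ClusterIsing.blockMatrix n J φ k)
        (-ClusterIsing.blockEnergy n J φ k)) ∧
    -- ground state energy of the fermionic Hamiltonian
    (∀ N : ℕ, n + 2 ≤ N → ∀ q : ℤˣ,
      ClusterIsing.IsGroundEnergy (ClusterIsing.fermionHamiltonian N n J φ q)
        (∑ l ∈ ClusterIsing.pairModes N q,
            ClusterIsing.blockEnergy n J φ (ClusterIsing.waveNumber N q l)
          - ∑ l ∈ ClusterIsing.selfModes N q,
            |ClusterIsing.epsilon n J φ (ClusterIsing.waveNumber N q l)|)) ∧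
    -- energy density, as the limit of the sum over the blocks and of the spin chain itself
    (∀ q : ℤˣ, Tendsto
      (fun N : ℕ => (∑ l ∈ ClusterIsing.pairModes N q,
        ClusterIsing.blockEnergy n J φ (ClusterIsing.waveNumber N q l)) / (N : ℝ)) atTop
      (𝓝 (-(J / Real.pi) * ∫ k in (0 : ℝ)..Real.pi,
        Real.sqrt (1 - Real.cos ((n + 2) * k) * Real.sin (2 * φ))))) ∧
    (∃ E : ℕ → ℝ,
      (∀ N : ℕ, n + 2 ≤ N →
        ClusterIsing.IsGroundEnergy (ClusterIsing.hamiltonian N n J φ) (E N)) ∧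
      Tendsto (fun N : ℕ => E N / (N : ℝ)) atTop
        (𝓝 (-(J / Real.pi) * ∫ k in (0 : ℝ)..Real.pi,
          Real.sqrt (1 - Real.cos ((n + 2) * k) * Real.sin (2 * φ))))) ∧
    -- gap of the fermionic Hamiltonian and its thermodynamic limit
    (∀ q : ℤˣ, ∃ g : ℕ → ℝ,
      (∀ N : ℕ, n + 2 ≤ N →
        IsLeast (Set.range fun l : Fin N =>
          -ClusterIsing.blockEnergy n J φ (ClusterIsing.waveNumber N q l)) (g N) ∧
        ClusterIsing.HasGap (ClusterIsing.fermionHamiltonian N n J φ q) (g N)) ∧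
      Tendsto g atTop (𝓝 (2 * J * Real.sqrt (1 - |Real.sin (2 * φ)|)))) ∧
    -- the critical point and the critical modes
    (0 ≤ φ → φ ≤ Real.pi / 2 →
      (2 * J * Real.sqrt (1 - |Real.sin (2 * φ)|) = 0 ↔ φ = Real.pi / 4) ∧
      (∀ k : ℝ, 0 ≤ k → k < 2 * Real.pi →
        (ClusterIsing.HasGap (ClusterIsing.blockMatrix n J φ k) 0 ↔
          φ = Real.pi / 4 ∧ ∃ j : ℕ, j ≤ n + 1 ∧ k = 2 * j * Real.pi / (n + 2)))) := by
  refine ⟨fun N hN => ⟨fun j => ?_, ClusterIsing.c_anticomm, ClusterIsing.c_anticomm_conjTranspose,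
      fun q => ClusterIsing.fermionHamiltonian_commute_parity n J φ q,
      ClusterIsing.hamiltonian_eq hN J φ⟩,
    fun N hN q => ⟨(ClusterIsing.isCAR_mode N q).anti, (ClusterIsing.isCAR_mode N q).anti_star,
      ClusterIsing.fermionHamiltonian_eq_sum_blockOp hN J φ q⟩,
    fun N _ q => ClusterIsing.exists_productBasis N n J φ q,
    fun k => ⟨ClusterIsing.blockMatrix_isHermitian n J φ k, ?_, ?_, ?_⟩,
    fun N hN q => ?_,
    fun q => ClusterIsing.tendsto_sum_blockEnergy_div n hJ φ q,
    ClusterIsing.exists_groundEnergy_tendsto n hJ φ,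
    fun q => ClusterIsing.exists_gap_tendsto n hJ φ q,
    fun h0 h1 => ⟨ClusterIsing.limitGap_eq_zero_iff hJ h0 h1, fun k hk0 hk1 => ?_⟩⟩
  · rw [ClusterIsing.c_conjTranspose, ClusterIsing.jwString_eq, ClusterIsing.jw]
  · rw [neg_mul]
    exact ClusterIsing.isGroundEnergy_blockMatrix n J φ k
  · rw [ClusterIsing.blockEnergy_eq n hJ, neg_mul, ClusterIsing.halfGap]
  · rw [ClusterIsing.blockEnergy_eq n hJ, neg_neg]
    exact ClusterIsing.hasGap_blockMatrix n J φ k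
  · rw [ClusterIsing.sum_blockEnergy_sub N n hJ]
    exact ClusterIsing.isGroundEnergy_fermionHamiltonian hN J φ q
  · rw [ClusterIsing.hasGap_blockMatrix_zero_iff, ClusterIsing.halfGap_eq n hJ,
      mul_eq_zero_iff_left hJ.ne']
    exact ClusterIsing.dispersion_eq_zero_iff_critical n h0 h1 hk0 hk1
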